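/- **Setting.** Let $\Bbbk$ be an algebraically closed field of characteristic $0$. For $N\ge 1$ let $SO_N$ be the special orthogonal group of the quadratic form $\sum x_i^2$ on $\Bbbk^N$, acting on its Lie algebra $\mathfrak{so}_N$ by conjugation. For a partition $\mu$ of $N$ let $\mathcal O(\mu)\subset\mathfrak{so}_N$ be the set of nilpotent elements whose Jordan blocks have sizes $\mu$. Let $G=SO_N$, $\mathfrak g=\mathfrak{so}_N$, let $H\subset G$ be a semisimple subgroup with Lie algebra $\mathfrak h$, let $\mathfrak m=\mathfrak h^\perp$ with respect to the Killing form of $\mathfrak g$, so that $\mathfrak g=\mathfrak h\oplus\mathfrak m$, and let $\varphi:\mathfrak g\to\mathfrak h$ be the corresponding projection. A nilpotent $G$-orbit $\mathcal O$ is *good* for $H$ if $\overline{\mathcal O}\cap\mathfrak m=\{0\}$ (Zariski closure). If $H$ has a dense orbit in $\mathcal O$, this (unique) $H$-orbit is denoted by $\Omega_{\mathcal O}$. The *height* of a nilpotent $G$-orbit is $\operatorname{ht}(G\cdot e)=\max\{d\mid(\operatorname{ad}_{\mathfrak g}e)^d\neq0\}$. **Proposition.** (i) Let $k\ge2$, $m\ge0$,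 $N=4k+m$, $G=SO_N$, and let $H=SO_{N-1}$ be embedded in the standard way (as the block matrices $\operatorname{diag}(g,1)$). If $m>0$, then $\mathcal O(2^{2k},1^m)$ is a single $G$-orbit; if $m=0$, then $\mathcal O(2^{2k})$ is the union of exactly two $G$-orbits $\mathcal O(2^{2k})_{\mathsf I}$ and $\mathcal O(2^{2k})_{\mathsf{II}}$. Let $\mathcal O$ be any of these $G$-orbits. Then $\mathcal O$ is good for $H$, $H$ has a unique dense orbit $\Omega_{\mathcal O}$ in $\mathcal O$, and $$\varphi(\Omega_{\mathcal O})=\mathcal O(3,2^{2k-2},1^m)\subset\mathfrak{so}_{N-1}$$ (in particular, both orbits for $m=0$ have the same projection). Moreover $\tilde{\mathcal O}:=SO_N\cdot\varphi(\Omega_{\mathcal O})=\mathcal O(3,2^{2k-2},1^{m+1})$, $\operatorname{ht}(\mathcal O)=2$ and $\operatorname{ht}(\tilde{\mathcal O})=3$. (ii) Let $G=SO_7$ and let $H=\mathsf G_2\subset SO_7$ be the automorphism group of the octonions acting on the imaginary octonions, with Lie algebra $\mathfrak g_2$ (the derivations of the octonions). Let $\mathcal O=\mathcal O(3,1^4)\subset\mathfrak{so}_7$.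 Then $\mathcal O$ is a single $G$-orbit, it is good for $H$, $H$ has a unique dense orbit $\Omega_{\mathcal O}$ in $\mathcal O$, and $\varphi(\Omega_{\mathcal O})$ is the subregular nilpotent orbit of $\mathfrak g_2$, i.e. the dense $\mathsf G_2$-orbit in the complement of the dense (regular) orbit of the nilpotent cone of $\mathfrak g_2$. Moreover $\tilde{\mathcal O}:=SO_7\cdot\varphi(\Omega_{\mathcal O})=\mathcal O(3,3,1)$, $\operatorname{ht}(\mathcal O)=2$ and $\operatorname{ht}(\tilde{\mathcal O})=4$. -/

import Mathlib

open Matrix LieAlgebra.Orthogonal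

/- Matrices form a Lie ring under the commutator. -/
attribute [local instance] LieRing.ofAssociativeRing

namespace OrbitProj

universe u

/-! ### The group `SO_N` acting on its Lie algebra `so_N` -/

/-- The group `SO_N` of the standard quadratic form `∑ xᵢ²` on `K^N`. -/
abbrev SO (K : Type u) [Field K] (N : ℕ) : Submonoid (Matrix (Fin N) (Fin N) K) :=
  Matrix.specialOrthogonalGroup (Fin N) K

/-- The Lie algebra `so_N` of skew-symmetric `N × N` matrices. -/
abbrev soLie (K : Type u) [Field K] (N : ℕ) : LieSubalgebra K (Matrix (Fin N) (Fin N) K) :=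
  so (Fin N) K

section

variable {K : Type u} [Field K] {N : ℕ}

theorem SO_transpose_mul (g : SO K N) : (g : Matrix (Fin N) (Fin N) K)ᵀ * g.1 = 1 :=
  (Matrix.mem_orthogonalGroup_iff' _ _).1 (Matrix.mem_specialOrthogonalGroup_iff.1 g.2).1

theorem mem_SO_iff (A : Matrix (Fin N) (Fin N) K) :
    A ∈ SO K N ↔ Aᵀ * A = 1 ∧ A.det = 1 :=
  Matrix.mem_specialOrthogonalGroup_iff.trans
    (and_congr_left fun _ => Matrix.mem_orthogonalGroup_iff' _ _)

/-- The adjoint action `x ↦ g x g⁻¹` of `SO_N` on `so_N` (note `g⁻¹ = gᵀ`). -/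
def Ad (g : SO K N) (x : soLie K N) : soLie K N :=
  ⟨g.1 * x.1 * g.1ᵀ, by
    have hx := (mem_so (Fin N) K x.1).1 x.2
    rw [mem_so]
    simp [Matrix.transpose_mul, hx, Matrix.mul_assoc]⟩

/-- The orbit of `x ∈ so_N` under a subgroup `H ⊆ SO_N`. -/
def adOrbit (H : Subgroup (SO K N)) (x : soLie K N) : Set (soLie K N) :=
  {y | ∃ g ∈ H, y = Ad g x}

/-- `S` is an `H`-orbit in `so_N`. -/
def IsOrbit (H : Subgroup (SO K N)) (S : Set (soLie K N)) : Prop :=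
  ∃ x, S = adOrbit H x

/-- The saturation `SO_N · S` of a subset `S ⊆ so_N`. -/
def saturation (S : Set (soLie K N)) : Set (soLie K N) :=
  {y | ∃ g : SO K N, ∃ x ∈ S, y = Ad g x}

end

/-! ### Zariski closure and dense orbits -/

section

variable {K : Type u} [Field K]

/-- The algebra of polynomial functions on a `K`-vector space: the algebra of functions generated
by the linear forms. -/
def polyFun (K : Type u) [Field K] (V : Type*) [AddCommGroup V] [Module K V] :
    Subalgebra K (V → K) :=
  Algebra.adjoin K (Set.range fun (f : Module.Dual K V) (v : V) => f v)

/-- The Zariski closure of a subset of a vector space. -/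
def zariskiClosure (K : Type u) [Field K] {V : Type*} [AddCommGroup V] [Module K V] (S : Set V) :
    Set V :=
  {x | ∀ p ∈ polyFun K V, (∀ y ∈ S, p y = 0) → p x = 0}

/-- `Ω` is an `H`-orbit contained in `X` and Zariski dense in `X`. -/
def IsDenseOrbit {N : ℕ} (H : Subgroup (SO K N)) (Ω X : Set (soLie K N)) : Prop :=
  IsOrbit H Ω ∧ Ω ⊆ X ∧ X ⊆ zariskiClosure K Ω

/-- The nilpotent cone `𝒩(𝔥) = 𝒩(so_N) ∩ 𝔥` of a subalgebra `𝔥 ⊆ so_N`. -/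
def nilCone {N : ℕ} (𝔥 : LieSubalgebra K (soLie K N)) : Set (soLie K N) :=
  {x | x ∈ 𝔥 ∧ IsNilpotent x.1}

/-- `S` is the subregular nilpotent orbit of `(H, 𝔥)`: there is a dense (regular) orbit `R` in the
nilpotent cone of `𝔥`, and `S` is a dense orbit in the complement of `R` in this cone. -/
def IsSubregularOrbit {N : ℕ} (H : Subgroup (SO K N)) (𝔥 : LieSubalgebra K (soLie K N))
    (S : Set (soLie K N)) : Prop :=
  ∃ R, IsDenseOrbit H R (nilCone 𝔥) ∧ IsDenseOrbit H S (nilCone 𝔥 \ R)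

/-! ### Partitions and heights -/

/-- The matrix `x` is nilpotent with Jordan blocks of sizes `μ₀, μ₁, …`: there is a basis
`b (i, j)`, `0 ≤ j < μᵢ`, with `x b(i, 0) = 0` and `x b(i, j + 1) = b(i, j)`. -/
def HasJordanType {N : ℕ} (x : Matrix (Fin N) (Fin N) K) (μ : List ℕ) : Prop :=
  ∃ b : Module.Basis (Σ i : Fin μ.length, Fin (μ.get i)) K (Fin N → K),
    ∀ (i : Fin μ.length) (j : Fin (μ.get i)),
      x *ᵥ b ⟨i, j⟩ =
        if j.1 = 0 then 0 else b ⟨i, ⟨j.1 - 1, lt_of_le_of_lt (Nat.sub_le _ _) j.2⟩⟩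

/-- `𝒪(μ) ⊆ so_N`: the elements of `so_N` that are nilpotent with Jordan type `μ`. -/
def nilOrbit (K : Type u) [Field K] (N : ℕ) (μ : List ℕ) : Set (soLie K N) :=
  {x | HasJordanType x.1 μ}

/-- The set `S ⊆ so_N` is nonempty and every `e ∈ S` has height
`max {d | (ad e)^d ≠ 0} = h`, where `ad e` is taken in `so_N`. -/
def HasHeight {N : ℕ} (S : Set (soLie K N)) (h : ℕ) : Prop :=
  S.Nonempty ∧ ∀ e ∈ S, IsGreatest {d : ℕ | (LieAlgebra.ad K (soLie K N) e) ^ d ≠ 0} h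

/-! ### The isotropy complement -/

/-- `𝔪 = 𝔥^⊥`, the orthogonal complement with respect to the Killing form of `so_N`. -/
noncomputable def isotropy {N : ℕ} (𝔥 : LieSubalgebra K (soLie K N)) :
    Submodule K (soLie K N) :=
  LinearMap.BilinForm.orthogonal (killingForm K (soLie K N)) 𝔥.toSubmodule

/-- The pair formed by the subgroup with Lie algebra `𝔥` and the orbit `O` is good:
the Zariski closure of `O` meets `𝔪` only in `0`. -/
def IsGood {N : ℕ} (𝔥 : LieSubalgebra K (soLie K N)) (O : Set (soLie K N)) : Prop :=
  zariskiClosure K O ∩ (isotropy 𝔥 : Set (soLie K N)) = {0}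

end

/-! ### The standard embedding `SO_n ⊆ SO_{n+1}` -/

section

variable {K : Type u} [Field K] {n : ℕ}

/-- The block diagonal matrix `diag(A, c)` of size `n + 1`. -/
def extend (A : Matrix (Fin n) (Fin n) K) (c : K) : Matrix (Fin (n + 1)) (Fin (n + 1)) K :=
  Matrix.reindex finSumFinEquiv finSumFinEquiv
    (Matrix.fromBlocks A 0 0 (Matrix.diagonal fun _ : Fin 1 => c))

theorem extend_mul (A B : Matrix (Fin n) (Fin n) K) (c d : K) :
    extend A c * extend B d = extend (A * B) (c * d) := by
  simp [extend, Matrix.submatrix_mul_equiv, Matrix.fromBlocks_multiply]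

theorem extend_transpose (A : Matrix (Fin n) (Fin n) K) (c : K) :
    (extend A c)ᵀ = extend Aᵀ c := by
  simp [extend, Matrix.transpose_submatrix, Matrix.fromBlocks_transpose]

theorem extend_one : extend (1 : Matrix (Fin n) (Fin n) K) 1 = 1 := by
  simp [extend]

theorem extend_det (A : Matrix (Fin n) (Fin n) K) (c : K) :
    (extend A c).det = A.det * c := by
  simp [extend, Matrix.det_submatrix_equiv_self, Matrix.det_fromBlocks_zero₂₁]

/-- `SO_n → SO_{n+1}`, `g ↦ diag(g, 1)`. -/
def stdGroupHom (K : Type u) [Field K] (n : ℕ) : SO K n →* SO K (n + 1) where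
  toFun g := ⟨extend g.1 1, by
    rw [mem_SO_iff, extend_transpose, extend_mul, extend_det, SO_transpose_mul]
    refine ⟨by simp [extend_one], ?_⟩
    rw [((mem_SO_iff g.1).1 g.2).2, mul_one]⟩
  map_one' := Subtype.ext extend_one
  map_mul' g h := Subtype.ext <| by
    change extend (g.1 * h.1) 1 = extend g.1 1 * extend h.1 1
    rw [extend_mul, mul_one]

/-- `so_n → so_{n+1}`, `x ↦ diag(x, 0)`. -/
def stdLieHom (K : Type u) [Field K] (n : ℕ) : soLie K n →ₗ⁅K⁆ soLie K (n + 1) where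
  toFun x := ⟨extend x.1 0, by
    rw [mem_so, extend_transpose, (mem_so (Fin n) K x.1).1 x.2]
    ext i j
    obtain ⟨i, rfl⟩ := finSumFinEquiv.surjective i
    obtain ⟨j, rfl⟩ := finSumFinEquiv.surjective j
    rcases i with i | i <;> rcases j with j | j <;> simp [extend]⟩
  map_add' x y := Subtype.ext <| by
    change extend (x.1 + y.1) 0 = extend x.1 0 + extend y.1 0
    ext i j
    obtain ⟨i, rfl⟩ := finSumFinEquiv.surjective i
    obtain ⟨j, rfl⟩ := finSumFinEquiv.surjective j
    rcases i with i | i <;> rcases j with j | j <;> simp [extend]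
  map_smul' c x := Subtype.ext <| by
    change extend (c • x.1) 0 = c • extend x.1 0
    ext i j
    obtain ⟨i, rfl⟩ := finSumFinEquiv.surjective i
    obtain ⟨j, rfl⟩ := finSumFinEquiv.surjective j
    rcases i with i | i <;> rcases j with j | j <;> simp [extend]
  map_lie' {x y} := Subtype.ext <| by
    change extend (x.1 * y.1 - y.1 * x.1) 0
      = extend x.1 0 * extend y.1 0 - extend y.1 0 * extend x.1 0
    rw [extend_mul, extend_mul]
    ext i j
    obtain ⟨i, rfl⟩ := finSumFinEquiv.surjective i
    obtain ⟨j, rfl⟩ := finSumFinEquiv.surjective j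
    rcases i with i | i <;> rcases j with j | j <;> simp [extend]

/-- `SO_n` as a subgroup of `SO_{n+1}`. -/
def stdSO (K : Type u) [Field K] (n : ℕ) : Subgroup (SO K (n + 1)) := (stdGroupHom K n).range

/-- `so_n` as a subalgebra of `so_{n+1}`. -/
def stdso (K : Type u) [Field K] (n : ℕ) : LieSubalgebra K (soLie K (n + 1)) :=
  (stdLieHom K n).range

end

/-! ### The group `G₂ ⊆ SO_7` -/

section

variable {K : Type u} [Field K]

/-- The seven-dimensional cross product, i.e. the multiplication of imaginary octonions followed by
the projection to the imaginary part: the bilinear alternating map on `K^7` with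
`eᵢ × eᵢ₊₁ = eᵢ₊₃`, `eᵢ₊₁ × eᵢ₊₃ = eᵢ`, `eᵢ₊₃ × eᵢ = eᵢ₊₁` (indices modulo `7`). -/
def cross7 (x y : Fin 7 → K) : Fin 7 → K := fun i =>
  (x (i + 1) * y (i + 3) - x (i + 3) * y (i + 1)) +
  (x (i + 2) * y (i + 6) - x (i + 6) * y (i + 2)) +
  (x (i + 4) * y (i + 5) - x (i + 5) * y (i + 4))

theorem cross7_add_left (x y z : Fin 7 → K) : cross7 (x + y) z = cross7 x z + cross7 y z := by
  funext i; simp only [cross7, Pi.add_apply]; ring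

theorem cross7_add_right (x y z : Fin 7 → K) : cross7 x (y + z) = cross7 x y + cross7 x z := by
  funext i; simp only [cross7, Pi.add_apply]; ring

theorem cross7_sub_left (x y z : Fin 7 → K) : cross7 (x - y) z = cross7 x z - cross7 y z := by
  funext i; simp only [cross7, Pi.sub_apply]; ring

theorem cross7_sub_right (x y z : Fin 7 → K) : cross7 x (y - z) = cross7 x y - cross7 x z := by
  funext i; simp only [cross7, Pi.sub_apply]; ring

theorem cross7_smul_left (c : K) (x y : Fin 7 → K) : cross7 (c • x) y = c • cross7 x y := by
  funext i; simp only [cross7, Pi.smul_apply, smul_eq_mul]; ring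

theorem cross7_smul_right (c : K) (x y : Fin 7 → K) : cross7 x (c • y) = c • cross7 x y := by
  funext i; simp only [cross7, Pi.smul_apply, smul_eq_mul]; ring

/-- `G₂` as the automorphism group of the octonions, acting on imaginary octonions: the subgroup of
`SO_7` preserving the cross product. -/
def G2 (K : Type u) [Field K] : Subgroup (SO K 7) where
  carrier := {g | ∀ x y, g.1 *ᵥ cross7 x y = cross7 (g.1 *ᵥ x) (g.1 *ᵥ y)}
  one_mem' := by
    intro x y
    change (1 : Matrix (Fin 7) (Fin 7) K) *ᵥ _ = cross7 ((1 : Matrix (Fin 7) (Fin 7) K) *ᵥ x)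
      ((1 : Matrix (Fin 7) (Fin 7) K) *ᵥ y)
    simp
  mul_mem' := by
    intro g h hg hh x y
    change (g.1 * h.1) *ᵥ _ = cross7 ((g.1 * h.1) *ᵥ x) ((g.1 * h.1) *ᵥ y)
    simp only [← Matrix.mulVec_mulVec]
    rw [hh x y, hg]
  inv_mem' := by
    intro g hg x y
    have h1 : g.1 * (g⁻¹).1 = 1 := congrArg Subtype.val (mul_inv_cancel g)
    have h2 : (g⁻¹).1 * g.1 = 1 := congrArg Subtype.val (inv_mul_cancel g)
    have := hg ((g⁻¹).1 *ᵥ x) ((g⁻¹).1 *ᵥ y)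
    simp only [Matrix.mulVec_mulVec, h1, Matrix.one_mulVec] at this
    rw [← this, Matrix.mulVec_mulVec, h2, Matrix.one_mulVec]

/-- The Lie algebra of `G₂`: the elements of `so_7` that are derivations of the cross product. -/
def g2 (K : Type u) [Field K] : LieSubalgebra K (soLie K 7) where
  carrier := {D | ∀ x y, D.1 *ᵥ cross7 x y = cross7 (D.1 *ᵥ x) y + cross7 x (D.1 *ᵥ y)}
  zero_mem' := by
    intro x y
    have h : ∀ z : Fin 7 → K, cross7 0 z = 0 := fun z => by funext i; simp [cross7]
    have h' : ∀ z : Fin 7 → K, cross7 z 0 = 0 := fun z => by funext i; simp [cross7]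
    simp [h, h']
  add_mem' := by
    intro C D hC hD x y
    change (C.1 + D.1) *ᵥ _ = cross7 ((C.1 + D.1) *ᵥ x) y + cross7 x ((C.1 + D.1) *ᵥ y)
    simp only [Matrix.add_mulVec, cross7_add_left, cross7_add_right, hC x y, hD x y]
    abel
  smul_mem' := by
    intro c D hD x y
    change (c • D.1) *ᵥ _ = cross7 ((c • D.1) *ᵥ x) y + cross7 x ((c • D.1) *ᵥ y)
    simp only [Matrix.smul_mulVec, cross7_smul_left, cross7_smul_right, hD x y, smul_add]
  lie_mem' := by
    intro C D hC hD x y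
    change (C.1 * D.1 - D.1 * C.1) *ᵥ _ = cross7 ((C.1 * D.1 - D.1 * C.1) *ᵥ x) y
      + cross7 x ((C.1 * D.1 - D.1 * C.1) *ᵥ y)
    simp only [Matrix.sub_mulVec, ← Matrix.mulVec_mulVec, cross7_sub_left, cross7_sub_right]
    rw [hD x y, hC x y, Matrix.mulVec_add, Matrix.mulVec_add]
    rw [hC, hC, hD, hD]
    abel

end

end OrbitProj

/-! The nilpotent orbits of `SO_N` on `so_N` in question are described by equations and ranks, and
the projections are computed in coordinates.

**Conjugacy.** Elements of `so_N` of the same Jordan type are conjugate by some invertible `h`, and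
`h` may be replaced by its orthogonal polar part (`exists_orthogonal_conj`), since over an
algebraically closed field of characteristic zero `hᵀ h` has a square root which is a polynomial in
`hᵀ h` (`exists_aeval_sq_eq`). So a Jordan type is a single orbit of `O_N`. It is a single orbit of
`SO_N` if some orthogonal matrix of determinant `-1` commutes with an element; this happens as soon
as the kernel contains a nonisotropic vector, and always for odd `N`. For type `(2^{2k})` and
`N = 4k` all orthogonal matrices commuting with an element have determinant one
(`det_eq_one_of_commute`), which gives exactly two orbits.

**The orthogonal case.** Let `v` be the last basis vector, fixed by `SO_n`. Projecting `e` to `so_n`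
is taking its upper left block `x`, and `e` is recovered from `x` and `u = e v`. By
`sq_eq_zero_iff`, `e² = 0` means `x² = u uᵀ`, `x u = 0` and `⟨u, u⟩ = 0`. If `x = 0`, then `u = 0`:
this is goodness, because `e² = 0` holds on the closure of the orbit. If `u ≠ 0`, then `x` has one
block of size three and the same rank as `e`, so that it has type `(3, 2^{2k-2}, 1^m)`
(`block_mem_nilOrbit`), and all elements of this type arise (`exists_block_eq`). As `x` determines
`u` up to sign, the elements with `u ≠ 0` in a given `SO_{n+1}`-orbit form one `SO_n`-orbit; it is
dense since conjugation by a unipotent one-parameter group moves any other element out of the locus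
`u = 0` (`isDenseOrbit_openPart`). The heights are read off from the expansion of `(ad e)^d z` on
bivectors `z = a ∧ b`.

**The octonionic case.** The derivations of the octonions are cut out in `so_7` by seven linear
forms (`mem_g2_iff`), and the complement consists of the cross products with a vector. The elements
of type `(3, 1⁴)` are the bivectors `a ∧ b` with `a ≠ 0` isotropic and `b` a unit vector orthogonal
to `a`; the Plücker relations hold on the closure and exclude nonzero cross products (`isGood_g2`).
A square root of `-1` provides split coordinates, in which `SL₃` and two families of unipotent
automorphisms are visible. They suffice to prove that `G₂` is transitive on nonzero isotropic
vectors and on the bivectors `a ∧ b` for which `a × b` is not a multiple of `a`; the latter form the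
dense orbit (`isDenseOrbit_openOrbit`).

For the identification of the projected orbit, every nilpotent element of `𝔤₂` is conjugated into
the nilradical of a Borel subalgebra (`exists_conj_nilSo`), by finding an isotropic vector in its
kernel and treating the remaining part as a nilpotent matrix of smaller size. If both coordinates
along the simple roots are nonzero, the other coordinates can be removed, so that all these elements
form one orbit (`nilSo_mem_regular`), which is dense. If one of the two vanishes, the element is in
the closure of the projected orbit, because it is the projection of some `a ∧ b` with `a` isotropic
and orthogonal to `b`, and such bivectors are limits of rescaled elements of the dense orbit
(`nilSo_mem_zariskiClosure`). The elements of the projected orbit have vanishing cube, so they are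
not regular; hence the orbit is subregular. They are of type `(3, 3, 1)`, which has height four. -/

namespace OrbitProj

universe u

/-! ### Conjugacy of skew-symmetric matrices under the orthogonal group -/

section SquareRoot

open Polynomial

/-- Over an algebraically closed field of characteristic zero, `X` is a square modulo every
polynomial that does not vanish at `0`. Modulo the radical this is interpolation of square roots at
the roots; Newton iteration lifts the solution along the nilpotent thickening. -/
theorem exists_dvd_sq_sub_X {K : Type*} [Field K] [IsAlgClosed K] [CharZero K] (f : K[X])
    (hf : f.eval 0 ≠ 0) : ∃ q : K[X], f ∣ q ^ 2 - X := by
  classical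
  have hf0 : f ≠ 0 := by rintro rfl; simp at hf
  choose sq hsq using fun a : K => IsAlgClosed.exists_pow_nat_eq a (n := 2) (by norm_num)
  let p : K[X] := Lagrange.interpolate f.roots.toFinset id sq
  have hp : ∀ a ∈ f.roots.toFinset, p.eval a = sq a := fun a ha =>
    Lagrange.eval_interpolate_at_node sq Function.injective_id.injOn ha
  have hdvd : f ∣ (p ^ 2 - X) ^ (f.natDegree) := by
    by_cases hq : p ^ 2 - X = 0
    · rcases Nat.eq_zero_or_pos f.natDegree with h | h
      · rw [h, pow_zero]
        exact (Polynomial.isUnit_iff_degree_eq_zero.2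
          (by rw [Polynomial.degree_eq_natDegree hf0, h]; rfl)).dvd
      · rw [hq, zero_pow h.ne']; exact dvd_zero _
    · rw [(IsAlgClosed.splits f).dvd_iff_roots_le_roots hf0 (pow_ne_zero _ hq),
        Multiset.le_iff_count]
      intro a
      by_cases ha : a ∈ f.roots
      · rw [Polynomial.roots_pow, Multiset.count_nsmul]
        have h1 : 1 ≤ (p ^ 2 - X).roots.count a := by
          rw [Multiset.one_le_count_iff_mem, Polynomial.mem_roots hq]
          simp [hp a (by simpa using ha), hsq]
        calc f.roots.count a ≤ Multiset.card f.roots := Multiset.count_le_card _ _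
          _ ≤ f.natDegree := f.card_roots'
          _ ≤ f.natDegree * _ := Nat.le_mul_of_pos_right _ h1
      · rw [Multiset.count_eq_zero_of_notMem ha]; exact Nat.zero_le _
  let S := AdjoinRoot f
  let x : S := AdjoinRoot.mk f p
  let s : S := AdjoinRoot.root f
  have hs : IsUnit s := by
    have : IsCoprime (X : K[X]) f := by
      refine (Polynomial.irreducible_X.coprime_iff_not_dvd).2 ?_
      rwa [Polynomial.X_dvd_iff, Polynomial.coeff_zero_eq_eval_zero]
    obtain ⟨a, b, hab⟩ := this
    refine IsUnit.of_mul_eq_one (AdjoinRoot.mk f a) ?_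
    have := congrArg (AdjoinRoot.mk f) hab
    simpa [mul_comm, s] using this
  have hnil : IsNilpotent (x ^ 2 - s) := by
    refine ⟨f.natDegree, ?_⟩
    have : AdjoinRoot.mk f ((p ^ 2 - X) ^ f.natDegree) = 0 := AdjoinRoot.mk_eq_zero.2 hdvd
    simpa [x, s] using this
  have hxu : IsUnit x := by
    have : IsUnit (x ^ 2) := by
      have := hnil.isUnit_add_left_of_commute hs (Commute.all _ _)
      simpa using this
    exact (isUnit_pow_iff two_ne_zero).1 this
  obtain ⟨r, ⟨-, hr⟩, -⟩ := Polynomial.existsUnique_nilpotent_sub_and_aeval_eq_zero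
    (P := (X ^ 2 - C s : S[X])) (x := x) (by simpa using hnil) (by
      have h2 : IsUnit (2 : S) := by
        have := (isUnit_iff_ne_zero.2 (two_ne_zero : (2 : K) ≠ 0)).map (algebraMap K S)
        rwa [map_ofNat] at this
      simpa [derivative_X_pow, one_add_one_eq_two] using h2.mul hxu)
  obtain ⟨q, rfl⟩ := AdjoinRoot.mk_surjective r
  refine ⟨q, AdjoinRoot.mk_eq_zero.1 ?_⟩
  simpa [s] using hr

end SquareRoot

section Polar

variable {K : Type*} [Field K] {n : Type*} [Fintype n] [DecidableEq n]

/-- An invertible matrix has a square root that is a polynomial in it. -/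
theorem exists_aeval_sq_eq [IsAlgClosed K] [CharZero K] (s : Matrix n n K) (hs : IsUnit s.det) :
    ∃ q : Polynomial K, Polynomial.aeval s q ^ 2 = s := by
  obtain ⟨q, c, hc⟩ := exists_dvd_sq_sub_X s.charpoly (by
    rw [Matrix.eval_charpoly]; simpa [Matrix.det_neg] using hs.ne_zero)
  refine ⟨q, ?_⟩
  have := congrArg (Polynomial.aeval s) hc
  simpa [Matrix.aeval_self_charpoly, sub_eq_zero] using this

theorem transpose_aeval (s : Matrix n n K) (hs : sᵀ = s) (q : Polynomial K) :
    (Polynomial.aeval s q)ᵀ = Polynomial.aeval s q := by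
  induction q using Polynomial.induction_on with
  | C a => simp [Matrix.algebraMap_eq_diagonal]
  | add p q hp hq => simp [hp, hq]
  | monomial k a _ =>
    rw [map_mul, Matrix.transpose_mul, Polynomial.aeval_C, map_pow, Polynomial.aeval_X,
      Matrix.transpose_pow, hs, Algebra.algebraMap_eq_smul_one]
    simp

/-- Skew-symmetric matrices conjugate under the general linear group are conjugate under the
orthogonal group: replace the conjugating matrix `h` by its orthogonal polar part, whose symmetric
part is a polynomial in `hᵀ h`, which commutes with `y`. -/
theorem exists_orthogonal_conj [IsAlgClosed K] [CharZero K] {x y h : Matrix n n K}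
    (hx : xᵀ = -x) (hy : yᵀ = -y) (hh : IsUnit h.det) (hc : x * h = h * y) :
    ∃ o : Matrix n n K, oᵀ * o = 1 ∧ x * o = o * y := by
  have hsy : Commute (hᵀ * h) y := by
    have h1 : hᵀ * x = y * hᵀ := by
      have := congrArg Matrix.transpose hc
      simpa [Matrix.transpose_mul, hx, hy] using this
    change hᵀ * h * y = y * (hᵀ * h)
    rw [Matrix.mul_assoc, ← hc, ← Matrix.mul_assoc, h1, Matrix.mul_assoc]
  have hdet : IsUnit (hᵀ * h).det := by simpa [Matrix.det_mul] using hh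
  obtain ⟨q, hq⟩ := exists_aeval_sq_eq (hᵀ * h) hdet
  set r := Polynomial.aeval (hᵀ * h) q with hr
  have hrT : rᵀ = r := transpose_aeval _ (by simp [Matrix.transpose_mul]) q
  have hry : Commute r y := (Algebra.commute_of_mem_adjoin_singleton_of_commute
    (Polynomial.aeval_mem_adjoin_singleton K _) hsy.symm).symm
  have hrdet : IsUnit r.det := by
    rw [← hq, pow_two, Matrix.det_mul] at hdet
    exact isUnit_of_mul_isUnit_left hdet
  refine ⟨h * r⁻¹, ?_, ?_⟩
  · rw [Matrix.transpose_mul, Matrix.transpose_nonsing_inv, hrT, Matrix.mul_assoc,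
      ← Matrix.mul_assoc hᵀ, ← hq, pow_two, Matrix.mul_assoc, Matrix.mul_nonsing_inv _ hrdet,
      Matrix.mul_one, Matrix.nonsing_inv_mul _ hrdet]
  · have : y * r⁻¹ = r⁻¹ * y := by
      calc y * r⁻¹ = r⁻¹ * (r * y) * r⁻¹ := by
            rw [← Matrix.mul_assoc, Matrix.nonsing_inv_mul _ hrdet, Matrix.one_mul]
        _ = r⁻¹ * y * (r * r⁻¹) := by rw [hry.eq]; simp only [Matrix.mul_assoc]
        _ = _ := by rw [Matrix.mul_nonsing_inv _ hrdet, Matrix.mul_one]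
    rw [← Matrix.mul_assoc, hc, Matrix.mul_assoc, this, Matrix.mul_assoc]

end Polar
/-! ### Zariski closures and polynomial curves -/

section Zariski

variable {K : Type*} [Field K]

theorem subset_zariskiClosure {V : Type*} [AddCommGroup V] [Module K V] (S : Set V) :
    S ⊆ zariskiClosure K S := fun x hx _ _ h => h x hx

theorem zariskiClosure_subset_of_subset {V : Type*} [AddCommGroup V] [Module K V] {S T : Set V}
    (h : S ⊆ zariskiClosure K T) : zariskiClosure K S ⊆ zariskiClosure K T :=
  fun _ hx p hp hT => hx p hp fun _ hy => h hy p hp hT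

theorem zariskiClosure_mono {V : Type*} [AddCommGroup V] [Module K V] {S T : Set V}
    (h : S ⊆ T) : zariskiClosure K S ⊆ zariskiClosure K T :=
  zariskiClosure_subset_of_subset (h.trans (subset_zariskiClosure T))

theorem polyFun_comp_linear {V W : Type*} [AddCommGroup V] [Module K V] [AddCommGroup W]
    [Module K W] (f : V →ₗ[K] W) {p : W → K} (hp : p ∈ polyFun K W) : p ∘ f ∈ polyFun K V := by
  induction hp using Algebra.adjoin_induction with
  | mem x hx =>
    obtain ⟨g, rfl⟩ := hx
    exact Algebra.subset_adjoin ⟨g.comp f, rfl⟩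
  | algebraMap r => exact Subalgebra.algebraMap_mem (polyFun K V) r
  | add x y _ _ hx hy => exact Subalgebra.add_mem _ hx hy
  | mul x y _ _ hx hy => exact Subalgebra.mul_mem _ hx hy

theorem map_mem_zariskiClosure {V W : Type*} [AddCommGroup V] [Module K V] [AddCommGroup W]
    [Module K W] (f : V →ₗ[K] W) {S : Set V} {T : Set W} (h : ∀ x ∈ S, f x ∈ T) {x : V}
    (hx : x ∈ zariskiClosure K S) : f x ∈ zariskiClosure K T :=
  fun _ hp hT => hx _ (polyFun_comp_linear f hp) fun _ hy => hT _ (h _ hy)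

variable {N : ℕ}

/-- The coordinate function `x ↦ x i j` on `so_N`. -/
def entryFun (K : Type*) [Field K] {N : ℕ} (i j : Fin N) : soLie K N → K := fun x => x.1 i j

theorem entryFun_mem (i j : Fin N) : entryFun K i j ∈ polyFun K (soLie K N) :=
  Algebra.subset_adjoin
    ⟨(Matrix.entryLinearMap K K i j).comp (soLie K N).toSubmodule.subtype, rfl⟩

/-- A curve `K → Mat_N(K)` whose entries are polynomials in the parameter. -/
def IsPolyCurve (γ : K → Matrix (Fin N) (Fin N) K) : Prop :=
  ∃ Γ : Matrix (Fin N) (Fin N) (Polynomial K),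
    ∀ t, γ t = (Polynomial.evalRingHom t).mapMatrix Γ

theorem IsPolyCurve.const (a : Matrix (Fin N) (Fin N) K) : IsPolyCurve fun _ => a :=
  ⟨Polynomial.C.mapMatrix a, fun t => by ext; simp⟩

theorem IsPolyCurve.smul {γ : K → Matrix (Fin N) (Fin N) K} (hγ : IsPolyCurve γ)
    (P : Polynomial K) : IsPolyCurve fun t => P.eval t • γ t := by
  obtain ⟨Γ, h⟩ := hγ
  exact ⟨P • Γ, fun t => by ext; simp [h t]⟩

theorem IsPolyCurve.add {γ δ : K → Matrix (Fin N) (Fin N) K} (hγ : IsPolyCurve γ)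
    (hδ : IsPolyCurve δ) : IsPolyCurve fun t => γ t + δ t := by
  obtain ⟨Γ, h⟩ := hγ
  obtain ⟨Δ, h'⟩ := hδ
  exact ⟨Γ + Δ, fun t => by simp only [map_add, ← h, ← h']⟩

theorem IsPolyCurve.mul {γ δ : K → Matrix (Fin N) (Fin N) K} (hγ : IsPolyCurve γ)
    (hδ : IsPolyCurve δ) : IsPolyCurve fun t => γ t * δ t := by
  obtain ⟨Γ, h⟩ := hγ
  obtain ⟨Δ, h'⟩ := hδ
  exact ⟨Γ * Δ, fun t => by simp only [map_mul, ← h, ← h']⟩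

theorem exists_eval_eq_of_isPolyCurve {γ : K → soLie K N} (hγ : IsPolyCurve fun t => (γ t).1)
    {p : soLie K N → K} (hp : p ∈ polyFun K (soLie K N)) :
    ∃ P : Polynomial K, ∀ t, p (γ t) = P.eval t := by
  obtain ⟨Γ, hΓ⟩ := hγ
  have hΓ' : ∀ t, (γ t).1 = (Polynomial.evalRingHom t).mapMatrix Γ := hΓ
  induction hp using Algebra.adjoin_induction with
  | mem x hx =>
    obtain ⟨g, rfl⟩ := hx
    obtain ⟨G, hG⟩ := LinearMap.exists_extend g
    refine ⟨∑ i, ∑ j, Γ i j * Polynomial.C (G (Matrix.single i j 1)), fun t => ?_⟩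
    have h1 : g (γ t) = G (γ t).1 := by rw [← hG]; rfl
    change g (γ t) = _
    rw [h1, Matrix.matrix_eq_sum_single (γ t).1, hΓ']
    simp only [map_sum, Polynomial.eval_finsetSum]
    refine Finset.sum_congr rfl fun i _ => Finset.sum_congr rfl fun j _ => ?_
    have : Matrix.single i j ((Polynomial.evalRingHom t).mapMatrix Γ i j)
        = ((Γ i j).eval t) • Matrix.single i j (1 : K) := by simp
    rw [this, map_smul]
    simp
  | algebraMap r => exact ⟨Polynomial.C r, fun t => by simp⟩
  | add x y _ _ hx hy =>
    obtain ⟨P, hP⟩ := hx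
    obtain ⟨Q, hQ⟩ := hy
    exact ⟨P + Q, fun t => by simp [hP, hQ]⟩
  | mul x y _ _ hx hy =>
    obtain ⟨P, hP⟩ := hx
    obtain ⟨Q, hQ⟩ := hy
    exact ⟨P * Q, fun t => by simp [hP, hQ]⟩

/-- A polynomial curve that lies generically in `S` lies in the Zariski closure of `S`. -/
theorem mem_zariskiClosure_of_curve [Infinite K] {S : Set (soLie K N)} {γ : K → soLie K N}
    (hγ : IsPolyCurve fun t => (γ t).1) {F : Polynomial K} (hF : F ≠ 0)
    (h : ∀ t, F.eval t ≠ 0 → γ t ∈ S) (t : K) : γ t ∈ zariskiClosure K S := by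
  intro p hp hS
  obtain ⟨P, hP⟩ := exists_eval_eq_of_isPolyCurve hγ hp
  have : P * F = 0 := Polynomial.funext fun s => by
    by_cases hs : F.eval s = 0
    · simp [hs]
    · rw [Polynomial.eval_mul, ← hP, hS _ (h s hs)]; simp
  rw [hP, (mul_eq_zero.1 this).resolve_right hF, Polynomial.eval_zero]

end Zariski

/-! ### Adjoint orbits -/

section Orbits

variable {K : Type*} [Field K] {N : ℕ}

theorem soLie_transpose (x : soLie K N) : x.1ᵀ = -x.1 := (mem_so (Fin N) K x.1).1 x.2

@[simp] theorem Ad_coe (g : SO K N) (x : soLie K N) : (Ad g x).1 = g.1 * x.1 * g.1ᵀ := rfl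

theorem SO_mul_transpose (g : SO K N) : g.1 * g.1ᵀ = 1 :=
  mul_eq_one_comm.1 (SO_transpose_mul g)

theorem SO_det (g : SO K N) : g.1.det = 1 := ((mem_SO_iff g.1).1 g.2).2

theorem Ad_one (x : soLie K N) : Ad 1 x = x := Subtype.ext (by simp)

theorem Ad_mul (g h : SO K N) (x : soLie K N) : Ad (g * h) x = Ad g (Ad h x) :=
  Subtype.ext (by simp [Matrix.transpose_mul, Matrix.mul_assoc])

theorem Ad_inv_Ad (g : SO K N) (x : soLie K N) : Ad g⁻¹ (Ad g x) = x := by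
  rw [← Ad_mul, inv_mul_cancel, Ad_one]

theorem Ad_eq_iff (g : SO K N) (x y : soLie K N) : Ad g x = y ↔ y.1 * g.1 = g.1 * x.1 := by
  rw [Subtype.ext_iff, Ad_coe]
  constructor
  · intro h
    rw [← h, Matrix.mul_assoc, SO_transpose_mul, Matrix.mul_one]
  · intro h
    rw [← h, Matrix.mul_assoc, SO_mul_transpose, Matrix.mul_one]

/-- The adjoint action of `g` as a linear map. -/
def AdLin (g : SO K N) : soLie K N →ₗ[K] soLie K N where
  toFun := Ad g
  map_add' x y := Subtype.ext (by
    change g.1 * (x.1 + y.1) * g.1ᵀ = g.1 * x.1 * g.1ᵀ + g.1 * y.1 * g.1ᵀ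
    rw [Matrix.mul_add, Matrix.add_mul])
  map_smul' c x := Subtype.ext (by
    change g.1 * (c • x.1) * g.1ᵀ = c • (g.1 * x.1 * g.1ᵀ)
    simp)

theorem mem_adOrbit_self (H : Subgroup (SO K N)) (x : soLie K N) : x ∈ adOrbit H x :=
  ⟨1, H.one_mem, (Ad_one x).symm⟩

theorem Ad_mem_adOrbit {H : Subgroup (SO K N)} {g : SO K N} (hg : g ∈ H) {x y : soLie K N}
    (hy : y ∈ adOrbit H x) : Ad g y ∈ adOrbit H x := by
  obtain ⟨k, hk, rfl⟩ := hy
  exact ⟨g * k, H.mul_mem hg hk, (Ad_mul _ _ _).symm⟩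

theorem adOrbit_eq_of_mem {H : Subgroup (SO K N)} {x y : soLie K N} (h : y ∈ adOrbit H x) :
    adOrbit H y = adOrbit H x := by
  obtain ⟨k, hk, rfl⟩ := h
  ext z
  constructor
  · rintro ⟨g, hg, rfl⟩
    exact Ad_mem_adOrbit hg ⟨k, hk, rfl⟩
  · rintro ⟨g, hg, rfl⟩
    refine ⟨g * k⁻¹, H.mul_mem hg (H.inv_mem hk), ?_⟩
    rw [Ad_mul, Ad_inv_Ad]

theorem IsOrbit.eq_adOrbit {H : Subgroup (SO K N)} {S : Set (soLie K N)} (hS : IsOrbit H S)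
    {x : soLie K N} (hx : x ∈ S) : S = adOrbit H x := by
  obtain ⟨y, rfl⟩ := hS
  exact (adOrbit_eq_of_mem hx).symm

theorem Ad_mem_zariskiClosure {S : Set (soLie K N)} (g : SO K N) (hS : ∀ x ∈ S, Ad g x ∈ S)
    {x : soLie K N} (hx : x ∈ zariskiClosure K S) : Ad g x ∈ zariskiClosure K S :=
  map_mem_zariskiClosure (AdLin g) hS hx

/-- Membership in the closure of a `G`-stable set can be checked after moving the point by `G`. -/
theorem mem_zariskiClosure_of_Ad {S : Set (soLie K N)} (g : SO K N)
    (hS : ∀ x ∈ S, Ad g⁻¹ x ∈ S) {x : soLie K N} (hx : Ad g x ∈ zariskiClosure K S) :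
    x ∈ zariskiClosure K S := by
  have := Ad_mem_zariskiClosure g⁻¹ hS hx
  rwa [Ad_inv_Ad] at this

/-- An orthogonal matrix of determinant one, as an element of `SO_N`. -/
def mkSO (o : Matrix (Fin N) (Fin N) K) (h : oᵀ * o = 1) (hd : o.det = 1) : SO K N :=
  ⟨o, (mem_SO_iff o).2 ⟨h, hd⟩⟩

theorem orthogonal_mul {n : Type*} [Fintype n] [DecidableEq n] {o p : Matrix n n K}
    (ho : oᵀ * o = 1) (hp : pᵀ * p = 1) : (o * p)ᵀ * (o * p) = 1 := by
  rw [Matrix.transpose_mul, Matrix.mul_assoc, ← Matrix.mul_assoc oᵀ, ho, Matrix.one_mul, hp]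

theorem det_eq_of_orthogonal {n : Type*} [Fintype n] [DecidableEq n] {o : Matrix n n K}
    (h : oᵀ * o = 1) : o.det = 1 ∨ o.det = -1 := by
  have := congrArg Matrix.det h
  rw [Matrix.det_mul, Matrix.det_transpose, Matrix.det_one] at this
  exact mul_self_eq_one_iff.1 this

end Orbits

/-! ### The Killing form of `so_N` -/

section Killing

variable {K : Type*} [Field K] {N : ℕ}

theorem mul_single_mul_apply {n : Type*} [Fintype n] [DecidableEq n] (a b : Matrix n n K)
    (i j k l : n) : (a * Matrix.single i j (1 : K) * b) k l = a k i * b j l := by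
  rw [Matrix.mul_assoc]
  simp [Matrix.mul_apply, Matrix.single_apply, ite_and]

theorem trace_end_matrix {n : Type*} [Fintype n] [DecidableEq n]
    (f : Matrix n n K →ₗ[K] Matrix n n K) :
    LinearMap.trace K _ f = ∑ i, ∑ j, f (Matrix.single i j 1) i j := by
  rw [LinearMap.trace_eq_matrix_trace K (Matrix.stdBasis K n n), Matrix.trace,
    Fintype.sum_prod_type]
  refine Finset.sum_congr rfl fun i _ => Finset.sum_congr rfl fun j _ => ?_
  rw [Matrix.diag_apply, LinearMap.toMatrix_apply, Matrix.stdBasis_eq_single]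
  simp [Matrix.stdBasis]

/-- The projection of the matrix algebra onto the skew-symmetric matrices. -/
noncomputable def skewPart (K : Type*) [Field K] (N : ℕ) :
    Matrix (Fin N) (Fin N) K →ₗ[K] soLie K N where
  toFun z := ⟨(2 : K)⁻¹ • (z - zᵀ), by
    rw [mem_so, Matrix.transpose_smul, Matrix.transpose_sub, Matrix.transpose_transpose,
      ← smul_neg, neg_sub]⟩
  map_add' x y := Subtype.ext (by
    change (2 : K)⁻¹ • (x + y - (x + y)ᵀ) = (2 : K)⁻¹ • (x - xᵀ) + (2 : K)⁻¹ • (y - yᵀ)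
    rw [Matrix.transpose_add, ← smul_add]; congr 1; abel)
  map_smul' c x := Subtype.ext (by
    change (2 : K)⁻¹ • (c • x - (c • x)ᵀ) = c • ((2 : K)⁻¹ • (x - xᵀ))
    rw [Matrix.transpose_smul, ← smul_sub, smul_comm])

/-- The Killing form of `so_N` is `(N - 2) tr(xy)`. -/
theorem killingForm_soLie [CharZero K] (x y : soLie K N) :
    killingForm K (soLie K N) x y = ((N : K) - 2) * (x.1 * y.1).trace := by
  let ι : soLie K N →ₗ[K] Matrix (Fin N) (Fin N) K := (soLie K N).toSubmodule.subtype
  have hπ : ∀ z : soLie K N, skewPart K N z.1 = z := fun z => Subtype.ext (by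
    change (2 : K)⁻¹ • (z.1 - z.1ᵀ) = z.1
    rw [soLie_transpose, sub_neg_eq_add, ← two_smul K, smul_smul, inv_mul_cancel₀ two_ne_zero,
      one_smul])
  let T : soLie K N →ₗ[K] soLie K N :=
    LieAlgebra.ad K (soLie K N) x ∘ₗ LieAlgebra.ad K (soLie K N) y
  have h1 : T = skewPart K N ∘ₗ (ι ∘ₗ T) := by
    ext1 z; exact (hπ _).symm
  rw [killingForm_apply_apply]
  change LinearMap.trace K _ T = _
  rw [h1, LinearMap.trace_comp_comm', trace_end_matrix]
  have h2 : ∀ z, (ι ∘ₗ T) (skewPart K N z) = (2 : K)⁻¹ •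
      (x.1 * y.1 * z * 1 - x.1 * z * y.1 - y.1 * z * x.1 + 1 * z * (y.1 * x.1)
       - (x.1 * y.1 * zᵀ * 1 - x.1 * zᵀ * y.1 - y.1 * zᵀ * x.1 + 1 * zᵀ * (y.1 * x.1))) := by
    intro z
    change x.1 * (y.1 * ((2 : K)⁻¹ • (z - zᵀ)) - ((2 : K)⁻¹ • (z - zᵀ)) * y.1)
      - (y.1 * ((2 : K)⁻¹ • (z - zᵀ)) - ((2 : K)⁻¹ • (z - zᵀ)) * y.1) * x.1 = _
    simp only [Matrix.mul_smul, Matrix.smul_mul, ← smul_sub, Matrix.mul_one, Matrix.one_mul]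
    congr 1
    noncomm_ring
  have key : ∀ a b : Matrix (Fin N) (Fin N) K, ∑ i, ∑ j, a i i * b j j = a.trace * b.trace := by
    intro a b
    simp only [Matrix.trace, Matrix.diag_apply, Finset.sum_mul_sum]
  have key' : ∀ a b : Matrix (Fin N) (Fin N) K, ∑ i, ∑ j, a i j * b i j = (a * bᵀ).trace := by
    intro a b
    simp only [Matrix.trace, Matrix.diag_apply, Matrix.mul_apply, Matrix.transpose_apply]
  have tx : x.1.trace = 0 := by
    have := congrArg Matrix.trace (soLie_transpose x)
    rw [Matrix.trace_transpose, Matrix.trace_neg] at this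
    exact self_eq_neg.1 this
  have hyx : (y.1 * x.1).trace = (x.1 * y.1).trace := Matrix.trace_mul_comm _ _
  have hyxT : (y.1 * x.1)ᵀ = x.1 * y.1 := by
    rw [Matrix.transpose_mul, soLie_transpose, soLie_transpose, neg_mul_neg]
  calc _ = (2 : K)⁻¹ * ((x.1 * y.1).trace * (1 : Matrix (Fin N) (Fin N) K).trace
        - x.1.trace * y.1.trace - y.1.trace * x.1.trace
        + (1 : Matrix (Fin N) (Fin N) K).trace * (y.1 * x.1).trace
        - ((x.1 * y.1 * 1ᵀ).trace - (x.1 * y.1ᵀ).trace - (y.1 * x.1ᵀ).trace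
          + (1 * (y.1 * x.1)ᵀ).trace)) := by
        simp only [← key, ← key', ← Finset.sum_add_distrib, ← Finset.sum_sub_distrib,
          Finset.mul_sum]
        refine Finset.sum_congr rfl fun i _ => Finset.sum_congr rfl fun j _ => ?_
        rw [LinearMap.comp_apply, h2]
        simp only [Matrix.smul_apply, Matrix.sub_apply, Matrix.add_apply, mul_single_mul_apply,
          Matrix.transpose_single, smul_eq_mul]
    _ = _ := by
        rw [soLie_transpose, soLie_transpose, hyxT, tx, hyx]
        simp only [Matrix.trace_one, Matrix.transpose_one, Matrix.mul_one, Matrix.one_mul,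
          Matrix.mul_neg, Matrix.trace_neg, Fintype.card_fin, hyx]
        field_simp
        ring

/-- The factor `N - 2` of the Killing form is nonzero for `2 < N`, so that the orthogonal complement
can be computed with the trace form. -/
theorem mem_isotropy_iff [CharZero K] (hN : 2 < N) (𝔥 : LieSubalgebra K (soLie K N))
    (y : soLie K N) : y ∈ isotropy 𝔥 ↔ ∀ x ∈ 𝔥, (x.1 * y.1).trace = 0 := by
  have h : ((N : K) - 2) ≠ 0 := by
    have : (N : K) ≠ (2 : ℕ) := by exact_mod_cast hN.ne'
    simpa [sub_eq_zero] using this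
  rw [isotropy, LinearMap.BilinForm.mem_orthogonal_iff]
  refine forall₂_congr fun x _ => ?_
  rw [killingForm_soLie]
  simp [h]

end Killing

/-! ### Powers of `ad e` -/

section Height

variable {K : Type*} [Field K] {N : ℕ}

theorem ad_coe (e z : soLie K N) :
    (LieAlgebra.ad K (soLie K N) e z).1 = e.1 * z.1 - z.1 * e.1 := rfl

theorem ad_pow_two_coe (e z : soLie K N) :
    ((LieAlgebra.ad K (soLie K N) e ^ 2) z).1
      = e.1 ^ 2 * z.1 - 2 * (e.1 * z.1 * e.1) + z.1 * e.1 ^ 2 := by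
  rw [pow_two, Module.End.mul_apply, ad_coe, ad_coe]
  noncomm_ring

theorem ad_pow_three_coe (e z : soLie K N) :
    ((LieAlgebra.ad K (soLie K N) e ^ 3) z).1
      = e.1 ^ 3 * z.1 - 3 * (e.1 ^ 2 * z.1 * e.1) + 3 * (e.1 * z.1 * e.1 ^ 2)
        - z.1 * e.1 ^ 3 := by
  rw [pow_succ', Module.End.mul_apply, ad_coe, ad_pow_two_coe]
  noncomm_ring

theorem ad_pow_four_coe (e z : soLie K N) :
    ((LieAlgebra.ad K (soLie K N) e ^ 4) z).1
      = e.1 ^ 4 * z.1 - 4 * (e.1 ^ 3 * z.1 * e.1) + 6 * (e.1 ^ 2 * z.1 * e.1 ^ 2)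
        - 4 * (e.1 * z.1 * e.1 ^ 3) + z.1 * e.1 ^ 4 := by
  rw [pow_succ', Module.End.mul_apply, ad_coe, ad_pow_three_coe]
  noncomm_ring

theorem ad_pow_five_coe (e z : soLie K N) :
    ((LieAlgebra.ad K (soLie K N) e ^ 5) z).1
      = e.1 ^ 5 * z.1 - 5 * (e.1 ^ 4 * z.1 * e.1) + 10 * (e.1 ^ 3 * z.1 * e.1 ^ 2)
        - 10 * (e.1 ^ 2 * z.1 * e.1 ^ 3) + 5 * (e.1 * z.1 * e.1 ^ 4) - z.1 * e.1 ^ 5 := by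
  rw [pow_succ', Module.End.mul_apply, ad_coe, ad_pow_four_coe]
  noncomm_ring

theorem isGreatest_ad_pow {e : soLie K N} {h : ℕ}
    (h1 : LieAlgebra.ad K (soLie K N) e ^ (h + 1) = 0)
    (h2 : ∃ z, (LieAlgebra.ad K (soLie K N) e ^ h) z ≠ 0) :
    IsGreatest {d : ℕ | (LieAlgebra.ad K (soLie K N) e) ^ d ≠ 0} h := by
  refine ⟨fun h0 => ?_, fun d hd => ?_⟩
  · obtain ⟨z, hz⟩ := h2
    rw [h0] at hz
    exact hz rfl
  · by_contra hlt
    exact hd (pow_eq_zero_of_le (not_le.1 hlt) h1)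

end Height

/-! ### Jordan types -/

section JordanType

variable {K : Type*} [Field K] {N : ℕ}

theorem pow_mulVec_succ (x : Matrix (Fin N) (Fin N) K) (j : ℕ) (v : Fin N → K) :
    (x ^ (j + 1)) *ᵥ v = (x ^ j) *ᵥ (x *ᵥ v) := by
  rw [pow_succ, Matrix.mulVec_mulVec]

/-- The chains of vectors `x^l t_i` with linearly independent last nonzero members are linearly
independent. -/
theorem linearIndependent_chains {μ : List ℕ} {x : Matrix (Fin N) (Fin N) K}
    (b : (Σ i : Fin μ.length, Fin (μ.get i)) → Fin N → K)
    (hb : ∀ (i : Fin μ.length) (j : Fin (μ.get i)), x *ᵥ b ⟨i, j⟩ =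
      if j.1 = 0 then 0 else b ⟨i, ⟨j.1 - 1, lt_of_le_of_lt (Nat.sub_le _ _) j.2⟩⟩)
    (w : Fin μ.length → Fin N → K) (hw : LinearIndependent K w)
    (hbw : ∀ i (h : 0 < μ.get i), b ⟨i, ⟨0, h⟩⟩ = w i) : LinearIndependent K b := by
  have hpow : ∀ (i : Fin μ.length) (l : ℕ) (hl : l < μ.get i) (L : ℕ), l ≤ L →
      (x ^ L) *ᵥ b ⟨i, ⟨l, hl⟩⟩ = if l = L then w i else 0 := by
    intro i l
    induction l with
    | zero =>
      intro hl L _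
      cases L with
      | zero => simp [hbw]
      | succ L => rw [pow_mulVec_succ, hb]; simp
    | succ l ih =>
      intro hl L hL
      obtain ⟨L, rfl⟩ : ∃ L', L = L' + 1 := ⟨L - 1, by omega⟩
      rw [pow_mulVec_succ, hb]
      simpa using ih (by omega) L (by omega)
  rw [Fintype.linearIndependent_iff]
  intro c hc
  -- downward induction on the position in the chain
  have key : ∀ d : ℕ, ∀ (i : Fin μ.length) (l : Fin (μ.get i)), μ.sum ≤ l.1 + d → c ⟨i, l⟩ = 0 := by
    intro d
    induction d with
    | zero =>
      intro i l h
      have h1 : μ.get i ≤ μ.sum :=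
        List.single_le_sum (fun _ _ => Nat.zero_le _) _ (List.get_mem _ _)
      omega
    | succ d ih =>
      intro i l h
      rcases Nat.lt_or_ge (l.1 + d) μ.sum with hlt | hge
      swap
      · exact ih i l hge
      have hL : ∀ (i' : Fin μ.length) (l' : Fin (μ.get i')), l.1 < l'.1 → c ⟨i', l'⟩ = 0 :=
        fun i' l' hl' => ih i' l' (by omega)
      have h2 := congrArg (fun v => (x ^ l.1) *ᵥ v) hc
      simp only [Matrix.mulVec_zero, Matrix.mulVec_sum, Matrix.mulVec_smul] at h2
      rw [Fintype.sum_sigma] at h2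
      have h3 : ∀ i' : Fin μ.length, ∑ l' : Fin (μ.get i'), c ⟨i', l'⟩ • (x ^ l.1) *ᵥ b ⟨i', l'⟩
          = (if h : l.1 < μ.get i' then c ⟨i', ⟨l.1, h⟩⟩ else 0) • w i' := by
        intro i'
        split_ifs with hl'
        · rw [Finset.sum_eq_single ⟨l.1, hl'⟩]
          · rw [hpow i' l.1 hl' l.1 le_rfl, if_pos rfl]
          · intro l' _ hne
            rcases lt_or_gt_of_ne (Fin.val_ne_iff.2 hne) with h' | h'
            · have := hpow i' l'.1 l'.2 l.1 h'.le
              rw [if_neg h'.ne] at this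
              rw [this, smul_zero]
            · rw [hL i' l' h', zero_smul]
          · simp
        · rw [zero_smul]
          refine Finset.sum_eq_zero fun l' _ => ?_
          have h' : l'.1 < l.1 := by have := l'.2; omega
          have := hpow i' l'.1 l'.2 l.1 h'.le
          rw [if_neg h'.ne] at this
          rw [this, smul_zero]
      rw [Finset.sum_congr rfl fun i' _ => h3 i'] at h2
      have h4 := Fintype.linearIndependent_iff.1 hw _ h2 i
      rwa [dif_pos l.2] at h4
  rintro ⟨i, l⟩
  exact key μ.sum i l (by omega)

theorem card_jordan_index (μ : List ℕ) :
    Fintype.card (Σ i : Fin μ.length, Fin (μ.get i)) = μ.sum := by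
  simp [Fintype.card_sigma]

/-- Criterion for the Jordan type `μ` of a nilpotent matrix: there are linearly independent vectors
`wᵢ` in its kernel with `wᵢ` in the image of `x ^ (μᵢ - 1)`, and `μ` is a partition of `N`. -/
theorem hasJordanType_of_kernel {μ : List ℕ} {x : Matrix (Fin N) (Fin N) K} (hμ : μ.sum = N)
    (w : Fin μ.length → Fin N → K) (hw : LinearIndependent K w) (hk : ∀ i, x *ᵥ w i = 0)
    (h : ∀ i, ∃ t, (x ^ (μ.get i - 1)) *ᵥ t = w i) : HasJordanType x μ := by
  choose t ht using h
  let b : (Σ i : Fin μ.length, Fin (μ.get i)) → Fin N → K :=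
    fun p => (x ^ (μ.get p.1 - 1 - p.2.1)) *ᵥ t p.1
  have hb : ∀ (i : Fin μ.length) (j : Fin (μ.get i)), x *ᵥ b ⟨i, j⟩ =
      if j.1 = 0 then 0 else b ⟨i, ⟨j.1 - 1, lt_of_le_of_lt (Nat.sub_le _ _) j.2⟩⟩ := by
    intro i j
    split_ifs with hj
    · simp only [b, hj, Nat.sub_zero, ht, hk]
    · have : μ.get i - 1 - (j.1 - 1) = (μ.get i - 1 - j.1) + 1 := by have := j.2; omega
      simp only [b, this, Matrix.mulVec_mulVec, ← pow_succ']
  have hli := linearIndependent_chains b hb w hw fun i _ => ht i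
  have hcard : Fintype.card (Σ i : Fin μ.length, Fin (μ.get i)) = Module.finrank K (Fin N → K) := by
    rw [card_jordan_index, hμ, Module.finrank_fin_fun]
  obtain h0 | h0 := isEmpty_or_nonempty (Σ i : Fin μ.length, Fin (μ.get i))
  · have hN : N = 0 := by
      rw [← Module.finrank_fin_fun K (n := N), ← hcard]; exact Fintype.card_eq_zero
    subst hN
    exact ⟨Module.Basis.empty _, fun i j => h0.elim ⟨i, j⟩⟩
  · exact ⟨basisOfLinearIndependentOfCardEqFinrank hli hcard, by simpa using hb⟩

theorem HasJordanType.sum_eq {μ : List ℕ} {x : Matrix (Fin N) (Fin N) K} (h : HasJordanType x μ) :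
    μ.sum = N := by
  obtain ⟨b, -⟩ := h
  rw [← card_jordan_index, ← Module.finrank_eq_card_basis b, Module.finrank_fin_fun]

/-- Matrices of the same Jordan type are conjugate under the general linear group. -/
theorem HasJordanType.exists_conj {μ : List ℕ} {x y : Matrix (Fin N) (Fin N) K}
    (hx : HasJordanType x μ) (hy : HasJordanType y μ) :
    ∃ h : Matrix (Fin N) (Fin N) K, IsUnit h.det ∧ x * h = h * y := by
  obtain ⟨b, hb⟩ := hx
  obtain ⟨c, hc⟩ := hy
  let e := c.equiv b (Equiv.refl _)
  refine ⟨LinearMap.toMatrix' e.toLinearMap, ?_, ?_⟩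
  · rw [LinearMap.det_toMatrix']; exact e.isUnit_det'
  · apply Matrix.toLin'.injective
    refine c.ext fun ⟨i, j⟩ => ?_
    have he : ∀ p, e (c p) = b p := fun p => by simp [e]
    simp only [Matrix.toLin'_mul, Matrix.toLin'_toMatrix', LinearMap.comp_apply,
      Matrix.toLin'_apply, LinearEquiv.coe_coe, he, hb, hc]
    split_ifs <;> simp [he]

theorem HasJordanType.conj {μ : List ℕ} {x y h : Matrix (Fin N) (Fin N) K} (hh : IsUnit h.det)
    (hc : x * h = h * y) (hy : HasJordanType y μ) : HasJordanType x μ := by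
  obtain ⟨c, hc'⟩ := hy
  let e : (Fin N → K) ≃ₗ[K] (Fin N → K) :=
    Matrix.toLinearEquiv' h ((Matrix.isUnit_iff_isUnit_det h).2 hh).invertible
  have he : ∀ v, e v = h *ᵥ v := fun v => rfl
  refine ⟨c.map e, fun i j => ?_⟩
  simp only [Module.Basis.map_apply, he, Matrix.mulVec_mulVec, hc]
  rw [← Matrix.mulVec_mulVec, hc']
  split_ifs <;> simp

/-- A linear independent family in a subspace can be prolonged within the subspace. -/
theorem exists_extend_family {V : Type*} [AddCommGroup V] [Module K V] [FiniteDimensional K V]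
    (U : Submodule K V) {p : ℕ} (w : Fin p → V) (hw : LinearIndependent K w) (hU : ∀ i, w i ∈ U)
    (s : ℕ) (hs : p + s ≤ Module.finrank K U) :
    ∃ w' : Fin (p + s) → V, LinearIndependent K w' ∧ (∀ i, w' i ∈ U) ∧
      ∀ i, w' (Fin.castAdd s i) = w i := by
  induction s with
  | zero => exact ⟨w, hw, hU, fun i => rfl⟩
  | succ s ih =>
    obtain ⟨w', h1, h2, h3⟩ := ih (by omega)
    let v : Fin (p + s) → U := fun i => ⟨w' i, h2 i⟩
    have hv : LinearIndependent K v := LinearIndependent.of_comp U.subtype h1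
    obtain ⟨y, hy⟩ := exists_linearIndependent_snoc_of_lt_finrank hv (by omega)
    refine ⟨fun i => (Fin.snoc (α := fun _ => U) v y i : U), ?_, fun i => Subtype.prop _,
        fun i => ?_⟩
    · exact hy.map' U.subtype U.ker_subtype
    · have : Fin.castAdd (s + 1) i = Fin.castSucc (Fin.castAdd s i) := rfl
      change ((Fin.snoc (α := fun _ => U) v y (Fin.castAdd (s + 1) i) : U) : V) = w i
      rw [this, Fin.snoc_castSucc]
      exact h3 i

theorem rank_add_finrank_ker (x : Matrix (Fin N) (Fin N) K) :
    x.rank + Module.finrank K (LinearMap.ker x.mulVecLin) = N := by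
  have := LinearMap.finrank_range_add_finrank_ker x.mulVecLin
  rwa [Module.finrank_fin_fun] at this

/-- Square-zero matrices are classified by their rank. -/
theorem hasJordanType_two_one {x : Matrix (Fin N) (Fin N) K} {r s : ℕ} (h2 : x ^ 2 = 0)
    (hr : x.rank = r) (hN : N = 2 * r + s) :
    HasJordanType x (List.replicate r 2 ++ List.replicate s 1) := by
  have hle : LinearMap.range x.mulVecLin ≤ LinearMap.ker x.mulVecLin := by
    rintro _ ⟨v, rfl⟩
    simp [Matrix.mulVec_mulVec, ← pow_two, h2]
  obtain ⟨B⟩ : Nonempty (Module.Basis (Fin r) K (LinearMap.range x.mulVecLin)) :=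
    ⟨Module.finBasisOfFinrankEq K _ hr⟩
  have hker : r + s ≤ Module.finrank K (LinearMap.ker x.mulVecLin) := by
    have := rank_add_finrank_ker x
    rw [hr] at this
    omega
  have hB : LinearIndependent K fun i => (B i : Fin N → K) :=
    B.linearIndependent.map' (Submodule.subtype _) (Submodule.ker_subtype _)
  obtain ⟨w, hw1, hw2, hw3⟩ := exists_extend_family (LinearMap.ker x.mulVecLin)
    (fun i => (B i : Fin N → K)) hB (fun i => hle (B i).2) s hker
  have hlen : (List.replicate r 2 ++ List.replicate s 1).length = r + s := by simp
  refine hasJordanType_of_kernel (by simp; omega) (fun i => w (Fin.cast hlen i))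
    (hw1.comp _ (Fin.cast_injective _)) (fun i => by simpa using hw2 (Fin.cast hlen i)) ?_
  intro i
  by_cases hi : i.1 < r
  · have h1 : (List.replicate r 2 ++ List.replicate s 1).get i = 2 := by
      rw [List.get_eq_getElem, List.getElem_append_left (by simpa using hi)]; simp
    have h3 : Fin.cast hlen i = Fin.castAdd s ⟨i.1, hi⟩ := Fin.ext rfl
    obtain ⟨t, ht⟩ := (B ⟨i.1, hi⟩).2
    refine ⟨t, ?_⟩
    rw [h1, h3, hw3, ← ht]
    simp
  · have h1 : (List.replicate r 2 ++ List.replicate s 1).get i = 1 := by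
      rw [List.get_eq_getElem, List.getElem_append_right (by simpa using hi)]; simp
    exact ⟨w (Fin.cast hlen i), by rw [h1]; simp⟩

/-- The kernel of `x` restricted to its image has dimension `rank x - rank x²`. -/
theorem rank_sq_add_finrank_range_inf_ker (x : Matrix (Fin N) (Fin N) K) :
    (x ^ 2).rank + Module.finrank K
      (LinearMap.range x.mulVecLin ⊓ LinearMap.ker x.mulVecLin : Submodule K (Fin N → K)) =
      x.rank := by
  set R := LinearMap.range x.mulVecLin with hR
  set Z := LinearMap.ker x.mulVecLin with hZ
  have h1 := LinearMap.finrank_range_add_finrank_ker (x.mulVecLin.domRestrict R)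
  have h2 : LinearMap.range (x.mulVecLin.domRestrict R) = LinearMap.range (x ^ 2).mulVecLin := by
    rw [LinearMap.range_domRestrict, hR, ← LinearMap.range_comp, ← Matrix.mulVecLin_mul, pow_two]
  have h4 : Module.finrank K (LinearMap.ker (x.mulVecLin.domRestrict R))
      = Module.finrank K (R ⊓ Z : Submodule K (Fin N → K)) := by
    rw [LinearMap.ker_domRestrict, (Submodule.equivSubtypeMap R _).finrank_eq]
    exact congrArg (fun S : Submodule K (Fin N → K) => Module.finrank K S)
      (Submodule.map_comap_subtype R Z)
  rw [h2, h4] at h1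
  exact h1

/-- The chain of length three is prolonged to a frame of `im x ∩ ker x`, and this frame to one of
`ker x`. -/
theorem hasJordanType_three_two_one {x : Matrix (Fin N) (Fin N) K} {a s : ℕ} (h3 : x ^ 3 = 0)
    (hr2 : (x ^ 2).rank = 1) (hr : x.rank = a + 2) (hN : N = 3 + 2 * a + s) :
    HasJordanType x (3 :: (List.replicate a 2 ++ List.replicate s 1)) := by
  set R := LinearMap.range x.mulVecLin with hR
  set Z := LinearMap.ker x.mulVecLin with hZ
  have hker := rank_add_finrank_ker x
  have hRZ : Module.finrank K (R ⊓ Z : Submodule K (Fin N → K)) = a + 1 := by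
    have h1 := rank_sq_add_finrank_range_inf_ker x
    rw [hr2, hr, ← hR, ← hZ] at h1
    omega
  obtain ⟨u, hu⟩ : ∃ u, (x ^ 2) *ᵥ u ≠ 0 := by
    by_contra! hcon
    have : (x ^ 2).mulVecLin = 0 := LinearMap.ext hcon
    have h6 : Module.finrank K (LinearMap.range (x ^ 2).mulVecLin) = 1 := hr2
    rw [this, LinearMap.range_zero, finrank_bot] at h6
    omega
  have hu1 : (x ^ 2) *ᵥ u ∈ R ⊓ Z :=
    ⟨⟨x *ᵥ u, by simp [Matrix.mulVec_mulVec, pow_two]⟩, by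
      simp [hZ, Matrix.mulVec_mulVec, ← pow_succ', h3]⟩
  obtain ⟨v, hv1, hv2, hv3⟩ := exists_extend_family (R ⊓ Z) ![(x ^ 2) *ᵥ u]
    (linearIndependent_unique_iff.2 (by simpa using hu)) (fun i => by simpa using hu1) a
    (by omega)
  obtain ⟨w, hw1, hw2, hw3⟩ := exists_extend_family Z v hv1 (fun i => (hv2 i).2) s (by
    have : Module.finrank K Z = a + 1 + s := by rw [← hZ] at hker; omega
    omega)
  have hlen : (3 :: (List.replicate a 2 ++ List.replicate s 1)).length = 1 + a + s := by
    simp; omega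
  refine hasJordanType_of_kernel (by simp; omega) (fun i => w (Fin.cast hlen i))
    (hw1.comp _ (Fin.cast_injective _)) (fun i => by simpa [hZ] using hw2 (Fin.cast hlen i)) ?_
  rintro ⟨_ | i, hi⟩
  · refine ⟨u, ?_⟩
    have h1 : Fin.cast hlen ⟨0, hi⟩ = Fin.castAdd s (Fin.castAdd a 0) := rfl
    rw [h1, hw3, hv3]
    rfl
  · by_cases hia : i < a
    · have h1 : (3 :: (List.replicate a 2 ++ List.replicate s 1)).get ⟨i + 1, hi⟩ = 2 := by
        rw [List.get_eq_getElem, List.getElem_cons_succ,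
          List.getElem_append_left (by simpa using hia)]; simp
      have h2 : Fin.cast hlen ⟨i + 1, hi⟩ = Fin.castAdd s ⟨i + 1, by omega⟩ := rfl
      obtain ⟨t, ht⟩ := (hv2 ⟨i + 1, by omega⟩).1
      refine ⟨t, ?_⟩
      rw [h1, h2, hw3, ← ht]
      simp
    · have h1 : (3 :: (List.replicate a 2 ++ List.replicate s 1)).get ⟨i + 1, hi⟩ = 1 := by
        rw [List.get_eq_getElem, List.getElem_cons_succ,
          List.getElem_append_right (by simpa using hia)]; simp
      exact ⟨w (Fin.cast hlen ⟨i + 1, hi⟩), by rw [h1]; simp⟩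

end JordanType

section JordanInvariants

variable {K : Type*} [Field K] {N : ℕ}

theorem jordan_pow_mulVec {μ : List ℕ} {x : Matrix (Fin N) (Fin N) K}
    {b : (Σ i : Fin μ.length, Fin (μ.get i)) → Fin N → K}
    (hb : ∀ (i : Fin μ.length) (j : Fin (μ.get i)), x *ᵥ b ⟨i, j⟩ =
      if j.1 = 0 then 0 else b ⟨i, ⟨j.1 - 1, lt_of_le_of_lt (Nat.sub_le _ _) j.2⟩⟩)
    (i : Fin μ.length) (j l : ℕ) (hl : l < μ.get i) :
    (x ^ j) *ᵥ b ⟨i, ⟨l, hl⟩⟩ =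
      if l < j then 0 else b ⟨i, ⟨l - j, lt_of_le_of_lt (Nat.sub_le _ _) hl⟩⟩ := by
  induction j generalizing l with
  | zero => simp
  | succ j ih =>
    rw [pow_mulVec_succ, hb]
    cases l with
    | zero => simp
    | succ l =>
      have := ih l (by omega)
      simpa using this

/-- The ranks of the powers of a matrix of Jordan type `μ`. -/
theorem HasJordanType.rank_pow {μ : List ℕ} {x : Matrix (Fin N) (Fin N) K}
    (h : HasJordanType x μ) (j : ℕ) : (x ^ j).rank = (μ.map (· - j)).sum := by
  obtain ⟨b, hb⟩ := h
  let c : (Σ i : Fin μ.length, Fin (μ.get i - j)) → Fin N → K :=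
    fun p => b ⟨p.1, ⟨p.2.1, lt_of_lt_of_le p.2.2 (Nat.sub_le _ _)⟩⟩
  have hc : LinearIndependent K c := by
    refine b.linearIndependent.comp _ ?_
    rintro ⟨i, l⟩ ⟨i', l'⟩ h
    obtain ⟨h1, h2⟩ := Sigma.mk.inj_iff.1 h
    subst h1
    have h3 := eq_of_heq h2
    simp only [Fin.mk.injEq] at h3
    exact Sigma.ext rfl (heq_of_eq (Fin.ext h3))
  have hrange : LinearMap.range (x ^ j).mulVecLin = Submodule.span K (Set.range c) := by
    apply le_antisymm
    · rw [LinearMap.range_eq_map, ← b.span_eq, Submodule.map_span, Submodule.span_le]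
      rintro _ ⟨_, ⟨⟨i, l⟩, rfl⟩, rfl⟩
      rw [Matrix.mulVecLin_apply, jordan_pow_mulVec hb i j l.1 l.2]
      split_ifs with hl
      · exact Submodule.zero_mem _
      · exact Submodule.subset_span ⟨⟨i, ⟨l.1 - j, by have := l.2; omega⟩⟩, rfl⟩
    · rw [Submodule.span_le]
      rintro _ ⟨⟨i, l⟩, rfl⟩
      refine ⟨b ⟨i, ⟨l.1 + j, by have := l.2; omega⟩⟩, ?_⟩
      rw [Matrix.mulVecLin_apply, jordan_pow_mulVec hb i j]
      simp [c]
  rw [Matrix.rank, hrange, finrank_span_eq_card hc]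
  simp only [Fintype.card_sigma, Fintype.card_fin]
  rw [← Fin.sum_univ_fun_getElem]
  rfl

theorem eq_zero_of_rank_eq_zero {x : Matrix (Fin N) (Fin N) K} (h : x.rank = 0) : x = 0 := by
  have h1 : LinearMap.range x.mulVecLin = ⊥ := Submodule.finrank_eq_zero.1 h
  have h2 := LinearMap.range_eq_bot.1 h1
  exact Matrix.toLin'.injective (by simpa [Matrix.toLin'_apply'] using h2)

theorem HasJordanType.two_one {x : Matrix (Fin N) (Fin N) K} {r s : ℕ}
    (h : HasJordanType x (List.replicate r 2 ++ List.replicate s 1)) :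
    x ^ 2 = 0 ∧ x.rank = r ∧ N = 2 * r + s := by
  refine ⟨eq_zero_of_rank_eq_zero (by rw [h.rank_pow]; simp), ?_, ?_⟩
  · have := h.rank_pow 1
    rw [pow_one] at this
    simpa using this
  · have := h.sum_eq
    simp at this
    omega

theorem HasJordanType.three_two_one {x : Matrix (Fin N) (Fin N) K} {a s : ℕ}
    (h : HasJordanType x (3 :: (List.replicate a 2 ++ List.replicate s 1))) :
    x ^ 3 = 0 ∧ (x ^ 2).rank = 1 ∧ x.rank = a + 2 ∧ N = 3 + 2 * a + s := by
  refine ⟨eq_zero_of_rank_eq_zero (by rw [h.rank_pow]; simp), by rw [h.rank_pow]; simp, ?_, ?_⟩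
  · have := h.rank_pow 1
    rw [pow_one] at this
    rw [this]; simp; omega
  · have := h.sum_eq
    simp at this
    omega

/-- The tops `tᵢ` of the Jordan chains: the vectors `x ^ (μᵢ - 1) tᵢ` are linearly independent. -/
theorem HasJordanType.exists_tops {μ : List ℕ} {x : Matrix (Fin N) (Fin N) K}
    (h : HasJordanType x μ) (hμ : ∀ i, 0 < μ.get i) :
    ∃ t : Fin μ.length → Fin N → K, LinearIndependent K (fun i => (x ^ (μ.get i - 1)) *ᵥ t i) ∧
      ∀ i, (x ^ μ.get i) *ᵥ t i = 0 := by
  obtain ⟨b, hb⟩ := h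
  refine ⟨fun i => b ⟨i, ⟨μ.get i - 1, by have := hμ i; omega⟩⟩, ?_, fun i => ?_⟩
  · have : (fun i => (x ^ (μ.get i - 1)) *ᵥ b ⟨i, ⟨μ.get i - 1, by have := hμ i; omega⟩⟩)
        = fun i => b ⟨i, ⟨0, hμ i⟩⟩ := by
      funext i
      rw [jordan_pow_mulVec hb]
      simp
    rw [this]
    refine b.linearIndependent.comp (fun i =>
        (⟨i, ⟨0, hμ i⟩⟩ : Σ i : Fin μ.length, Fin (μ.get i))) ?_
    intro i i' h
    exact (Sigma.mk.inj_iff.1 h).1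
  · rw [jordan_pow_mulVec hb, if_pos]
    have := hμ i
    omega

/-- A symmetric matrix of rank one over an algebraically closed field is of the form `u uᵀ`. -/
theorem exists_eq_vecMulVec_self [IsAlgClosed K] {A : Matrix (Fin N) (Fin N) K} (hA : Aᵀ = A)
    (hr : A.rank = 1) : ∃ u, u ≠ 0 ∧ A = vecMulVec u u := by
  obtain ⟨⟨f, hf⟩, hf0, hspan⟩ := finrank_eq_one_iff'.1 hr
  have hf0' : f ≠ 0 := fun h => hf0 (Subtype.ext h)
  have h1 : ∀ v, ∃ c : K, A *ᵥ v = c • f := fun v => by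
    obtain ⟨c, hc⟩ := hspan ⟨A *ᵥ v, ⟨v, rfl⟩⟩
    exact ⟨c, (congrArg Subtype.val hc).symm⟩
  choose c hc using h1
  have hA' : ∀ i j, A i j = c (Pi.single j 1) * f i := fun i j => by
    have := congrFun (hc (Pi.single j 1)) i
    simpa using this
  have hsymm : ∀ i j, A i j = A j i := fun i j => congrFun (congrFun hA j) i
  obtain ⟨i, hi⟩ := Function.ne_iff.1 hf0'
  have hi' : f i ≠ 0 := hi
  obtain ⟨s, hs⟩ := IsAlgClosed.exists_pow_nat_eq (c (Pi.single i 1) / f i) (n := 2) (by norm_num)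
  have hAs : A = vecMulVec (s • f) (s • f) := by
    ext k j
    have e1 : c (Pi.single j 1) * f i = c (Pi.single i 1) * f j := by rw [← hA', ← hA', hsymm]
    rw [hA', vecMulVec_apply, Pi.smul_apply, Pi.smul_apply, smul_eq_mul, smul_eq_mul]
    have e2 : s * f k * (s * f j) = s ^ 2 * (f k * f j) := by ring
    rw [e2, hs]
    field_simp
    linear_combination f k * e1
  refine ⟨s • f, fun h0 => ?_, hAs⟩
  rw [h0, vecMulVec_zero] at hAs
  rw [hAs, Matrix.rank_zero] at hr
  exact zero_ne_one hr

end JordanInvariants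

/-! ### Bivectors and reflections -/

section Wedge

variable {K : Type*} [Field K] {n : Type*}

/-- The skew-symmetric matrix of `w ↦ ⟨a, w⟩ b - ⟨b, w⟩ a`. -/
def wedge (a b : n → K) : Matrix n n K := vecMulVec b a - vecMulVec a b

theorem wedge_apply (a b : n → K) (i j : n) : wedge a b i j = b i * a j - a i * b j := rfl

theorem wedge_transpose (a b : n → K) : (wedge a b)ᵀ = -wedge a b := by
  ext i j
  simp [wedge_apply]
  ring

theorem wedge_mulVec [Fintype n] (a b w : n → K) :
    wedge a b *ᵥ w = (a ⬝ᵥ w) • b - (b ⬝ᵥ w) • a := by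
  rw [wedge, Matrix.sub_mulVec, vecMulVec_mulVec, vecMulVec_mulVec]
  simp

theorem mul_wedge_mul [Fintype n] (M : Matrix n n K) (a b : n → K) :
    M * wedge a b * Mᵀ = wedge (M *ᵥ a) (M *ᵥ b) := by
  simp only [wedge, Matrix.mul_sub, Matrix.sub_mul, mul_vecMulVec, vecMulVec_mul,
    Matrix.vecMul_transpose]

/-- Linearly independent vectors have a nonzero wedge. -/
theorem wedge_ne_zero {a b : n → K} (ha : a ≠ 0) (hb : ∀ c : K, b ≠ c • a) : wedge a b ≠ 0 := by
  intro h
  obtain ⟨i, hi⟩ := Function.ne_iff.1 ha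
  have hi' : a i ≠ 0 := hi
  refine hb (b i / a i) ?_
  ext j
  have := congrFun (congrFun h j) i
  rw [wedge_apply, Matrix.zero_apply] at this
  simp only [Pi.smul_apply, smul_eq_mul]
  field_simp
  linear_combination this

variable [Fintype n] [DecidableEq n]

/-- `wedge a b` as an element of `so_N`. -/
def wedgeSo {N : ℕ} (a b : Fin N → K) : soLie K N :=
  ⟨wedge a b, (mem_so _ _ _).2 (wedge_transpose a b)⟩

@[simp] theorem wedgeSo_coe {N : ℕ} (a b : Fin N → K) : (wedgeSo a b).1 = wedge a b := rfl

/-- The orthogonal reflection in the hyperplane orthogonal to `w`. -/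
noncomputable def refl (w : n → K) : Matrix n n K := 1 - (2 / (w ⬝ᵥ w)) • vecMulVec w w

theorem refl_transpose (w : n → K) : (refl w)ᵀ = refl w := by
  rw [refl, Matrix.transpose_sub, Matrix.transpose_smul, transpose_vecMulVec, Matrix.transpose_one]

theorem refl_mul_self {w : n → K} (hw : w ⬝ᵥ w ≠ 0) : refl w * refl w = 1 := by
  rw [refl, Matrix.sub_mul, Matrix.mul_sub, Matrix.mul_one, Matrix.one_mul, Matrix.smul_mul,
    Matrix.mul_sub, Matrix.mul_smul, Matrix.mul_one, vecMulVec_mul_vecMulVec, vecMulVec_smul,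
    smul_sub, smul_smul, smul_smul]
  have : 2 / (w ⬝ᵥ w) * (2 / (w ⬝ᵥ w)) * w ⬝ᵥ w = 2 / (w ⬝ᵥ w) + 2 / (w ⬝ᵥ w) := by
    field_simp; norm_num
  rw [this, add_smul]
  abel

theorem refl_orthogonal {w : n → K} (hw : w ⬝ᵥ w ≠ 0) : (refl w)ᵀ * refl w = 1 := by
  rw [refl_transpose, refl_mul_self hw]

theorem det_refl {w : n → K} (hw : w ⬝ᵥ w ≠ 0) : (refl w).det = -1 := by
  have h : refl w = 1 + Matrix.replicateCol Unit (-(2 / (w ⬝ᵥ w)) • w) *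
      Matrix.replicateRow Unit w := by
    ext i j
    simp [refl, Matrix.mul_apply, vecMulVec_apply]
    ring
  rw [h, Matrix.det_one_add_replicateCol_mul_replicateRow, dotProduct_smul, smul_eq_mul]
  field_simp
  norm_num

theorem refl_commute {x : Matrix n n K} (hx : xᵀ = -x) {w : n → K} (hw : x *ᵥ w = 0) :
    x * refl w = refl w * x := by
  have h : w ᵥ* x = 0 := by
    rw [← Matrix.mulVec_transpose, hx, Matrix.neg_mulVec, hw, neg_zero]
  rw [refl, Matrix.mul_sub, Matrix.sub_mul, Matrix.mul_smul, Matrix.smul_mul, mul_vecMulVec,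
    vecMulVec_mul, h, hw]
  simp

theorem refl_mulVec_of_orthogonal {w v : n → K} (h : w ⬝ᵥ v = 0) : refl w *ᵥ v = v := by
  rw [refl, Matrix.sub_mulVec, Matrix.smul_mulVec, vecMulVec_mulVec, h]
  simp

theorem refl_mulVec_self {w : n → K} (hw : w ⬝ᵥ w ≠ 0) : refl w *ᵥ w = -w := by
  rw [refl, Matrix.sub_mulVec, Matrix.smul_mulVec, vecMulVec_mulVec]
  ext i
  simp
  field_simp
  ring

end Wedge

/-! ### Heights of matrices with vanishing square or cube -/

section HeightCriteria

variable {K : Type*} [Field K] {N : ℕ}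

theorem sq_transpose (e : soLie K N) : (e.1 ^ 2)ᵀ = e.1 ^ 2 := by
  rw [Matrix.transpose_pow, soLie_transpose, neg_sq]

theorem skew_dotProduct (z : soLie K N) (u v : Fin N → K) :
    (z.1 *ᵥ u) ⬝ᵥ v = -(u ⬝ᵥ (z.1 *ᵥ v)) := by
  rw [Matrix.dotProduct_mulVec, ← Matrix.mulVec_transpose, soLie_transpose, Matrix.neg_mulVec,
    neg_dotProduct, neg_neg]

variable [CharZero K]

/-- If `e² = 0`, then `(ad e)³ = 0` and `(ad e)² z = -2 e z e`. The value on `z = a ∧ b` is a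
multiple of `e a ∧ e b`, which does not vanish if the rank of `e` is at least two. -/
theorem height_two_of_sq_eq_zero {e : soLie K N} (he : e.1 ^ 2 = 0) {a b : Fin N → K}
    (ha : e.1 *ᵥ a ≠ 0) (hb : ∀ c : K, e.1 *ᵥ b ≠ c • (e.1 *ᵥ a)) :
    IsGreatest {d : ℕ | (LieAlgebra.ad K (soLie K N) e) ^ d ≠ 0} 2 := by
  have he3 : e.1 ^ 3 = 0 := by rw [pow_succ, he, Matrix.zero_mul]
  refine isGreatest_ad_pow ?_ ⟨wedgeSo a b, fun h => ?_⟩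
  · ext1 z
    refine Subtype.ext ?_
    rw [ad_pow_three_coe, he, he3]
    simp
  · have h1 := congrArg Subtype.val h
    rw [ad_pow_two_coe, he] at h1
    have h2 : e.1 * (wedgeSo a b).1 * e.1 = -wedge (e.1 *ᵥ a) (e.1 *ᵥ b) := by
      rw [← mul_wedge_mul, soLie_transpose, Matrix.mul_neg, neg_neg]; rfl
    rw [h2] at h1
    refine wedge_ne_zero ha hb ?_
    have h3 : (2 : Matrix (Fin N) (Fin N) K) * wedge (e.1 *ᵥ a) (e.1 *ᵥ b) = 0 := by
      simpa using h1
    have h4 : (2 : K) • wedge (e.1 *ᵥ a) (e.1 *ᵥ b) = 0 := by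
      rw [two_smul, ← two_mul]; exact h3
    exact (smul_eq_zero.1 h4).resolve_left two_ne_zero

theorem skew_dotProduct_self (z : soLie K N) (u : Fin N → K) : u ⬝ᵥ (z.1 *ᵥ u) = 0 := by
  have := skew_dotProduct z u u
  rw [dotProduct_comm] at this
  exact self_eq_neg.1 this

theorem vecMulVec_mul_skew_mul_vecMulVec (z : soLie K N) (u : Fin N → K) :
    vecMulVec u u * z.1 * vecMulVec u u = 0 := by
  rw [Matrix.mul_assoc, mul_vecMulVec, vecMulVec_mul_vecMulVec, skew_dotProduct_self]
  simp

/-- If `e³ = 0` and `e² = u uᵀ`, then `(ad e)⁴ z = 6 e² z e²` vanishes, as `z` is skew-symmetric.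
The value of `(ad e)³` on `a ∧ b` is a multiple of `e² a ∧ e b` if `e² b = 0`. -/
theorem height_three_of_cube_eq_zero {e : soLie K N} (he : e.1 ^ 3 = 0) {u : Fin N → K}
    (hu : e.1 ^ 2 = vecMulVec u u) {a b : Fin N → K}
    (ha : (e.1 ^ 2) *ᵥ a ≠ 0) (hb2 : (e.1 ^ 2) *ᵥ b = 0)
    (hb : ∀ c : K, e.1 *ᵥ b ≠ c • ((e.1 ^ 2) *ᵥ a)) :
    IsGreatest {d : ℕ | (LieAlgebra.ad K (soLie K N) e) ^ d ≠ 0} 3 := by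
  have he4 : e.1 ^ 4 = 0 := by rw [pow_succ, he, Matrix.zero_mul]
  refine isGreatest_ad_pow ?_ ⟨wedgeSo a b, fun h => ?_⟩
  · ext1 z
    refine Subtype.ext ?_
    rw [ad_pow_four_coe, he, he4, hu, vecMulVec_mul_skew_mul_vecMulVec]
    simp
  · have h1 := congrArg Subtype.val h
    rw [ad_pow_three_coe, he] at h1
    have hT : ∀ v, v ᵥ* e.1 = -(e.1 *ᵥ v) := fun v => by
      rw [← Matrix.mulVec_transpose, soLie_transpose, Matrix.neg_mulVec]
    have hT2 : ∀ v, v ᵥ* (e.1 ^ 2) = e.1 ^ 2 *ᵥ v := fun v => by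
      rw [← Matrix.mulVec_transpose, sq_transpose]
    have h2 : e.1 ^ 2 * (wedgeSo a b).1 * e.1 = vecMulVec ((e.1 ^ 2) *ᵥ a) (e.1 *ᵥ b) := by
      rw [wedgeSo_coe, wedge, Matrix.mul_sub, Matrix.sub_mul, mul_vecMulVec, mul_vecMulVec,
        vecMulVec_mul, vecMulVec_mul, hb2, hT, hT]
      simp
    have h3 : e.1 * (wedgeSo a b).1 * e.1 ^ 2 = vecMulVec (e.1 *ᵥ b) ((e.1 ^ 2) *ᵥ a) := by
      rw [wedgeSo_coe, wedge, Matrix.mul_sub, Matrix.sub_mul, mul_vecMulVec, mul_vecMulVec,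
        vecMulVec_mul, vecMulVec_mul, hT2, hT2, hb2]
      simp
    rw [h2, h3] at h1
    refine wedge_ne_zero ha hb ?_
    have h4 : (3 : Matrix (Fin N) (Fin N) K) * wedge ((e.1 ^ 2) *ᵥ a) (e.1 *ᵥ b) = 0 := by
      rw [wedge, mul_sub]
      have h1' : _ = (0 : Matrix (Fin N) (Fin N) K) := h1
      rw [← h1']
      simp only [Matrix.zero_mul, Matrix.mul_zero]
      abel
    have h5 : (3 : K) • wedge ((e.1 ^ 2) *ᵥ a) (e.1 *ᵥ b) = 0 := by
      rw [← h4, ← Matrix.diagonal_ofNat, Matrix.smul_eq_diagonal_mul]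
    exact (smul_eq_zero.1 h5).resolve_left three_ne_zero

/-- If `e³ = 0`, then `(ad e)⁵ = 0` and `(ad e)⁴ z = 6 e² z e²`, whose value on `a ∧ b` is a
multiple of `e² a ∧ e² b`. -/
theorem height_four_of_cube_eq_zero {e : soLie K N} (he : e.1 ^ 3 = 0) {a b : Fin N → K}
    (ha : (e.1 ^ 2) *ᵥ a ≠ 0) (hb : ∀ c : K, (e.1 ^ 2) *ᵥ b ≠ c • ((e.1 ^ 2) *ᵥ a)) :
    IsGreatest {d : ℕ | (LieAlgebra.ad K (soLie K N) e) ^ d ≠ 0} 4 := by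
  have he4 : e.1 ^ 4 = 0 := by rw [pow_succ, he, Matrix.zero_mul]
  have he5 : e.1 ^ 5 = 0 := by rw [pow_succ, he4, Matrix.zero_mul]
  refine isGreatest_ad_pow ?_ ⟨wedgeSo a b, fun h => ?_⟩
  · ext1 z
    refine Subtype.ext ?_
    rw [ad_pow_five_coe, he, he4, he5]
    simp
  · have h1 := congrArg Subtype.val h
    rw [ad_pow_four_coe, he, he4] at h1
    have h2 : e.1 ^ 2 * (wedgeSo a b).1 * e.1 ^ 2 = wedge ((e.1 ^ 2) *ᵥ a) ((e.1 ^ 2) *ᵥ b) := by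
      rw [← mul_wedge_mul, sq_transpose]; rfl
    rw [h2] at h1
    refine wedge_ne_zero ha hb ?_
    have h4 : (6 : Matrix (Fin N) (Fin N) K) * wedge ((e.1 ^ 2) *ᵥ a) ((e.1 ^ 2) *ᵥ b) = 0 := by
      simpa using h1
    have h5 : (6 : K) • wedge ((e.1 ^ 2) *ᵥ a) ((e.1 ^ 2) *ᵥ b) = 0 := by
      rw [← h4, ← Matrix.diagonal_ofNat, Matrix.smul_eq_diagonal_mul]
    exact (smul_eq_zero.1 h5).resolve_left (by norm_num)

end HeightCriteria

/-! ### Nilpotent elements of given Jordan type up to conjugacy -/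

section NilOrbits

variable {K : Type*} [Field K] {N : ℕ}

/-- Skew-symmetric matrices of the same Jordan type are conjugate under the orthogonal group. -/
theorem nilOrbit_exists_orthogonal [IsAlgClosed K] [CharZero K] {μ : List ℕ} {x y : soLie K N}
    (hx : HasJordanType x.1 μ) (hy : HasJordanType y.1 μ) :
    ∃ o : Matrix (Fin N) (Fin N) K, oᵀ * o = 1 ∧ x.1 * o = o * y.1 := by
  obtain ⟨h, h1, h2⟩ := hx.exists_conj hy
  exact exists_orthogonal_conj (soLie_transpose x) (soLie_transpose y) h1 h2

theorem hasJordanType_of_orthogonal {μ : List ℕ} {x y o : Matrix (Fin N) (Fin N) K}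
    (ho : oᵀ * o = 1) (hc : x * o = o * y) (hy : HasJordanType y μ) : HasJordanType x μ := by
  refine HasJordanType.conj ?_ hc hy
  rcases det_eq_of_orthogonal ho with h | h <;> rw [h] <;> simp

theorem Ad_mem_nilOrbit {μ : List ℕ} (g : SO K N) {x : soLie K N} (hx : x ∈ nilOrbit K N μ) :
    Ad g x ∈ nilOrbit K N μ :=
  hasJordanType_of_orthogonal (SO_transpose_mul g) ((Ad_eq_iff g x _).1 rfl) hx

/-- If some orthogonal matrix of determinant `-1` commutes with `x`, then all skew-symmetric
matrices of the Jordan type of `x` form one `SO_N`-orbit. -/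
theorem nilOrbit_eq_adOrbit [IsAlgClosed K] [CharZero K] {μ : List ℕ} {x : soLie K N}
    (hx : x ∈ nilOrbit K N μ) {c : Matrix (Fin N) (Fin N) K} (hc : cᵀ * c = 1) (hd : c.det = -1)
    (hxc : x.1 * c = c * x.1) : nilOrbit K N μ = adOrbit ⊤ x := by
  ext y
  constructor
  · intro hy
    obtain ⟨o, ho, hyo⟩ := nilOrbit_exists_orthogonal (x := y) (y := x) hy hx
    rcases det_eq_of_orthogonal ho with h | h
    · exact ⟨mkSO o ho h, trivial, ((Ad_eq_iff _ _ _).2 hyo).symm⟩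
    · refine ⟨mkSO (o * c) (orthogonal_mul ho hc) (by simp [h, hd]), trivial,
        ((Ad_eq_iff _ _ _).2 ?_).symm⟩
      change y.1 * (o * c) = o * c * x.1
      rw [← Matrix.mul_assoc, hyo, Matrix.mul_assoc, hxc, Matrix.mul_assoc]
  · rintro ⟨g, -, rfl⟩
    exact Ad_mem_nilOrbit g hx

end NilOrbits

/-! ### Kernels, centralizers and square-zero skew-symmetric matrices -/

section SkewLinearAlgebra

variable {K : Type*} [Field K] {N : ℕ}

/-- The orthogonal complement of the kernel of a skew-symmetric matrix is its image. -/
theorem exists_mulVec_eq_of_orthogonal_ker (x : soLie K N) (v : Fin N → K)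
    (h : ∀ z, x.1 *ᵥ z = 0 → v ⬝ᵥ z = 0) : ∃ p, x.1 *ᵥ p = v := by
  let φ : Module.Dual K (Fin N → K) := dotProductBilin K K v
  have h1 : φ ∈ (LinearMap.ker x.1.mulVecLin).dualAnnihilator := by
    rw [Submodule.mem_dualAnnihilator]
    exact fun z hz => h z hz
  rw [← LinearMap.range_dualMap_eq_dualAnnihilator_ker] at h1
  obtain ⟨ψ, hψ⟩ := h1
  have h2 : ∀ w, ψ (x.1 *ᵥ w) = v ⬝ᵥ w := fun w => LinearMap.congr_fun hψ w
  let p : Fin N → K := fun i => ψ (Pi.single i 1)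
  have h3 : ∀ w, ψ w = p ⬝ᵥ w := by
    intro w
    conv_lhs => rw [pi_eq_sum_univ' w]
    simp [dotProduct, p, mul_comm]
  refine ⟨-p, dotProduct_eq _ _ fun w => ?_⟩
  rw [skew_dotProduct, neg_dotProduct, neg_neg, ← h3, h2]

/-- If every vector of the kernel is isotropic, then the kernel is orthogonal to itself, hence
contained in the image. -/
theorem exists_nonisotropic_ker [CharZero K] (x : soLie K N)
    (h : ¬ LinearMap.ker x.1.mulVecLin ≤ LinearMap.range x.1.mulVecLin) :
    ∃ w, x.1 *ᵥ w = 0 ∧ w ⬝ᵥ w ≠ 0 := by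
  by_contra! hcon
  refine h fun w hw => exists_mulVec_eq_of_orthogonal_ker x w fun z hz => ?_
  have hw' : x.1 *ᵥ w = 0 := hw
  have h1 := hcon (w + z) (by rw [Matrix.mulVec_add, hw', hz, add_zero])
  rw [add_dotProduct, dotProduct_add, dotProduct_add, hcon w hw', hcon z hz, dotProduct_comm z w,
    zero_add, add_zero, ← two_mul] at h1
  exact (mul_eq_zero.1 h1).resolve_left two_ne_zero

theorem exists_two_of_two_le_rank {A : Matrix (Fin N) (Fin N) K} (h : 2 ≤ A.rank) :
    ∃ a b, A *ᵥ a ≠ 0 ∧ ∀ c : K, A *ᵥ b ≠ c • (A *ᵥ a) := by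
  obtain ⟨a, ha⟩ : ∃ a, A *ᵥ a ≠ 0 := by
    by_contra! hcon
    have : A = 0 := Matrix.toLin'.injective (LinearMap.ext fun v => by simpa using hcon v)
    rw [this, Matrix.rank_zero] at h
    omega
  by_contra! hcon
  have : A.rank ≤ 1 := by
    refine finrank_le_one (⟨A *ᵥ a, ⟨a, rfl⟩⟩ : LinearMap.range A.mulVecLin) ?_
    rintro ⟨_, ⟨b, rfl⟩⟩
    obtain ⟨c, hc⟩ := hcon a b ha
    exact ⟨c, Subtype.ext hc.symm⟩
  omega

/-- An orthogonal matrix commuting with a skew-symmetric `e` of type `(2^r)`, `N = 2r`, has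
determinant one: it acts on `im e = ker e` and on the quotient by matrices `p` conjugate through
`e`, and `p` preserves the nondegenerate form `⟨e s, t⟩` on the quotient. -/
theorem det_eq_one_of_commute {e : soLie K N} {r : ℕ} (he : e.1 ^ 2 = 0) (hr : e.1.rank = r)
    (hN : N = 2 * r) {c : Matrix (Fin N) (Fin N) K} (hc : cᵀ * c = 1) (hce : e.1 * c = c * e.1) :
    c.det = 1 := by
  obtain ⟨B⟩ : Nonempty (Module.Basis (Fin r) K (LinearMap.range e.1.mulVecLin)) :=
    ⟨Module.finBasisOfFinrankEq K _ hr⟩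
  have ht : ∀ i, ∃ t, e.1 *ᵥ t = (B i : Fin N → K) := fun i => (B i).2
  choose t ht using ht
  have hB : LinearIndependent K fun i => (B i : Fin N → K) :=
    B.linearIndependent.map' (Submodule.subtype _) (Submodule.ker_subtype _)
  have hee : ∀ v, e.1 *ᵥ (e.1 *ᵥ v) = 0 := fun v => by
    rw [Matrix.mulVec_mulVec, ← pow_two, he, Matrix.zero_mulVec]
  have hli : LinearIndependent K (Sum.elim (fun i => e.1 *ᵥ t i) t) := by
    rw [Fintype.linearIndependent_iff]
    intro g hg
    rw [Fintype.sum_sum_type] at hg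
    simp only [Sum.elim_inl, Sum.elim_inr] at hg
    have h1 := congrArg (fun v => e.1 *ᵥ v) hg
    simp only [Matrix.mulVec_add, Matrix.mulVec_sum, Matrix.mulVec_smul, hee, smul_zero,
      Finset.sum_const_zero, zero_add, Matrix.mulVec_zero] at h1
    simp only [ht] at h1
    have h2 := Fintype.linearIndependent_iff.1 hB _ h1
    simp only [h2, zero_smul, Finset.sum_const_zero, add_zero, ht] at hg
    have h3 := Fintype.linearIndependent_iff.1 hB _ hg
    rintro (i | i)
    · exact h3 i
    · exact h2 i
  obtain ⟨b, hb⟩ : ∃ b : Module.Basis (Fin r ⊕ Fin r) K (Fin N → K),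
      ∀ i, b i = Sum.elim (fun i => e.1 *ᵥ t i) t i := by
    rcases Nat.eq_zero_or_pos r with h0 | h0
    · subst h0; subst hN
      have : IsEmpty (Fin (2 * 0)) := ⟨fun i => by have := i.2; omega⟩
      exact ⟨Module.Basis.empty _, fun i => isEmptyElim i⟩
    · have : Nonempty (Fin r ⊕ Fin r) := ⟨Sum.inl ⟨0, h0⟩⟩
      exact ⟨basisOfLinearIndependentOfCardEqFinrank hli (by simp; omega), fun i => by simp⟩
  let M : Matrix (Fin N) (Fin r ⊕ Fin r) K := Matrix.of fun i j => b j i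
  let C := LinearMap.toMatrix b b (Matrix.toLin' c)
  have hM : c * M = M * C := by
    ext i j
    have h1 : c *ᵥ b j = ∑ k, C k j • b k := by
      rw [← Matrix.toLin'_apply, ← b.sum_repr (Matrix.toLin' c (b j))]
      simp [C, LinearMap.toMatrix_apply]
    have h2 := congrFun h1 i
    simp only [Finset.sum_apply, Pi.smul_apply, smul_eq_mul] at h2
    simp only [Matrix.mul_apply, M, Matrix.of_apply]
    simp only [Matrix.mulVec, dotProduct] at h2
    rw [h2]
    exact Finset.sum_congr rfl fun k _ => mul_comm _ _
  let p : Matrix (Fin r) (Fin r) K := C.toBlocks₂₂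
  let q : Matrix (Fin r) (Fin r) K := C.toBlocks₁₂
  have hct : ∀ j, c *ᵥ t j = ∑ k, q k j • (e.1 *ᵥ t k) + ∑ k, p k j • t k := by
    intro j
    have h1 : c *ᵥ b (Sum.inr j) = ∑ k, C k (Sum.inr j) • b k := by
      rw [← Matrix.toLin'_apply, ← b.sum_repr (Matrix.toLin' c (b (Sum.inr j)))]
      simp [C, LinearMap.toMatrix_apply]
    rw [Fintype.sum_sum_type] at h1
    simp only [hb, Sum.elim_inl, Sum.elim_inr] at h1
    exact h1
  have hcet : ∀ j, c *ᵥ (e.1 *ᵥ t j) = ∑ k, p k j • (e.1 *ᵥ t k) := by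
    intro j
    rw [Matrix.mulVec_mulVec, ← hce, ← Matrix.mulVec_mulVec, hct]
    simp [Matrix.mulVec_add, Matrix.mulVec_sum, Matrix.mulVec_smul, hee]
  have hC : C = Matrix.fromBlocks p q 0 p := by
    have h1 : ∀ j k, C k (Sum.inl j) = Sum.elim (fun k => p k j) (fun _ => 0) k := by
      intro j k
      have h2 : c *ᵥ b (Sum.inl j) = ∑ k, Sum.elim (fun k => p k j) (fun _ => 0) k • b k := by
        rw [Fintype.sum_sum_type]
        simp [hb, hcet]
      have h3 : C k (Sum.inl j) = b.repr (c *ᵥ b (Sum.inl j)) k := by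
        simp [C, LinearMap.toMatrix_apply]
      rw [h3, h2, Module.Basis.repr_sum_self]
    ext (k | k) (j | j)
    · simpa using h1 j (Sum.inl k)
    · rfl
    · simpa using h1 j (Sum.inr k)
    · rfl
  have hdet : c.det = p.det * p.det := by
    rw [← LinearMap.det_toLin' c, ← LinearMap.det_toMatrix b]
    change C.det = _
    rw [hC, Matrix.det_fromBlocks_zero₂₁]
  -- the form `⟨e s, t⟩` on the tops of the chains
  let A : Matrix (Fin r) (Fin r) K := Matrix.of fun i j => (e.1 *ᵥ t i) ⬝ᵥ t j
  have hbot : ∀ v w, (e.1 *ᵥ v) ⬝ᵥ (e.1 *ᵥ w) = 0 := fun v w => by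
    rw [skew_dotProduct, hee, dotProduct_zero, neg_zero]
  have hA : pᵀ * A * p = A := by
    ext i j
    have h1 : (c *ᵥ (e.1 *ᵥ t i)) ⬝ᵥ (c *ᵥ t j) = (e.1 *ᵥ t i) ⬝ᵥ t j := by
      rw [Matrix.dotProduct_mulVec, Matrix.vecMul_mulVec, hc, Matrix.vecMul_one]
    rw [hcet, hct, dotProduct_add, dotProduct_sum, dotProduct_sum] at h1
    simp only [sum_dotProduct, smul_dotProduct, dotProduct_smul, hbot, smul_eq_mul, mul_zero,
      Finset.sum_const_zero, zero_add] at h1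
    simp only [Matrix.mul_apply, Matrix.transpose_apply]
    simp only [A, Matrix.of_apply]
    rw [← h1]
    refine Finset.sum_congr rfl fun k _ => ?_
    rw [Finset.sum_mul, Finset.mul_sum]
    exact Finset.sum_congr rfl fun l _ => by ring
  have hAdet : A.det ≠ 0 := by
    intro h0
    obtain ⟨y, hy0, hy⟩ := Matrix.exists_vecMul_eq_zero_iff.2 h0
    have h1 : ∑ i, y i • (e.1 *ᵥ t i) = 0 := by
      refine dotProduct_eq _ _ fun w => ?_
      rw [zero_dotProduct]
      have h2 : ∀ j, (∑ i, y i • (e.1 *ᵥ t i)) ⬝ᵥ b j = 0 := by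
        rintro (j | j)
        · simp [hb, sum_dotProduct, hbot]
        · rw [hb, Sum.elim_inr, sum_dotProduct]
          simp only [smul_dotProduct, smul_eq_mul]
          exact congrFun hy j
      rw [← b.sum_repr w, dotProduct_sum]
      exact Finset.sum_eq_zero fun j _ => by rw [dotProduct_smul, h2, smul_zero]
    simp only [ht] at h1
    exact hy0 (funext (Fintype.linearIndependent_iff.1 hB _ h1))
  have h1 := congrArg Matrix.det hA
  rw [Matrix.det_mul, Matrix.det_mul, Matrix.det_transpose] at h1
  rw [hdet]
  exact mul_left_cancel₀ hAdet (by linear_combination h1)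

/-- There are isotropic frames of every size up to half the dimension. -/
theorem exists_isotropic_frame [IsAlgClosed K] {p : Type*} [Fintype p] [DecidableEq p] {m : ℕ}
    (hN : N = 2 * Fintype.card p + m) :
    ∃ (U : Matrix (Fin N) p K) (L : Matrix p (Fin N) K), Uᵀ * U = 0 ∧ L * U = 1 := by
  obtain ⟨I, hI⟩ := IsAlgClosed.exists_pow_nat_eq (-1 : K) (n := 2) (by norm_num)
  let ε : Fin N ≃ (p ⊕ p) ⊕ Fin m := Fintype.equivOfCardEq (by simp; omega)
  refine ⟨(Matrix.fromRows (Matrix.fromRows 1 (I • 1)) 0).submatrix ε id,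
    (Matrix.fromCols (Matrix.fromCols 1 0) 0).submatrix id ε, ?_, ?_⟩
  · rw [Matrix.transpose_submatrix, Matrix.submatrix_mul_equiv, Matrix.transpose_fromRows,
      Matrix.fromCols_mul_fromRows, Matrix.transpose_fromRows, Matrix.fromCols_mul_fromRows]
    simp [← pow_two, smul_pow, hI]
  · rw [Matrix.submatrix_mul_equiv, Matrix.fromCols_mul_fromRows, Matrix.fromCols_mul_fromRows]
    simp

/-- Existence of skew-symmetric square-zero matrices of even rank `2k`, for `4k ≤ N`. -/
theorem exists_sq_zero [IsAlgClosed K] {k m : ℕ} (hN : N = 4 * k + m) :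
    ∃ e : soLie K N, e.1 ^ 2 = 0 ∧ e.1.rank = 2 * k := by
  obtain ⟨U, L, hU, hL⟩ := exists_isotropic_frame (K := K) (N := N) (p := Fin k ⊕ Fin k) (m := m)
    (by simp; omega)
  have hJ := Matrix.J_transpose (Fin k) K
  refine ⟨⟨U * Matrix.J (Fin k) K * Uᵀ, ?_⟩, ?_, le_antisymm ?_ ?_⟩
  · rw [mem_so]
    simp [Matrix.transpose_mul, hJ, Matrix.mul_assoc]
  · change (U * Matrix.J (Fin k) K * Uᵀ) ^ 2 = 0
    rw [pow_two]
    calc _ = U * Matrix.J (Fin k) K * (Uᵀ * U) * Matrix.J (Fin k) K * Uᵀ := by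
          simp only [Matrix.mul_assoc]
      _ = 0 := by rw [hU]; simp
  · refine (Matrix.rank_mul_le_right _ _).trans ((Matrix.rank_le_card_height _).trans ?_)
    simp; omega
  · have h1 : L * (U * Matrix.J (Fin k) K * Uᵀ) * Lᵀ = Matrix.J (Fin k) K := by
      have h2 : Uᵀ * Lᵀ = 1 := by rw [← Matrix.transpose_mul, hL, Matrix.transpose_one]
      calc _ = (L * U) * Matrix.J (Fin k) K * (Uᵀ * Lᵀ) := by simp only [Matrix.mul_assoc]
        _ = _ := by rw [hL, h2]; simp
    have h2 : (Matrix.J (Fin k) K).rank = 2 * k := by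
      rw [Matrix.rank_of_isUnit _ ((Matrix.isUnit_iff_isUnit_det _).2 (Matrix.isUnit_det_J _ _))]
      simp; omega
    calc 2 * k = (L * (U * Matrix.J (Fin k) K * Uᵀ) * Lᵀ).rank := by rw [h1, h2]
      _ ≤ _ := (Matrix.rank_mul_le_left _ _).trans (Matrix.rank_mul_le_right _ _)

end SkewLinearAlgebra

/-! ### Unipotent one-parameter groups -/

section Exponential

variable {K : Type*} [Field K] {N : ℕ}

theorem smul_cube_eq_zero {y : soLie K N} (hy : y.1 ^ 3 = 0) (t : K) :
    ((t • y : soLie K N).1) ^ 3 = 0 := by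
  change (t • y.1) ^ 3 = 0
  rw [smul_pow, hy, smul_zero]

/-- The exponential series of a matrix with vanishing cube. -/
noncomputable def expMat (y : Matrix (Fin N) (Fin N) K) :
    Matrix (Fin N) (Fin N) K := 1 + y + (2 : K)⁻¹ • y ^ 2

variable [CharZero K]

theorem expMat_orthogonal {y : soLie K N} (hy : y.1 ^ 3 = 0) :
    (expMat y.1)ᵀ * expMat y.1 = 1 := by
  have h4 : y.1 ^ 4 = 0 := by rw [pow_succ, hy, Matrix.zero_mul]
  have h1 : (expMat y.1)ᵀ = 1 - y.1 + (2 : K)⁻¹ • y.1 ^ 2 := by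
    rw [expMat, Matrix.transpose_add, Matrix.transpose_add, Matrix.transpose_smul, sq_transpose,
      soLie_transpose, Matrix.transpose_one, sub_eq_add_neg]
  have h2 : (1 - y.1 + (2 : K)⁻¹ • y.1 ^ 2) * (1 + y.1 + (2 : K)⁻¹ • y.1 ^ 2)
      = 1 - y.1 ^ 2 + ((2 : K)⁻¹ + (2 : K)⁻¹) • y.1 ^ 2
        + ((2 : K)⁻¹ * (2 : K)⁻¹) • y.1 ^ 4 := by
    simp only [pow_succ, pow_zero, one_mul, mul_one, mul_assoc, add_mul, mul_add, sub_mul,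
      smul_mul_assoc, mul_smul_comm, smul_smul, smul_add]
    module
  rw [h1, expMat, h2, h4]
  have : (2 : K)⁻¹ + (2 : K)⁻¹ = 1 := by norm_num
  rw [this]
  simp

/-- The matrix is the square of an orthogonal matrix. -/
theorem expMat_det {y : soLie K N} (hy : y.1 ^ 3 = 0) : (expMat y.1).det = 1 := by
  have h4 : y.1 ^ 4 = 0 := by rw [pow_succ, hy, Matrix.zero_mul]
  have hz : (((2 : K)⁻¹ • y : soLie K N).1) ^ 3 = 0 := by
    change ((2 : K)⁻¹ • y.1) ^ 3 = 0
    rw [smul_pow, hy, smul_zero]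
  have h1 : expMat ((2 : K)⁻¹ • y.1) * expMat ((2 : K)⁻¹ • y.1) = expMat y.1 := by
    have e : expMat ((2 : K)⁻¹ • y.1) = 1 + (2 : K)⁻¹ • y.1 + (8 : K)⁻¹ • y.1 ^ 2 := by
      rw [expMat, smul_pow, smul_smul]; norm_num
    rw [e]
    have h2 : (1 + (2 : K)⁻¹ • y.1 + (8 : K)⁻¹ • y.1 ^ 2) *
        (1 + (2 : K)⁻¹ • y.1 + (8 : K)⁻¹ • y.1 ^ 2)
        = 1 + ((2 : K)⁻¹ + (2 : K)⁻¹) • y.1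
          + ((2 : K)⁻¹ * (2 : K)⁻¹ + (8 : K)⁻¹ + (8 : K)⁻¹) • y.1 ^ 2
          + ((2 : K)⁻¹ * (8 : K)⁻¹ + (8 : K)⁻¹ * (2 : K)⁻¹) • y.1 ^ 3
          + ((8 : K)⁻¹ * (8 : K)⁻¹) • y.1 ^ 4 := by
      simp only [pow_succ, pow_zero, one_mul, mul_one, mul_assoc, add_mul, mul_add,
        smul_mul_assoc, mul_smul_comm, smul_smul, smul_add]
      module
    rw [h2, hy, h4, expMat]
    norm_num
  have h2 := det_eq_of_orthogonal (expMat_orthogonal hz)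
  have h3 : (expMat y.1).det = (expMat ((2 : K)⁻¹ • y.1)).det ^ 2 := by
    rw [← h1, Matrix.det_mul, pow_two]
  rw [h3]
  rcases h2 with h | h
  · have h' : (expMat ((2 : K)⁻¹ • y.1)).det = 1 := h
    rw [h', one_pow]
  · have h' : (expMat ((2 : K)⁻¹ • y.1)).det = -1 := h
    rw [h']; norm_num

/-- The unipotent element `exp y` of `SO_N` attached to `y ∈ so_N` with `y³ = 0`. -/
noncomputable def expSO (y : soLie K N) (hy : y.1 ^ 3 = 0) : SO K N :=
  mkSO (expMat y.1) (expMat_orthogonal hy) (expMat_det hy)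

theorem isPolyCurve_Ad_exp {y : soLie K N} (hy : y.1 ^ 3 = 0) (e : soLie K N) :
    IsPolyCurve fun t => (Ad (expSO (t • y) (smul_cube_eq_zero hy t)) e).1 := by
  have h1 : IsPolyCurve fun t : K => expMat (t • y.1) := by
    have h : (fun t : K => expMat (t • y.1)) = fun t : K =>
        1 + (Polynomial.X : Polynomial K).eval t • y.1
          + (Polynomial.X ^ 2 : Polynomial K).eval t • ((2 : K)⁻¹ • y.1 ^ 2) := by
      funext t
      rw [expMat, smul_pow, Polynomial.eval_X, Polynomial.eval_pow, Polynomial.eval_X,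
        smul_comm]
    rw [h]
    exact ((IsPolyCurve.const _).add ((IsPolyCurve.const _).smul _)).add
      ((IsPolyCurve.const _).smul _)
  have h2 : IsPolyCurve fun t : K => (expMat (t • y.1))ᵀ := by
    obtain ⟨Γ, hΓ⟩ := h1
    exact ⟨Γᵀ, fun t => by
      have := hΓ t
      simp only at this ⊢
      rw [this]; ext; simp⟩
  exact (h1.mul (IsPolyCurve.const e.1)).mul h2

end Exponential

/-! ### The standard embedding of `so_n` into `so_{n+1}` -/

section StandardEmbedding

variable {K : Type*} [Field K] {n : ℕ}

theorem extend_castSucc_castSucc (A : Matrix (Fin n) (Fin n) K) (c : K) (i j : Fin n) :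
    extend A c i.castSucc j.castSucc = A i j := by
  have h : ∀ i : Fin n, (finSumFinEquiv (m := n) (n := 1)).symm i.castSucc = Sum.inl i := fun i =>
    finSumFinEquiv_symm_apply_castAdd i
  simp [extend, h]

theorem extend_castSucc_last (A : Matrix (Fin n) (Fin n) K) (c : K) (i : Fin n) :
    extend A c i.castSucc (Fin.last n) = 0 := by
  have h : ∀ i : Fin n, (finSumFinEquiv (m := n) (n := 1)).symm i.castSucc = Sum.inl i := fun i =>
    finSumFinEquiv_symm_apply_castAdd i
  simp [extend, h]

theorem extend_last_castSucc (A : Matrix (Fin n) (Fin n) K) (c : K) (i : Fin n) :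
    extend A c (Fin.last n) i.castSucc = 0 := by
  have h : ∀ i : Fin n, (finSumFinEquiv (m := n) (n := 1)).symm i.castSucc = Sum.inl i := fun i =>
    finSumFinEquiv_symm_apply_castAdd i
  simp [extend, h]

theorem extend_last_last (A : Matrix (Fin n) (Fin n) K) (c : K) :
    extend A c (Fin.last n) (Fin.last n) = c := by
  simp [extend]

/-- The last basis vector, fixed by the subgroup `SO_n` of `SO_{n+1}`. -/
def lastVec (K : Type*) [Field K] (n : ℕ) : Fin (n + 1) → K := Pi.single (Fin.last n) 1

theorem mulVec_lastVec (A : Matrix (Fin (n + 1)) (Fin (n + 1)) K) (i : Fin (n + 1)) :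
    (A *ᵥ lastVec K n) i = A i (Fin.last n) := by
  simp [lastVec]

theorem lastVec_castSucc (i : Fin n) : lastVec K n i.castSucc = 0 := by
  simp [lastVec, Fin.castSucc_ne_last]

theorem lastVec_last : lastVec K n (Fin.last n) = 1 := by simp [lastVec]

theorem lastVec_dotProduct_self : lastVec K n ⬝ᵥ lastVec K n = 1 := by simp [lastVec]

theorem extend_mulVec_lastVec (A : Matrix (Fin n) (Fin n) K) (c : K) :
    extend A c *ᵥ lastVec K n = c • lastVec K n := by
  ext i
  rw [mulVec_lastVec]
  induction i using Fin.lastCases with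
  | last => simp [extend_last_last, lastVec_last]
  | cast i => simp [extend_castSucc_last, lastVec_castSucc]

theorem soLie_apply_self [CharZero K] {N : ℕ} (x : soLie K N) (i : Fin N) : x.1 i i = 0 := by
  have := congrFun (congrFun (soLie_transpose x) i) i
  exact self_eq_neg.1 this

theorem soLie_apply_swap {N : ℕ} (x : soLie K N) (i j : Fin N) : x.1 j i = -x.1 i j :=
  congrFun (congrFun (soLie_transpose x) i) j

/-- The upper left `n × n` block of `y ∈ so_{n+1}`. -/
def block (y : soLie K (n + 1)) : soLie K n :=
  ⟨y.1.submatrix Fin.castSucc Fin.castSucc, by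
    rw [mem_so, Matrix.transpose_submatrix, soLie_transpose]; rfl⟩

theorem block_apply (y : soLie K (n + 1)) (i j : Fin n) :
    (block y).1 i j = y.1 i.castSucc j.castSucc := rfl

theorem stdLieHom_coe (x : soLie K n) : (stdLieHom K n x).1 = extend x.1 0 := rfl

theorem block_stdLieHom (x : soLie K n) : block (stdLieHom K n x) = x :=
  Subtype.ext (by ext i j; rw [block_apply, stdLieHom_coe, extend_castSucc_castSucc])

/-- The decomposition of `y ∈ so_{n+1}` along `so_n` and its complement. -/
theorem eq_block_add_wedge [CharZero K] (y : soLie K (n + 1)) :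
    y = stdLieHom K n (block y) + wedgeSo (lastVec K n) (y.1 *ᵥ lastVec K n) := by
  refine Subtype.ext ?_
  change y.1 = extend (block y).1 0 + wedge (lastVec K n) (y.1 *ᵥ lastVec K n)
  ext i j
  rw [Matrix.add_apply, wedge_apply, mulVec_lastVec, mulVec_lastVec]
  induction i using Fin.lastCases with
  | last =>
    induction j using Fin.lastCases with
    | last => rw [extend_last_last, soLie_apply_self]; ring
    | cast j =>
      rw [extend_last_castSucc, lastVec_castSucc, lastVec_last, soLie_apply_swap y j.castSucc]; ring
  | cast i =>
    induction j using Fin.lastCases with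
    | last => rw [extend_castSucc_last, lastVec_castSucc, lastVec_last]; ring
    | cast j => rw [extend_castSucc_castSucc, lastVec_castSucc, lastVec_castSucc, block_apply]; ring

theorem trace_extend_zero_mul (A : Matrix (Fin n) (Fin n) K) (y : soLie K (n + 1)) :
    (extend A 0 * y.1).trace = (A * (block y).1).trace := by
  simp only [Matrix.trace, Matrix.diag_apply, Matrix.mul_apply, Fin.sum_univ_castSucc,
    extend_castSucc_castSucc, extend_castSucc_last, extend_last_castSucc, extend_last_last,
    block_apply]
  simp

theorem mem_isotropy_stdso_iff [CharZero K] (hn : 2 ≤ n) (y : soLie K (n + 1)) :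
    y ∈ isotropy (stdso K n) ↔ block y = 0 := by
  rw [mem_isotropy_iff (by omega)]
  constructor
  · intro h
    refine Subtype.ext ?_
    ext i j
    have h1 := h (stdLieHom K n (wedgeSo (Pi.single i 1) (Pi.single j 1))) ⟨_, rfl⟩
    rw [stdLieHom_coe, trace_extend_zero_mul, wedgeSo_coe, wedge, Matrix.sub_mul,
      Matrix.trace_sub, vecMulVec_mul, vecMulVec_mul, trace_vecMulVec, trace_vecMulVec] at h1
    have h2 : (block y).1 i j - (block y).1 j i = 0 := by simpa using h1
    rw [soLie_apply_swap (block y) i j, sub_neg_eq_add, ← two_mul] at h2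
    exact (mul_eq_zero.1 h2).resolve_left two_ne_zero
  · rintro h _ ⟨x, rfl⟩
    change (extend x.1 0 * y.1).trace = 0
    rw [trace_extend_zero_mul, h]
    change (x.1 * 0).trace = 0
    simp

theorem wedge_lastVec_mem_isotropy [CharZero K] (hn : 2 ≤ n) (u : Fin (n + 1) → K) :
    wedgeSo (lastVec K n) u ∈ isotropy (stdso K n) := by
  rw [mem_isotropy_stdso_iff hn]
  refine Subtype.ext ?_
  ext i j
  rw [block_apply, wedgeSo_coe, wedge_apply, lastVec_castSucc, lastVec_castSucc]
  change u i.castSucc * 0 - 0 * u j.castSucc = 0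
  ring

theorem isCompl_stdso [CharZero K] (hn : 2 ≤ n) :
    IsCompl (stdso K n).toSubmodule (isotropy (stdso K n)) := by
  rw [isCompl_iff, Submodule.disjoint_def, Submodule.codisjoint_iff_exists_add_eq]
  constructor
  · rintro _ ⟨x, rfl⟩ hx
    have h1 := (mem_isotropy_stdso_iff hn _).1 hx
    have h2 : block (stdLieHom K n x) = x := block_stdLieHom x
    have h3 : x = 0 := h2.symm.trans h1
    change stdLieHom K n x = 0
    rw [h3, map_zero]
  · intro y
    exact ⟨_, _, ⟨block y, rfl⟩, wedge_lastVec_mem_isotropy hn _, (eq_block_add_wedge y).symm⟩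

theorem projection_stdso [CharZero K] (hn : 2 ≤ n)
    (hc : IsCompl (stdso K n).toSubmodule (isotropy (stdso K n))) (y : soLie K (n + 1)) :
    Submodule.projection _ _ hc y = stdLieHom K n (block y) := by
  conv_lhs => rw [eq_block_add_wedge y]
  have h1 : stdLieHom K n (block y) ∈ (stdso K n).toSubmodule := ⟨block y, rfl⟩
  rw [map_add, Submodule.projection_apply_of_mem_left _ h1,
    (Submodule.projection_apply_eq_zero_iff hc).2 (wedge_lastVec_mem_isotropy hn _), add_zero]

theorem extend_pow (A : Matrix (Fin n) (Fin n) K) {j : ℕ} (hj : j ≠ 0) :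
    extend A 0 ^ j = extend (A ^ j) 0 := by
  induction j with
  | zero => exact absurd rfl hj
  | succ j ih =>
    rcases Nat.eq_zero_or_pos j with rfl | h
    · simp
    · rw [pow_succ, ih h.ne', extend_mul, pow_succ, mul_zero]

theorem extend_zero_zero : extend (0 : Matrix (Fin n) (Fin n) K) 0 = 0 := by
  ext i j
  induction i using Fin.lastCases <;> induction j using Fin.lastCases <;>
    simp [extend_castSucc_castSucc, extend_castSucc_last, extend_last_castSucc, extend_last_last]

theorem rank_extend_zero (A : Matrix (Fin n) (Fin n) K) : (extend A 0).rank = A.rank := by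
  let E : Matrix (Fin (n + 1)) (Fin n) K :=
    (1 : Matrix (Fin (n + 1)) (Fin (n + 1)) K).submatrix id Fin.castSucc
  have h1 : extend A 0 = E * A * Eᵀ := by
    ext i j
    induction i using Fin.lastCases <;> induction j using Fin.lastCases <;>
    simp [E, Matrix.mul_apply, Matrix.one_apply, extend_castSucc_castSucc, extend_castSucc_last,
      extend_last_castSucc, extend_last_last, Fin.castSucc_ne_last, (Fin.castSucc_ne_last _).symm]
  have h2 : A = Eᵀ * extend A 0 * E := by
    have h3 : Eᵀ * E = 1 := by
      ext i j
      simp [E, Matrix.mul_apply, Matrix.one_apply]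
    calc A = (Eᵀ * E) * A * (Eᵀ * E) := by rw [h3]; simp
      _ = Eᵀ * (E * A * Eᵀ) * E := by simp only [Matrix.mul_assoc]
      _ = _ := by rw [← h1]
  refine le_antisymm ?_ ?_
  · rw [h1]
    exact (Matrix.rank_mul_le_left _ _).trans (Matrix.rank_mul_le_right _ _)
  · calc A.rank = (Eᵀ * extend A 0 * E).rank := by rw [← h2]
      _ ≤ _ := (Matrix.rank_mul_le_left _ _).trans (Matrix.rank_mul_le_right _ _)

/-- Extension of a vector of `K^n` by zero. -/
def extVec (u : Fin n → K) : Fin (n + 1) → K := Fin.snoc (α := fun _ => K) u 0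

@[simp] theorem extVec_castSucc (u : Fin n → K) (i : Fin n) : extVec u i.castSucc = u i := by
  simp [extVec]

@[simp] theorem extVec_last (u : Fin n → K) : extVec u (Fin.last n) = 0 := by simp [extVec]

theorem extend_mulVec_extVec (A : Matrix (Fin n) (Fin n) K) (c : K) (u : Fin n → K) :
    extend A c *ᵥ extVec u = extVec (A *ᵥ u) := by
  ext i
  simp only [Matrix.mulVec, dotProduct, Fin.sum_univ_castSucc]
  induction i using Fin.lastCases with
  | last => simp [extend_last_castSucc]
  | cast i =>
    simp only [extend_castSucc_castSucc, extVec_castSucc, extVec_last, mul_zero, add_zero]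
    rfl

theorem lastVec_dotProduct_extVec (u : Fin n → K) : lastVec K n ⬝ᵥ extVec u = 0 := by
  simp [dotProduct, Fin.sum_univ_castSucc, lastVec_castSucc]

theorem extVec_injective : Function.Injective (extVec : (Fin n → K) → _) := fun u w h =>
  funext fun i => by rw [← extVec_castSucc u, h, extVec_castSucc]

theorem exists_extVec [CharZero K] (y : soLie K (n + 1)) : ∃ u, y.1 *ᵥ lastVec K n = extVec u := by
  refine ⟨fun i => y.1 i.castSucc (Fin.last n), ?_⟩
  ext i
  rw [mulVec_lastVec]
  induction i using Fin.lastCases with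
  | last => rw [soLie_apply_self, extVec_last]
  | cast i => rw [extVec_castSucc]

end StandardEmbedding

/-! ### Projection of square-zero matrices to `so_n` -/

section ProjectionOfSquareZero

variable {K : Type*} [Field K] {n : ℕ}

theorem eq_neg_of_vecMulVec_self_eq {p : Type*} {a b : p → K}
    (h : vecMulVec a a = vecMulVec b b) : a = b ∨ a = -b := by
  have h1 : ∀ i j, a i * a j = b i * b j := fun i j => congrFun (congrFun h i) j
  by_cases hb : b = 0
  · left
    ext i
    have := h1 i i
    rw [hb] at this ⊢
    simpa using this
  · obtain ⟨i, hi⟩ := Function.ne_iff.1 hb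
    have hi' : b i ≠ 0 := hi
    rcases mul_self_eq_mul_self_iff.1 (h1 i i) with h2 | h2
    · left
      ext j
      have := h1 i j
      rw [h2] at this
      exact mul_left_cancel₀ hi' this
    · right
      ext j
      have := h1 i j
      rw [h2] at this
      exact mul_left_cancel₀ hi' (by rw [Pi.neg_apply]; linear_combination -this)

/-- The square-zero condition in terms of the block decomposition of a skew-symmetric matrix. -/
theorem sq_eq_zero_iff [CharZero K] {e : soLie K (n + 1)} {u : Fin n → K}
    (hu : e.1 *ᵥ lastVec K n = extVec u) : e.1 ^ 2 = 0 ↔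
      (block e).1 ^ 2 = vecMulVec u u ∧ (block e).1 *ᵥ u = 0 ∧ u ⬝ᵥ u = 0 := by
  have hu' : ∀ i : Fin n, e.1 i.castSucc (Fin.last n) = u i := fun i => by
    rw [← mulVec_lastVec e.1, hu, extVec_castSucc]
  have hu'' : ∀ i : Fin n, e.1 (Fin.last n) i.castSucc = -u i := fun i => by
    rw [soLie_apply_swap e i.castSucc, hu']
  have e1 : ∀ i j : Fin n, (e.1 ^ 2) i.castSucc j.castSucc
      = ((block e).1 ^ 2) i j - u i * u j := fun i j => by
    rw [pow_two, pow_two, Matrix.mul_apply, Matrix.mul_apply, Fin.sum_univ_castSucc, hu', hu'']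
    simp only [block_apply]
    ring
  have e2 : ∀ i : Fin n, (e.1 ^ 2) i.castSucc (Fin.last n) = ((block e).1 *ᵥ u) i := fun i => by
    rw [pow_two, Matrix.mul_apply, Fin.sum_univ_castSucc, soLie_apply_self]
    simp [Matrix.mulVec, dotProduct, hu', block_apply]
  have e3 : (e.1 ^ 2) (Fin.last n) (Fin.last n) = -(u ⬝ᵥ u) := by
    rw [pow_two, Matrix.mul_apply, Fin.sum_univ_castSucc, soLie_apply_self]
    simp [dotProduct, hu', hu'']
  constructor
  · intro h
    refine ⟨?_, ?_, ?_⟩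
    · ext i j
      have := e1 i j
      rw [h, Matrix.zero_apply] at this
      rw [vecMulVec_apply]
      linear_combination -this
    · ext i
      rw [← e2, h]; rfl
    · rw [h, Matrix.zero_apply] at e3
      linear_combination e3
  · rintro ⟨h1, h2, h3⟩
    ext i j
    rw [Matrix.zero_apply]
    induction i using Fin.lastCases with
    | last =>
      induction j using Fin.lastCases with
      | last => rw [e3, h3, neg_zero]
      | cast j =>
        have := congrFun (congrFun (sq_transpose e) (Fin.last n)) j.castSucc
        rw [← this, Matrix.transpose_apply, e2, h2]; rfl
    | cast i =>
      induction j using Fin.lastCases with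
      | last => rw [e2, h2]; rfl
      | cast j => rw [e1, h1, vecMulVec_apply, sub_self]

theorem coe_eq_extend_add_wedge [CharZero K] (e : soLie K (n + 1)) :
    e.1 = extend (block e).1 0 + wedge (lastVec K n) (e.1 *ᵥ lastVec K n) :=
  congrArg Subtype.val (eq_block_add_wedge e)

/-- Compressing a square-zero matrix that does not kill the last basis vector does not lower its
rank. -/
theorem rank_block [CharZero K] {e : soLie K (n + 1)} (he : e.1 ^ 2 = 0)
    (hu : e.1 *ᵥ lastVec K n ≠ 0) : (block e).1.rank = e.1.rank := by
  set v := lastVec K n with hv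
  refine le_antisymm ?_ ?_
  · let E : Matrix (Fin (n + 1)) (Fin n) K :=
      (1 : Matrix (Fin (n + 1)) (Fin (n + 1)) K).submatrix id Fin.castSucc
    have h1 : (block e).1 = Eᵀ * e.1 * E := by
      ext i j
      simp [E, Matrix.mul_apply, Matrix.one_apply, block_apply]
    rw [h1]
    exact (Matrix.rank_mul_le_left _ _).trans (Matrix.rank_mul_le_right _ _)
  · -- a kernel vector `z` with `⟨v, z⟩ = 1` makes `e` the pullback of its compression
    obtain ⟨z, hz, hvz⟩ : ∃ z, e.1 *ᵥ z = 0 ∧ v ⬝ᵥ z ≠ 0 := by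
      by_contra! hcon
      obtain ⟨p, hp⟩ := exists_mulVec_eq_of_orthogonal_ker e v hcon
      refine hu ?_
      rw [← hp, Matrix.mulVec_mulVec, ← pow_two, he, Matrix.zero_mulVec]
    let Q : Matrix (Fin (n + 1)) (Fin (n + 1)) K := 1 - (v ⬝ᵥ z)⁻¹ • vecMulVec v z
    have hzT : z ᵥ* e.1 = 0 := by
      rw [← Matrix.mulVec_transpose, soLie_transpose, Matrix.neg_mulVec, hz, neg_zero]
    have h1 : Q * e.1 = e.1 := by
      simp [Q, Matrix.sub_mul, vecMulVec_mul, hzT]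
    have h2 : e.1 * Qᵀ = e.1 := by
      simp [Q, Matrix.transpose_sub, transpose_vecMulVec, Matrix.mul_sub, mul_vecMulVec, hz]
    have h3 : Q *ᵥ v = 0 := by
      rw [Matrix.sub_mulVec, Matrix.smul_mulVec, vecMulVec_mulVec, Matrix.one_mulVec,
        dotProduct_comm z v]
      ext i
      simp
      field_simp
      simp
    have h4 : Q * extend (block e).1 0 * Qᵀ = e.1 := by
      have h5 : extend (block e).1 0 = e.1 - wedge v (e.1 *ᵥ v) :=
        eq_sub_of_add_eq (coe_eq_extend_add_wedge e).symm
      rw [h5, Matrix.mul_sub, Matrix.sub_mul, mul_wedge_mul, h1, h2, h3]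
      simp [wedge]
    calc e.1.rank = (Q * extend (block e).1 0 * Qᵀ).rank := by rw [h4]
      _ ≤ (extend (block e).1 0).rank :=
        (Matrix.rank_mul_le_left _ _).trans (Matrix.rank_mul_le_right _ _)
      _ = _ := rank_extend_zero _

/-- If `u` is the image of the last basis vector, then the square of the compression is `u uᵀ`,
which gives one block of size three; the rank does not change. -/
theorem block_mem_nilOrbit [CharZero K] {k m : ℕ} (hk : 2 ≤ k) (hN : n + 1 = 4 * k + m)
    {e : soLie K (n + 1)}
    (he : e ∈ nilOrbit K (n + 1) (List.replicate (2 * k) 2 ++ List.replicate m 1))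
    (hu : e.1 *ᵥ lastVec K n ≠ 0) :
    block e ∈ nilOrbit K n (3 :: (List.replicate (2 * k - 2) 2 ++ List.replicate m 1)) := by
  obtain ⟨h2, hr, -⟩ := HasJordanType.two_one he
  obtain ⟨u, hu'⟩ := exists_extVec e
  obtain ⟨h3, h4, h5⟩ := (sq_eq_zero_iff hu').1 h2
  have hu0 : u ≠ 0 := by
    rintro rfl
    refine hu (hu'.trans ?_)
    ext i
    induction i using Fin.lastCases <;> simp
  refine hasJordanType_three_two_one ?_ ?_ ?_ ?_
  · rw [pow_succ', h3, mul_vecMulVec, h4, zero_vecMulVec]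
  · rw [h3]
    refine le_antisymm (Matrix.rank_vecMulVec_le _ _) ?_
    by_contra hlt
    have h6 := eq_zero_of_rank_eq_zero (x := vecMulVec u u) (by omega)
    exact vecMulVec_ne_zero hu0 hu0 h6
  · rw [rank_block h2 hu, hr]; omega
  · omega

/-- A matrix of type `(3, 2^{2k-2}, 1^m)` in `so_n` is the compression of a matrix of type
`(2^{2k}, 1^m)` in `so_{n+1}`. -/
theorem exists_block_eq [IsAlgClosed K] [CharZero K] {k m : ℕ} (hk : 2 ≤ k)
    (hN : n + 1 = 4 * k + m) {x : soLie K n}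
    (hx : x ∈ nilOrbit K n (3 :: (List.replicate (2 * k - 2) 2 ++ List.replicate m 1))) :
    ∃ e ∈ nilOrbit K (n + 1) (List.replicate (2 * k) 2 ++ List.replicate m 1),
      e.1 *ᵥ lastVec K n ≠ 0 ∧ block e = x := by
  obtain ⟨h3, hr2, hr, -⟩ := HasJordanType.three_two_one hx
  obtain ⟨u, hu0, hu⟩ := exists_eq_vecMulVec_self (sq_transpose x) hr2
  have hxu : x.1 *ᵥ u = 0 := by
    have h4 : vecMulVec (x.1 *ᵥ u) u = 0 := by rw [← mul_vecMulVec, ← hu, ← pow_succ', h3]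
    exact (vecMulVec_eq_zero.1 h4).resolve_right hu0
  have huu : u ⬝ᵥ u = 0 := by
    have h4 : vecMulVec u u *ᵥ u = 0 := by
      rw [← hu, pow_two, ← Matrix.mulVec_mulVec, hxu, Matrix.mulVec_zero]
    rw [vecMulVec_mulVec] at h4
    obtain ⟨i, hi⟩ := Function.ne_iff.1 hu0
    have := congrFun h4 i
    simpa [show u i ≠ 0 from hi] using this
  let e : soLie K (n + 1) := stdLieHom K n x + wedgeSo (lastVec K n) (extVec u)
  have hev : e.1 *ᵥ lastVec K n = extVec u := by
    change (extend x.1 0 + wedge (lastVec K n) (extVec u)) *ᵥ lastVec K n = _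
    rw [Matrix.add_mulVec, extend_mulVec_lastVec, wedge_mulVec, lastVec_dotProduct_self,
      dotProduct_comm, lastVec_dotProduct_extVec]
    simp
  have hb : block e = x := by
    refine Subtype.ext ?_
    ext i j
    change extend x.1 0 i.castSucc j.castSucc + wedge (lastVec K n) (extVec u) i.castSucc
        j.castSucc = _
    rw [extend_castSucc_castSucc, wedge_apply, lastVec_castSucc, lastVec_castSucc]
    ring
  have he2 : e.1 ^ 2 = 0 := (sq_eq_zero_iff hev).2 ⟨by rw [hb, hu], by rw [hb, hxu], huu⟩
  have hev0 : e.1 *ᵥ lastVec K n ≠ 0 := by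
    rw [hev]
    intro h
    refine hu0 (extVec_injective (h.trans ?_))
    ext i
    induction i using Fin.lastCases <;> simp
  refine ⟨e, hasJordanType_two_one he2 ?_ (by omega), hev0, hb⟩
  rw [← rank_block he2 hev0, hb, hr]
  omega

theorem extend_orthogonal {o : Matrix (Fin n) (Fin n) K} (ho : oᵀ * o = 1) :
    (extend o 1)ᵀ * extend o 1 = 1 := by
  rw [extend_transpose, extend_mul, ho, mul_one, extend_one]

/-- A conjugacy between compressions that matches the images of the last basis vector extends to a
conjugacy under `O_n`. -/
theorem mul_extend_eq [CharZero K] {e e' : soLie K (n + 1)} {u u' : Fin n → K}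
    (hu : e.1 *ᵥ lastVec K n = extVec u) (hu' : e'.1 *ᵥ lastVec K n = extVec u')
    {o : Matrix (Fin n) (Fin n) K} (ho : oᵀ * o = 1) (hc : (block e).1 * o = o * (block e').1)
    (hou : o *ᵥ u' = u) : e.1 * extend o 1 = extend o 1 * e'.1 := by
  have h1 : extend o 1 * e'.1 * (extend o 1)ᵀ = e.1 := by
    have hoo : o * oᵀ = 1 := mul_eq_one_comm.1 ho
    rw [coe_eq_extend_add_wedge e', Matrix.mul_add, Matrix.add_mul, mul_wedge_mul, extend_transpose,
      extend_mul, extend_mul, ← hc, Matrix.mul_assoc, hoo, hu', extend_mulVec_extVec, hou,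
      extend_mulVec_lastVec, one_smul]
    conv_rhs => rw [coe_eq_extend_add_wedge e, hu]
    simp
  rw [← h1, Matrix.mul_assoc, extend_orthogonal ho, Matrix.mul_one]

/-- Two elements of an `SO_{n+1}`-orbit of type `(2^{2k}, 1^m)` not killing the last basis vector
are conjugate under `SO_n`. Their compressions are `O_n`-conjugate, and the conjugating matrix can
be corrected to have determinant one: for `m > 0` by a reflection in a kernel vector of the
compression, for `m = 0` because the centralizer in `O_{n+1}` lies in `SO_{n+1}`. -/
theorem exists_stdSO_conj [IsAlgClosed K] [CharZero K] {k m : ℕ} (hk : 2 ≤ k)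
    (hN : n + 1 = 4 * k + m) {e e' : soLie K (n + 1)}
    (he : e ∈ nilOrbit K (n + 1) (List.replicate (2 * k) 2 ++ List.replicate m 1))
    (hee' : ∃ g : SO K (n + 1), e' = Ad g e)
    (hu : e.1 *ᵥ lastVec K n ≠ 0) (hu' : e'.1 *ᵥ lastVec K n ≠ 0) :
    ∃ g ∈ stdSO K n, e = Ad g e' := by
  have he' : e' ∈ nilOrbit K (n + 1) (List.replicate (2 * k) 2 ++ List.replicate m 1) := by
    obtain ⟨g, rfl⟩ := hee'
    exact Ad_mem_nilOrbit g he
  obtain ⟨h2, hr, -⟩ := HasJordanType.two_one he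
  obtain ⟨h2', -, -⟩ := HasJordanType.two_one he'
  obtain ⟨u, hev⟩ := exists_extVec e
  obtain ⟨u', hev'⟩ := exists_extVec e'
  have hb := block_mem_nilOrbit hk hN he hu
  have hb' := block_mem_nilOrbit hk hN he' hu'
  obtain ⟨hx2, hxu, -⟩ := (sq_eq_zero_iff hev).1 h2
  obtain ⟨hx2', -, -⟩ := (sq_eq_zero_iff hev').1 h2'
  suffices hs : ∃ o : Matrix (Fin n) (Fin n) K, oᵀ * o = 1 ∧ o.det = 1 ∧
      (block e).1 * o = o * (block e').1 ∧ o *ᵥ u' = u by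
    obtain ⟨o, ho, hd, hc, hou⟩ := hs
    exact ⟨stdGroupHom K n (mkSO o ho hd), ⟨_, rfl⟩,
      ((Ad_eq_iff _ _ _).2 (mul_extend_eq hev hev' ho hc hou)).symm⟩
  obtain ⟨o, ho, hc, hou⟩ : ∃ o : Matrix (Fin n) (Fin n) K, oᵀ * o = 1 ∧
      (block e).1 * o = o * (block e').1 ∧ o *ᵥ u' = u := by
    obtain ⟨o, ho, hc⟩ := nilOrbit_exists_orthogonal hb hb'
    have h3 : vecMulVec (o *ᵥ u') (o *ᵥ u') = vecMulVec u u := by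
      rw [← hx2]
      have h4 : vecMulVec (o *ᵥ u') (o *ᵥ u') = o * vecMulVec u' u' * oᵀ := by
        rw [mul_vecMulVec, vecMulVec_mul, Matrix.vecMul_transpose]
      rw [h4, ← hx2', pow_two, ← Matrix.mul_assoc, ← hc, Matrix.mul_assoc (block e).1, ← hc,
        ← Matrix.mul_assoc, Matrix.mul_assoc, mul_eq_one_comm.1 ho, Matrix.mul_one, pow_two]
    rcases eq_neg_of_vecMulVec_self_eq h3 with h | h
    · exact ⟨o, ho, hc, h⟩
    · refine ⟨-o, by simpa using ho, by rw [Matrix.mul_neg, Matrix.neg_mul, hc], ?_⟩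
      rw [Matrix.neg_mulVec, h, neg_neg]
  rcases det_eq_of_orthogonal ho with hd | hd
  · exact ⟨o, ho, hd, hc, hou⟩
  rcases Nat.eq_zero_or_pos m with hm | hm
  · exfalso
    obtain ⟨g, hg⟩ := hee'
    have h3 := mul_extend_eq hev hev' ho hc hou
    have h4 := (Ad_eq_iff g e e').1 hg.symm
    have h5 := det_eq_one_of_commute (c := extend o 1 * g.1) h2 hr (by omega)
      (orthogonal_mul (extend_orthogonal ho) (SO_transpose_mul g)) (by
      rw [← Matrix.mul_assoc, h3, Matrix.mul_assoc, h4, Matrix.mul_assoc])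
    rw [Matrix.det_mul, extend_det, hd, SO_det] at h5
    norm_num at h5
  · obtain ⟨-, hr2, hr1, hn⟩ := HasJordanType.three_two_one hb
    obtain ⟨w, hw, hww⟩ := exists_nonisotropic_ker (block e) (by
      intro hle
      have h3 := rank_sq_add_finrank_range_inf_ker (block e).1
      have h4 := rank_add_finrank_ker (block e).1
      rw [inf_eq_right.2 hle, hr2, hr1] at h3
      rw [hr1] at h4
      omega)
    have hwu : w ⬝ᵥ u = 0 := by
      have h3 : vecMulVec u u *ᵥ w = 0 := by
        rw [← hx2, pow_two, ← Matrix.mulVec_mulVec, hw, Matrix.mulVec_zero]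
      rw [vecMulVec_mulVec] at h3
      have hu0 : u ≠ 0 := by
        rintro rfl
        refine hu (hev.trans ?_)
        ext i
        induction i using Fin.lastCases <;> simp
      obtain ⟨i, hi⟩ := Function.ne_iff.1 hu0
      have := congrFun h3 i
      rw [dotProduct_comm]
      simpa [show u i ≠ 0 from hi] using this
    refine ⟨refl w * o, orthogonal_mul (refl_orthogonal hww) ho,
      by rw [Matrix.det_mul, det_refl hww, hd]; norm_num, ?_, ?_⟩
    · rw [← Matrix.mul_assoc, refl_commute (soLie_transpose _) hw, Matrix.mul_assoc, hc,
        Matrix.mul_assoc]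
    · rw [← Matrix.mulVec_mulVec, hou, refl_mulVec_of_orthogonal hwu]

/-- A nonzero skew-symmetric matrix killing the last basis vector moves some isotropic vector
orthogonal to it. -/
theorem exists_isotropic_not_ker [IsAlgClosed K] [CharZero K] {e : soLie K (n + 1)} (he : e.1 ≠ 0)
    (hv : e.1 *ᵥ lastVec K n = 0) (hn : 2 ≤ n) :
    ∃ a, a ⬝ᵥ a = 0 ∧ a ⬝ᵥ lastVec K n = 0 ∧ e.1 *ᵥ a ≠ 0 := by
  obtain ⟨I, hI⟩ := IsAlgClosed.exists_pow_nat_eq (-1 : K) (n := 2) (by norm_num)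
  obtain ⟨i, hi⟩ : ∃ i : Fin n, e.1 *ᵥ Pi.single i.castSucc 1 ≠ 0 := by
    by_contra! hcon
    refine he ?_
    ext k j
    induction j using Fin.lastCases with
    | last => rw [← mulVec_lastVec e.1, hv]; rfl
    | cast j =>
      have := congrFun (hcon j) k
      simpa using this
  obtain ⟨j, hj⟩ : ∃ j : Fin n, j ≠ i := by
    have : Nontrivial (Fin n) := Fin.nontrivial_iff_two_le.2 hn
    exact exists_ne i
  have hj' : j.castSucc ≠ i.castSucc := fun h => hj (Fin.castSucc_injective n h)
  by_contra! hcon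
  have key : ∀ s : K, s ^ 2 = -1 →
      e.1 *ᵥ (Pi.single i.castSucc 1 + s • Pi.single j.castSucc 1) = 0 := by
    intro s hs
    refine hcon _ ?_ ?_
    · simp [dotProduct_add, hj', hj'.symm, ← pow_two, hs]
    · simp [lastVec, (Fin.castSucc_ne_last _).symm]
  have h1 := key I hI
  have h2 := key (-I) (by rw [neg_sq, hI])
  rw [Matrix.mulVec_add, Matrix.mulVec_smul] at h1 h2
  have h3 : (2 : K) • (e.1 *ᵥ Pi.single i.castSucc 1) = 0 := by
    rw [neg_smul] at h2
    rw [two_smul]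
    have := congrArg₂ (· + ·) h1 h2
    simp only [add_zero] at this
    rw [← this]
    abel
  exact hi ((smul_eq_zero.1 h3).resolve_left two_ne_zero)

theorem wedge_cube {N : ℕ} {a b : Fin N → K} (ha : a ⬝ᵥ a = 0) (hab : a ⬝ᵥ b = 0) :
    wedge a b ^ 3 = 0 := by
  have hba : b ⬝ᵥ a = 0 := by rw [dotProduct_comm, hab]
  rw [pow_succ, pow_two]
  refine Matrix.toLin'.injective (LinearMap.ext fun w => ?_)
  simp only [Matrix.toLin'_mul, LinearMap.comp_apply, Matrix.toLin'_apply, wedge_mulVec,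
    dotProduct_sub, dotProduct_smul, ha, hab, hba]
  simp

/-- The curve through `e₀` obtained by conjugating with `exp t (a ∧ v)` leaves the locus `e v = 0`
at once. -/
theorem exists_curve_of_kills_lastVec [IsAlgClosed K] [CharZero K] {O : Set (soLie K (n + 1))}
    (hO : ∀ (g : SO K (n + 1)), ∀ e ∈ O, Ad g e ∈ O) (h0 : ∀ e ∈ O, e.1 ≠ 0) (hn : 2 ≤ n)
    {e : soLie K (n + 1)} (he : e ∈ O) (hv : e.1 *ᵥ lastVec K n = 0) :
    ∃ γ : K → soLie K (n + 1), IsPolyCurve (fun t => (γ t).1) ∧ γ 0 = e ∧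
      ∀ t ≠ 0, γ t ∈ O ∧ (γ t).1 *ᵥ lastVec K n ≠ 0 := by
  obtain ⟨a, haa, hav, hea⟩ := exists_isotropic_not_ker (h0 e he) hv hn
  have hy : (wedgeSo a (lastVec K n)).1 ^ 3 = 0 := wedge_cube haa hav
  refine ⟨fun t => Ad (expSO (t • wedgeSo a (lastVec K n)) (smul_cube_eq_zero hy t)) e,
    isPolyCurve_Ad_exp hy e, ?_, fun t ht => ⟨hO _ _ he, fun h => hea ?_⟩⟩
  · refine Subtype.ext ?_
    change expMat ((0 : K) • wedge a (lastVec K n)) * e.1 *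
        (expMat ((0 : K) • wedge a (lastVec K n)))ᵀ = e.1
    simp [expMat]
  · set g := expSO (t • wedgeSo a (lastVec K n)) (smul_cube_eq_zero hy t) with hg
    have h1 : g.1ᵀ *ᵥ lastVec K n = lastVec K n + t • a := by
      have h2 : g.1ᵀ = 1 - t • wedge a (lastVec K n) +
          (2 : K)⁻¹ • (t • wedge a (lastVec K n)) ^ 2 := by
        change (1 + t • wedge a (lastVec K n) + (2 : K)⁻¹ • (t • wedge a (lastVec K n)) ^ 2)ᵀ = _
        simp [Matrix.transpose_smul, wedge_transpose, sub_eq_add_neg]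
      rw [h2, Matrix.add_mulVec, Matrix.sub_mulVec, Matrix.smul_mulVec, Matrix.smul_mulVec, pow_two,
        ← Matrix.mulVec_mulVec]
      simp only [Matrix.smul_mulVec, wedge_mulVec, hav, lastVec_dotProduct_self,
        Matrix.mulVec_smul, dotProduct_sub, dotProduct_smul, haa, dotProduct_comm (lastVec K n) a]
      simp
    rw [Ad_coe, ← Matrix.mulVec_mulVec, ← Matrix.mulVec_mulVec, h1, Matrix.mulVec_add, hv, zero_add,
      Matrix.mulVec_smul, Matrix.mulVec_smul] at h
    have h3 := (smul_eq_zero.1 h).resolve_left ht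
    have h4 : g.1ᵀ *ᵥ (g.1 *ᵥ (e.1 *ᵥ a)) = 0 := by rw [h3, Matrix.mulVec_zero]
    rwa [Matrix.mulVec_mulVec, SO_transpose_mul, Matrix.one_mulVec] at h4

end ProjectionOfSquareZero

/-! ### Dense orbits and their closures -/

section DenseOrbits

variable {K : Type*} [Field K] {N : ℕ}

/-- A dense orbit that is the complement of a closed condition `P` is the only dense orbit. -/
theorem IsDenseOrbit.unique {H : Subgroup (SO K N)} {Ω Ω' O : Set (soLie K N)}
    {P : soLie K N → Prop} (hΩ : IsDenseOrbit H Ω O) (hΩP : ∀ e ∈ O, e ∈ Ω ↔ ¬ P e)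
    (hP : zariskiClosure K {e | P e} ⊆ {e | P e}) (hΩ' : IsDenseOrbit H Ω' O) : Ω' = Ω := by
  obtain ⟨h1, h2, -⟩ := hΩ
  obtain ⟨h1', h2', h3'⟩ := hΩ'
  by_cases h : ∃ e ∈ Ω', ¬ P e
  · obtain ⟨e, he, hPe⟩ := h
    rw [h1'.eq_adOrbit he, h1.eq_adOrbit ((hΩP e (h2' he)).2 hPe)]
  · push Not at h
    exfalso
    obtain ⟨x, rfl⟩ := h1
    have hx := mem_adOrbit_self H x
    exact (hΩP x (h2 hx)).1 hx (hP (zariskiClosure_mono h (h3' (h2 hx))))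

theorem sq_entry_mem (i j : Fin N) :
    (fun x : soLie K N => (x.1 ^ 2) i j) ∈ polyFun K (soLie K N) := by
  have h : (fun x : soLie K N => (x.1 ^ 2) i j) = ∑ k, entryFun K i k * entryFun K k j := by
    funext x
    rw [pow_two, Matrix.mul_apply, Finset.sum_apply]
    rfl
  rw [h]
  exact Subalgebra.sum_mem _ fun k _ => Subalgebra.mul_mem _ (entryFun_mem i k) (entryFun_mem k j)

theorem sq_eq_zero_of_mem_zariskiClosure {S : Set (soLie K N)} (hS : ∀ x ∈ S, x.1 ^ 2 = 0)
    {y : soLie K N} (hy : y ∈ zariskiClosure K S) : y.1 ^ 2 = 0 := by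
  ext i j
  exact hy _ (sq_entry_mem i j) fun x hx => by rw [hS x hx]; rfl

/-- The closure of a cone contains `0`. -/
theorem zero_mem_zariskiClosure [Infinite K] {S : Set (soLie K N)} {e : soLie K N}
    (h : ∀ t : K, t ≠ 0 → t • e ∈ S) : (0 : soLie K N) ∈ zariskiClosure K S := by
  have h1 := mem_zariskiClosure_of_curve (S := S) (γ := fun t => t • e) (F := Polynomial.X)
    (by
      have := (IsPolyCurve.const e.1).smul (Polynomial.X : Polynomial K)
      simpa using this) Polynomial.X_ne_zero (fun t ht => h t (by simpa using ht)) 0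
  simpa using h1

theorem smul_mem_nilOrbit_two_one {r s : ℕ} {e : soLie K N} {d : K} (hd : d ≠ 0)
    (he : e ∈ nilOrbit K N (List.replicate r 2 ++ List.replicate s 1)) :
    d • e ∈ nilOrbit K N (List.replicate r 2 ++ List.replicate s 1) := by
  obtain ⟨h2, hr, hN⟩ := HasJordanType.two_one he
  refine hasJordanType_two_one (x := d • e.1) ?_ ?_ hN
  · rw [smul_pow, h2, smul_zero]
  · rw [Matrix.rank_smul_of_mem_nonZeroDivisors _ (mem_nonZeroDivisors_of_ne_zero hd), hr]

/-- An `SO_N`-orbit of type `(2^r, 1^s)` is stable under nonzero scalars `d²`: if `o` conjugates `e`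
to `d e`, then `o²`, of determinant one, conjugates `e` to `d² e`. -/
theorem smul_mem_orbit_two_one [IsAlgClosed K] [CharZero K] {r s : ℕ} {O : Set (soLie K N)}
    (hO : IsOrbit ⊤ O) (hs : O ⊆ nilOrbit K N (List.replicate r 2 ++ List.replicate s 1))
    {e : soLie K N} (he : e ∈ O) {c : K} (hc : c ≠ 0) : c • e ∈ O := by
  obtain ⟨d, rfl⟩ := IsAlgClosed.exists_pow_nat_eq c (n := 2) (by norm_num)
  have hd : d ≠ 0 := by rintro rfl; simp at hc
  obtain ⟨o, ho, hoe⟩ := nilOrbit_exists_orthogonal (smul_mem_nilOrbit_two_one hd (hs he)) (hs he)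
  have hoe' : d • (e.1 * o) = o * e.1 := by rw [← hoe, ← Matrix.smul_mul]; rfl
  rw [hO.eq_adOrbit he]
  refine ⟨mkSO (o * o) (orthogonal_mul ho ho) ?_, trivial, ((Ad_eq_iff _ _ _).2 ?_).symm⟩
  · rw [Matrix.det_mul]
    rcases det_eq_of_orthogonal ho with h | h <;> rw [h] <;> norm_num
  · change (d ^ 2 • e.1) * (o * o) = o * o * e.1
    calc (d ^ 2 • e.1) * (o * o) = d • ((d • (e.1 * o)) * o) := by
          rw [pow_two, mul_smul, Matrix.smul_mul, Matrix.smul_mul, ← Matrix.mul_assoc,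
              Matrix.smul_mul]
      _ = o * (d • (e.1 * o)) := by rw [hoe', Matrix.mul_assoc, ← Matrix.mul_smul, hoe']
      _ = _ := by rw [hoe', Matrix.mul_assoc]

theorem IsOrbit.Ad_mem {O : Set (soLie K N)} (hO : IsOrbit ⊤ O) (g : SO K N)
    {e : soLie K N} (he : e ∈ O) : Ad g e ∈ O := by
  obtain ⟨x, rfl⟩ := hO
  exact Ad_mem_adOrbit (Subgroup.mem_top g) he

theorem zariskiClosure_kills_lastVec {n : ℕ} :
    zariskiClosure K {e : soLie K (n + 1) | e.1 *ᵥ lastVec K n = 0} ⊆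
      {e | e.1 *ᵥ lastVec K n = 0} := by
  intro e he
  ext i
  rw [mulVec_lastVec]
  refine he _ (entryFun_mem i (Fin.last n)) fun y hy => ?_
  have hy' : y.1 *ᵥ lastVec K n = 0 := hy
  change y.1 i (Fin.last n) = 0
  rw [← mulVec_lastVec y.1, hy']
  rfl

/-- The open `SO_n`-orbit in an `SO_{n+1}`-orbit: the elements not killing the last basis vector. -/
def openPart {n : ℕ} (O : Set (soLie K (n + 1))) : Set (soLie K (n + 1)) :=
  {e | e ∈ O ∧ e.1 *ᵥ lastVec K n ≠ 0}

theorem height_two_of_mem_nilOrbit [CharZero K] {N r s : ℕ} (hr : 2 ≤ r) {e : soLie K N}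
    (he : e ∈ nilOrbit K N (List.replicate r 2 ++ List.replicate s 1)) :
    IsGreatest {d : ℕ | (LieAlgebra.ad K (soLie K N) e) ^ d ≠ 0} 2 := by
  obtain ⟨h2, hrank, -⟩ := HasJordanType.two_one he
  obtain ⟨a, b, ha, hb⟩ := exists_two_of_two_le_rank (A := e.1) (by omega)
  exact height_two_of_sq_eq_zero h2 ha hb

end DenseOrbits

/-! ### The orbits of type `(2^{2k}, 1^m)` -/

section OrthogonalCase

variable {K : Type*} [Field K] [IsAlgClosed K] {n : ℕ}

theorem exists_mem_nilOrbit_two_one {N k m : ℕ} (hN : N = 4 * k + m) :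
    ∃ e, e ∈ nilOrbit K N (List.replicate (2 * k) 2 ++ List.replicate m 1) := by
  obtain ⟨e, he, hr⟩ := exists_sq_zero (K := K) hN
  exact ⟨e, hasJordanType_two_one he hr (by omega)⟩

variable [CharZero K]

theorem isOrbit_nilOrbit_two_one {N k m : ℕ} (hN : N = 4 * k + m) (hm : 0 < m) :
    IsOrbit ⊤ (nilOrbit K N (List.replicate (2 * k) 2 ++ List.replicate m 1)) := by
  obtain ⟨e, he⟩ := exists_mem_nilOrbit_two_one (K := K) hN
  obtain ⟨-, hr, -⟩ := HasJordanType.two_one he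
  obtain ⟨w, hw, hww⟩ := exists_nonisotropic_ker e (by
    intro hle
    have h1 := Submodule.finrank_mono hle
    have h2 := rank_add_finrank_ker e.1
    have h3 : Module.finrank K (LinearMap.range e.1.mulVecLin) = 2 * k := hr
    rw [hr] at h2
    omega)
  exact ⟨e, nilOrbit_eq_adOrbit he (refl_orthogonal hww) (det_refl hww)
    (refl_commute (soLie_transpose e) hw)⟩

/-- For `N = 4k` the matrices of type `(2^{2k})` form exactly two `SO_N`-orbits, exchanged by a
reflection. -/
theorem two_orbits_nilOrbit_two {N k : ℕ} (hN : N = 4 * k) (hN0 : 0 < N) :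
    ∃ O₁ O₂ : Set (soLie K N), IsOrbit ⊤ O₁ ∧ IsOrbit ⊤ O₂ ∧ O₁ ≠ O₂ ∧
      O₁ ∪ O₂ = nilOrbit K N (List.replicate (2 * k) 2) := by
  obtain ⟨e, he⟩ := exists_mem_nilOrbit_two_one (K := K) (N := N) (k := k) (m := 0) hN
  obtain ⟨he2, hr, -⟩ := HasJordanType.two_one he
  rw [List.replicate_zero, List.append_nil] at he
  let w : Fin N → K := Pi.single ⟨0, hN0⟩ 1
  have hww : w ⬝ᵥ w ≠ 0 := by simp [w]
  let e' : soLie K N := ⟨refl w * e.1 * (refl w)ᵀ, by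
    rw [mem_so]; simp [Matrix.transpose_mul, soLie_transpose e, Matrix.mul_assoc]⟩
  have hc : e'.1 * refl w = refl w * e.1 := by
    change refl w * e.1 * (refl w)ᵀ * refl w = _
    rw [Matrix.mul_assoc, refl_orthogonal hww, Matrix.mul_one]
  have he' : e' ∈ nilOrbit K N (List.replicate (2 * k) 2) :=
    hasJordanType_of_orthogonal (refl_orthogonal hww) hc he
  refine ⟨adOrbit ⊤ e, adOrbit ⊤ e', ⟨_, rfl⟩, ⟨_, rfl⟩, fun heq => ?_, ?_⟩
  · have h1 : e' ∈ adOrbit ⊤ e := heq ▸ mem_adOrbit_self ⊤ e'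
    obtain ⟨g, -, hg⟩ := h1
    have h2 := (Ad_eq_iff g e e').1 hg.symm
    have h3 := det_eq_one_of_commute (c := refl w * g.1) he2 hr (by omega)
      (orthogonal_mul (refl_orthogonal hww) (SO_transpose_mul g)) (by
      have h4 : e.1 * refl w = refl w * e'.1 := by
        change _ = refl w * (refl w * e.1 * (refl w)ᵀ)
        rw [refl_transpose, ← Matrix.mul_assoc, ← Matrix.mul_assoc, refl_mul_self hww,
            Matrix.one_mul]
      rw [← Matrix.mul_assoc, h4, Matrix.mul_assoc, h2, Matrix.mul_assoc])
    rw [Matrix.det_mul, det_refl hww, SO_det] at h3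
    norm_num at h3
  · ext y
    constructor
    · rintro (⟨g, -, rfl⟩ | ⟨g, -, rfl⟩)
      · exact Ad_mem_nilOrbit g he
      · exact Ad_mem_nilOrbit g he'
    · intro hy
      obtain ⟨o, ho, hyo⟩ := nilOrbit_exists_orthogonal (x := y) (y := e) hy he
      rcases det_eq_of_orthogonal ho with hd | hd
      · exact Or.inl ⟨mkSO o ho hd, trivial, ((Ad_eq_iff _ _ _).2 hyo).symm⟩
      · refine Or.inr ⟨mkSO (o * refl w) (orthogonal_mul ho (refl_orthogonal hww)) ?_, trivial,
          ((Ad_eq_iff _ _ _).2 ?_).symm⟩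
        · rw [Matrix.det_mul, hd, det_refl hww]; norm_num
        · change y.1 * (o * refl w) = o * refl w * (refl w * e.1 * (refl w)ᵀ)
          rw [← Matrix.mul_assoc, hyo, refl_transpose]
          calc o * e.1 * refl w = o * (refl w * refl w) * e.1 * refl w := by
                rw [refl_mul_self hww, Matrix.mul_one]
            _ = _ := by simp only [Matrix.mul_assoc]

section

variable {k m : ℕ} {O : Set (soLie K (n + 1))}

theorem exists_curve_openPart (hk : 2 ≤ k) (hN : n + 1 = 4 * k + m) (hO : IsOrbit ⊤ O)
    (hs : O ⊆ nilOrbit K (n + 1) (List.replicate (2 * k) 2 ++ List.replicate m 1))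
    {e : soLie K (n + 1)} (he : e ∈ O) (hv : e.1 *ᵥ lastVec K n = 0) :
    ∃ γ : K → soLie K (n + 1), IsPolyCurve (fun t => (γ t).1) ∧ γ 0 = e ∧
      ∀ t ≠ 0, γ t ∈ openPart O := by
  refine exists_curve_of_kills_lastVec (fun g e he => hO.Ad_mem g he) (fun e he h => ?_)
    (by omega) he hv
  obtain ⟨-, hr, -⟩ := HasJordanType.two_one (hs he)
  rw [h, Matrix.rank_zero] at hr
  omega

theorem openPart_nonempty (hk : 2 ≤ k) (hN : n + 1 = 4 * k + m) (hO : IsOrbit ⊤ O)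
    (hs : O ⊆ nilOrbit K (n + 1) (List.replicate (2 * k) 2 ++ List.replicate m 1)) :
    (openPart O).Nonempty := by
  obtain ⟨e, rfl⟩ := id hO
  have he := mem_adOrbit_self ⊤ e
  by_cases hv : e.1 *ᵥ lastVec K n = 0
  · obtain ⟨γ, -, -, h⟩ := exists_curve_openPart hk hN hO hs he hv
    exact ⟨γ 1, h 1 one_ne_zero⟩
  · exact ⟨e, he, hv⟩

/-- The elements of `O` not killing the last basis vector form one `SO_n`-orbit, which is dense
because every other element lies on a curve leaving the locus `e v = 0`. -/
theorem isDenseOrbit_openPart (hk : 2 ≤ k) (hN : n + 1 = 4 * k + m) (hO : IsOrbit ⊤ O)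
    (hs : O ⊆ nilOrbit K (n + 1) (List.replicate (2 * k) 2 ++ List.replicate m 1)) :
    IsDenseOrbit (stdSO K n) (openPart O) O := by
  refine ⟨?_, fun e he => he.1, fun e he => ?_⟩
  · obtain ⟨e, he, hv⟩ := openPart_nonempty hk hN hO hs
    refine ⟨e, Set.ext fun y => ⟨fun hy => ?_, ?_⟩⟩
    · obtain ⟨hyO, hyv⟩ := hy
      refine exists_stdSO_conj hk hN (hs hyO) ?_ hyv hv
      rw [hO.eq_adOrbit hyO] at he
      obtain ⟨g, -, hg⟩ := he
      exact ⟨g, hg⟩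
    · rintro ⟨_, ⟨g, rfl⟩, rfl⟩
      refine ⟨hO.Ad_mem _ he, fun h => hv ?_⟩
      have h1 : (stdGroupHom K n g).1ᵀ *ᵥ lastVec K n = lastVec K n := by
        change (extend g.1 1)ᵀ *ᵥ _ = _
        rw [extend_transpose, extend_mulVec_lastVec, one_smul]
      rw [Ad_coe, ← Matrix.mulVec_mulVec, h1, ← Matrix.mulVec_mulVec] at h
      have h2 := congrArg (fun v => (stdGroupHom K n g).1ᵀ *ᵥ v) h
      simpa [Matrix.mulVec_mulVec, ← Matrix.mul_assoc, SO_transpose_mul] using h2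
  · by_cases hv : e.1 *ᵥ lastVec K n = 0
    · obtain ⟨γ, h1, h2, h3⟩ := exists_curve_openPart hk hN hO hs he hv
      have := mem_zariskiClosure_of_curve h1 Polynomial.X_ne_zero
        (fun t ht => h3 t (by simpa using ht)) 0
      rwa [h2] at this
    · exact subset_zariskiClosure _ ⟨he, hv⟩

theorem eq_openPart_of_isDenseOrbit (hk : 2 ≤ k) (hN : n + 1 = 4 * k + m) (hO : IsOrbit ⊤ O)
    (hs : O ⊆ nilOrbit K (n + 1) (List.replicate (2 * k) 2 ++ List.replicate m 1))
    {Ω : Set (soLie K (n + 1))} (hΩ : IsDenseOrbit (stdSO K n) Ω O) : Ω = openPart O :=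
  (isDenseOrbit_openPart hk hN hO hs).unique
    (fun _ he => ⟨fun h => h.2, fun h => ⟨he, h⟩⟩) zariskiClosure_kills_lastVec hΩ

/-- An element of the complement is `v ∧ u` with `v` the last basis vector and `u` orthogonal to it.
Elements of the closure have square zero, so that the compression `0` satisfies `u uᵀ = 0`. -/
theorem isGood_stdso (hk : 2 ≤ k) (hN : n + 1 = 4 * k + m) (hO : IsOrbit ⊤ O)
    (hs : O ⊆ nilOrbit K (n + 1) (List.replicate (2 * k) 2 ++ List.replicate m 1)) :
    IsGood (stdso K n) O := by
  refine Set.Subset.antisymm ?_ ?_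
  · rintro y ⟨hy, hym⟩
    have h2 := sq_eq_zero_of_mem_zariskiClosure (fun x hx => (HasJordanType.two_one (hs hx)).1) hy
    have hb : block y = 0 := (mem_isotropy_stdso_iff (by omega) y).1 hym
    obtain ⟨u, hu⟩ := exists_extVec y
    obtain ⟨h3, -, -⟩ := (sq_eq_zero_iff hu).1 h2
    have hu0 : u = 0 := by
      rw [hb] at h3
      have h4 : vecMulVec u u = 0 := by rw [← h3]; simp
      simpa using vecMulVec_eq_zero.1 h4
    have h5 := eq_block_add_wedge y
    have h6 : extVec (0 : Fin n → K) = 0 := by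
      ext i; induction i using Fin.lastCases <;> simp
    rw [hb, hu, hu0, h6, map_zero, zero_add] at h5
    rw [Set.mem_singleton_iff, h5]
    exact Subtype.ext (by simp [wedge])
  · rintro _ rfl
    obtain ⟨e, rfl⟩ := id hO
    exact ⟨zero_mem_zariskiClosure fun t ht =>
      smul_mem_orbit_two_one hO hs (mem_adOrbit_self ⊤ e) ht, Submodule.zero_mem _⟩

/-- Compression maps the dense orbit onto all matrices of type `(3, 2^{2k-2}, 1^m)`. For `m = 0`
both `SO_{n+1}`-orbits have this image, since the reflection in the last hyperplane exchanges them.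
-/
theorem image_block_openPart (hk : 2 ≤ k) (hN : n + 1 = 4 * k + m) (hO : IsOrbit ⊤ O)
    (hs : O ⊆ nilOrbit K (n + 1) (List.replicate (2 * k) 2 ++ List.replicate m 1)) :
    block '' openPart O =
      nilOrbit K n (3 :: (List.replicate (2 * k - 2) 2 ++ List.replicate m 1)) := by
  refine Set.Subset.antisymm ?_ fun x hx => ?_
  · rintro _ ⟨e, ⟨he, hv⟩, rfl⟩
    exact block_mem_nilOrbit hk hN (hs he) hv
  · obtain ⟨e, he, hv, hb⟩ := exists_block_eq hk hN hx
    obtain ⟨e₀, rfl⟩ := id hO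
    have he₀ := hs (mem_adOrbit_self ⊤ e₀)
    obtain ⟨o, ho, heo⟩ := nilOrbit_exists_orthogonal (x := e) (y := e₀) he he₀
    rcases det_eq_of_orthogonal ho with hd | hd
    · exact ⟨e, ⟨⟨mkSO o ho hd, trivial, ((Ad_eq_iff _ _ _).2 heo).symm⟩, hv⟩, hb⟩
    · -- the mirror image of `e` in the last hyperplane has the same compression
      have hww : lastVec K n ⬝ᵥ lastVec K n ≠ 0 := by
        rw [lastVec_dotProduct_self]; exact one_ne_zero
      set r := refl (lastVec K n) with hr
      have hrc : ∀ i : Fin n, ∀ j, r i.castSucc j = (1 : Matrix _ _ K) i.castSucc j := fun i j => by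
        rw [hr, refl, Matrix.sub_apply, Matrix.smul_apply, vecMulVec_apply, lastVec_castSucc]
        simp
      let e' : soLie K (n + 1) := ⟨r * e.1 * rᵀ, by
        rw [mem_so]; simp [Matrix.transpose_mul, soLie_transpose e, Matrix.mul_assoc]⟩
      have hb' : block e' = x := by
        rw [← hb]
        refine Subtype.ext ?_
        ext i j
        change (r * e.1 * rᵀ) i.castSucc j.castSucc = e.1 i.castSucc j.castSucc
        simp [Matrix.mul_apply, hrc, Matrix.one_apply]
      refine ⟨e', ⟨⟨mkSO (r * o) (orthogonal_mul (refl_orthogonal hww) ho) ?_, trivial,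
        ((Ad_eq_iff _ _ _).2 ?_).symm⟩, fun h => hv ?_⟩, hb'⟩
      · rw [Matrix.det_mul, hd, hr, det_refl hww]; norm_num
      · change r * e.1 * rᵀ * (r * o) = r * o * e₀.1
        rw [Matrix.mul_assoc, ← Matrix.mul_assoc rᵀ, hr, refl_orthogonal hww, Matrix.one_mul,
          Matrix.mul_assoc, heo, Matrix.mul_assoc]
      · have h1 : (r * e.1 * rᵀ) *ᵥ lastVec K n = 0 := h
        have h2 := congrArg (fun v => r *ᵥ v) h1
        simp only [Matrix.mulVec_mulVec, ← Matrix.mul_assoc, hr, refl_mul_self hww, Matrix.one_mul,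
          refl_transpose, Matrix.mulVec_zero] at h2
        rw [← Matrix.mulVec_mulVec, refl_mulVec_self hww, Matrix.mulVec_neg, neg_eq_zero] at h2
        exact h2

end

/-- The last basis vector is a nonisotropic vector in the kernel of `diag(x, 0)`, so that its
reflection commutes with `diag(x, 0)` and the Jordan type determines the `SO_{n+1}`-orbit. -/
theorem saturation_nilOrbit_three {a s : ℕ}
    (hne : (nilOrbit K n (3 :: (List.replicate a 2 ++ List.replicate s 1))).Nonempty) :
    saturation (stdLieHom K n '' nilOrbit K n (3 :: (List.replicate a 2 ++ List.replicate s 1))) =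
      nilOrbit K (n + 1) (3 :: (List.replicate a 2 ++ List.replicate (s + 1) 1)) := by
  have key : ∀ x ∈ nilOrbit K n (3 :: (List.replicate a 2 ++ List.replicate s 1)),
      stdLieHom K n x ∈ nilOrbit K (n + 1)
        (3 :: (List.replicate a 2 ++ List.replicate (s + 1) 1)) := by
    intro x hx
    obtain ⟨h3, hr2, hr, hN⟩ := HasJordanType.three_two_one hx
    refine hasJordanType_three_two_one (x := extend x.1 0) ?_ ?_ ?_ (by omega)
    · rw [extend_pow _ three_ne_zero, h3, extend_zero_zero]
    · rw [extend_pow _ two_ne_zero, rank_extend_zero, hr2]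
    · rw [rank_extend_zero, hr]
  refine Set.Subset.antisymm ?_ fun y hy => ?_
  · rintro _ ⟨g, _, ⟨x, hx, rfl⟩, rfl⟩
    exact Ad_mem_nilOrbit g (key x hx)
  · obtain ⟨x, hx⟩ := hne
    have hww : lastVec K n ⬝ᵥ lastVec K n ≠ 0 := by rw [lastVec_dotProduct_self]; exact one_ne_zero
    have h0 : (stdLieHom K n x).1 *ᵥ lastVec K n = 0 := by
      rw [stdLieHom_coe, extend_mulVec_lastVec, zero_smul]
    rw [nilOrbit_eq_adOrbit (key x hx) (refl_orthogonal hww) (det_refl hww)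
      (refl_commute (soLie_transpose _) h0)] at hy
    obtain ⟨g, -, hg⟩ := hy
    exact ⟨g, _, ⟨x, hx, rfl⟩, hg⟩

theorem height_three_of_mem_nilOrbit {N a s : ℕ} (ha : 0 < a) {e : soLie K N}
    (he : e ∈ nilOrbit K N (3 :: (List.replicate a 2 ++ List.replicate s 1))) :
    IsGreatest {d : ℕ | (LieAlgebra.ad K (soLie K N) e) ^ d ≠ 0} 3 := by
  obtain ⟨h3, hr2, -⟩ := HasJordanType.three_two_one he
  obtain ⟨u, -, hu⟩ := exists_eq_vecMulVec_self (sq_transpose e) hr2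
  obtain ⟨a, rfl⟩ : ∃ a', a = a' + 1 := ⟨a - 1, by omega⟩
  have he' : HasJordanType e.1 (3 :: (List.replicate (a + 1) 2 ++ List.replicate s 1)) := he
  obtain ⟨t, ht, ht0⟩ := he'.exists_tops (fun i => by
    have := List.get_mem (3 :: (List.replicate (a + 1) 2 ++ List.replicate s 1)) i
    simp only [List.mem_cons, List.mem_append, List.mem_replicate] at this
    omega)
  have hl : 1 < (3 :: (List.replicate (a + 1) 2 ++ List.replicate s 1)).length := by simp
  have hne : (⟨0, by omega⟩ : Fin (3 :: (List.replicate (a + 1) 2 ++ List.replicate s 1)).length) ≠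
      ⟨1, hl⟩ := by simp
  refine height_three_of_cube_eq_zero h3 hu (a := t ⟨0, by omega⟩) (b := t ⟨1, hl⟩) ?_ ?_ ?_
  · exact ht.ne_zero ⟨0, by omega⟩
  · exact ht0 ⟨1, hl⟩
  · intro c hc
    have hp := ht.comp ![⟨0, by omega⟩, ⟨1, hl⟩] (fun i j hij => by
      fin_cases i <;> fin_cases j <;> simp_all)
    have hf : ((fun i =>
        e.1 ^ ((3 :: (List.replicate (a + 1) 2 ++ List.replicate s 1)).get i - 1) *ᵥ t i) ∘
          ![⟨0, by omega⟩, ⟨1, hl⟩]) =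
        ![e.1 ^ 2 *ᵥ t ⟨0, by omega⟩, e.1 ^ 1 *ᵥ t ⟨1, hl⟩] := by
      funext i
      fin_cases i <;> rfl
    have hp' := hf ▸ hp
    rw [pow_one] at hp'
    exact (LinearIndependent.pair_iff' (hp.ne_zero 0)).1 hp' c hc.symm

/-- The orthogonal case: orbits of type `(2^{2k}, 1^m)` projected to the hyperplane subalgebra. -/
theorem orthogonal_case {k m : ℕ} (hk : 2 ≤ k) (hN : n + 1 = 4 * k + m) :
      ∃ hc : IsCompl (stdso K n).toSubmodule (isotropy (stdso K n)),
        (0 < m → IsOrbit ⊤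
          (nilOrbit K (n + 1) (List.replicate (2 * k) 2 ++ List.replicate m 1))) ∧
        (m = 0 → ∃ O₁ O₂ : Set (soLie K (n + 1)),
          IsOrbit ⊤ O₁ ∧ IsOrbit ⊤ O₂ ∧ O₁ ≠ O₂ ∧
          O₁ ∪ O₂ = nilOrbit K (n + 1) (List.replicate (2 * k) 2)) ∧
        ∀ O : Set (soLie K (n + 1)), IsOrbit ⊤ O →
          O ⊆ nilOrbit K (n + 1) (List.replicate (2 * k) 2 ++ List.replicate m 1) →
          IsGood (stdso K n) O ∧
          (∃! Ω, IsDenseOrbit (stdSO K n) Ω O) ∧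
          HasHeight O 2 ∧
          ∀ Ω, IsDenseOrbit (stdSO K n) Ω O →
            Submodule.projection _ _ hc '' Ω =
              stdLieHom K n ''
                nilOrbit K n
                  (3 :: (List.replicate (2 * k - 2) 2 ++ List.replicate m 1)) ∧
            saturation (Submodule.projection _ _ hc '' Ω) =
              nilOrbit K (n + 1)
                (3 :: (List.replicate (2 * k - 2) 2 ++ List.replicate (m + 1) 1)) ∧
            HasHeight
              (saturation (Submodule.projection _ _ hc '' Ω)) 3 := by
  refine ⟨isCompl_stdso (by omega), isOrbit_nilOrbit_two_one hN,
    fun hm => two_orbits_nilOrbit_two (by omega) (by omega), fun O hO hs =>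
    ⟨isGood_stdso hk hN hO hs, ⟨_, isDenseOrbit_openPart hk hN hO hs,
      fun _ => eq_openPart_of_isDenseOrbit hk hN hO hs⟩, ⟨?_, fun e he =>
      height_two_of_mem_nilOrbit (by omega) (hs he)⟩, fun Ω hΩ => ?_⟩⟩
  · obtain ⟨e, rfl⟩ := hO
    exact ⟨e, mem_adOrbit_self ⊤ e⟩
  · obtain rfl := eq_openPart_of_isDenseOrbit hk hN hO hs hΩ
    have h1 : Submodule.projection _ _ (isCompl_stdso (K := K) (n := n) (by omega)) '' openPart O =
        stdLieHom K n ''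
          nilOrbit K n (3 :: (List.replicate (2 * k - 2) 2 ++ List.replicate m 1)) := by
      rw [← image_block_openPart hk hN hO hs, Set.image_image]
      exact Set.image_congr fun e _ => projection_stdso (by omega) _ e
    obtain ⟨e, he⟩ := openPart_nonempty hk hN hO hs
    have hne : (nilOrbit K n
        (3 :: (List.replicate (2 * k - 2) 2 ++ List.replicate m 1))).Nonempty :=
      ⟨block e, block_mem_nilOrbit hk hN (hs he.1) he.2⟩
    have h2 := saturation_nilOrbit_three hne
    rw [h1, h2]
    refine ⟨rfl, rfl, ?_, fun e he => height_three_of_mem_nilOrbit (by omega) he⟩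
    rw [← h2]
    obtain ⟨x, hx⟩ := hne
    exact ⟨_, 1, _, ⟨x, hx, rfl⟩, rfl⟩

end OrthogonalCase

/-! ### The Lie algebra of `G₂` inside `so_7` and its complement -/

section CrossProduct

variable {K : Type u} [Field K]

theorem cross7_eq (x y : Fin 7 → K) : cross7 x y =
    ![x 1 * y 3 - x 3 * y 1 + (x 2 * y 6 - x 6 * y 2) + (x 4 * y 5 - x 5 * y 4),
      x 2 * y 4 - x 4 * y 2 + (x 3 * y 0 - x 0 * y 3) + (x 5 * y 6 - x 6 * y 5),
      x 3 * y 5 - x 5 * y 3 + (x 4 * y 1 - x 1 * y 4) + (x 6 * y 0 - x 0 * y 6),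
      x 4 * y 6 - x 6 * y 4 + (x 5 * y 2 - x 2 * y 5) + (x 0 * y 1 - x 1 * y 0),
      x 5 * y 0 - x 0 * y 5 + (x 6 * y 3 - x 3 * y 6) + (x 1 * y 2 - x 2 * y 1),
      x 6 * y 1 - x 1 * y 6 + (x 0 * y 4 - x 4 * y 0) + (x 2 * y 3 - x 3 * y 2),
      x 0 * y 2 - x 2 * y 0 + (x 1 * y 5 - x 5 * y 1) + (x 3 * y 4 - x 4 * y 3)] := by
  funext i
  fin_cases i <;> rfl

/-- The matrix of the cross product with `c`. -/
def crossMat (c : Fin 7 → K) : Matrix (Fin 7) (Fin 7) K :=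
  !![0, -c 3, -c 6, c 1, -c 5, c 4, c 2;
     c 3, 0, -c 4, -c 0, c 2, -c 6, c 5;
     c 6, c 4, 0, -c 5, -c 1, c 3, -c 0;
     -c 1, c 0, c 5, 0, -c 6, -c 2, c 4;
     c 5, -c 2, c 1, c 6, 0, -c 0, -c 3;
     -c 4, c 6, -c 3, c 2, c 0, 0, -c 1;
     -c 2, -c 5, c 0, -c 4, c 3, c 1, 0]

theorem crossMat_mulVec (c w : Fin 7 → K) : crossMat c *ᵥ w = cross7 c w := by
  rw [cross7_eq]
  funext i
  fin_cases i <;>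
    simp [crossMat, Matrix.mulVec, dotProduct, Fin.sum_univ_seven] <;> ring

theorem crossMat_transpose (c : Fin 7 → K) : (crossMat c)ᵀ = -crossMat c := by
  ext i j
  fin_cases i <;> fin_cases j <;> simp [crossMat]

/-- The cross product with `c` as an element of `so_7`. -/
def crossSo (c : Fin 7 → K) : soLie K 7 := ⟨crossMat c, (mem_so _ _ _).2 (crossMat_transpose c)⟩

/-- The seven linear forms on `so_7` cutting out `𝔤₂`. -/
def defect (x : Matrix (Fin 7) (Fin 7) K) : Fin 7 → K := fun i =>
  x (i + 1) (i + 3) + x (i + 2) (i + 6) + x (i + 4) (i + 5)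

/-- An element of `so_7` is a derivation of the cross product if and only if the seven linear forms
in `defect` vanish on it. -/
theorem mem_g2_iff [CharZero K] (D : soLie K 7) : D ∈ g2 K ↔ defect D.1 = 0 := by
  have hs : ∀ i j : Fin 7, i < j → D.1 j i = -D.1 i j := fun i j _ => soLie_apply_swap D i j
  have hd := soLie_apply_self D
  constructor
  · intro h
    funext i
    -- the component `i + 5` of the derivation property for `e_{i + 1} × e_{i + 2}`
    have h1 := congrFun (h (Pi.single (i + 1) 1) (Pi.single (i + 2) 1)) (i + 5)
    simp only [defect, Pi.zero_apply]
    simp only [cross7_eq, Matrix.mulVec_single_one] at h1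
    fin_cases i <;>
      simp [Matrix.mulVec, dotProduct, Fin.sum_univ_seven, Matrix.col] at h1 ⊢ <;>
      simp only [hs, Fin.reduceLT] at h1 ⊢ <;>
      linear_combination -h1
  · intro h x y
    have e : ∀ i : Fin 7, D.1 (i + 1) (i + 3) + D.1 (i + 2) (i + 6) + D.1 (i + 4) (i + 5) = 0 :=
      fun i => congrFun h i
    have e0 : D.1 1 3 + D.1 2 6 + D.1 4 5 = 0 := e 0
    have e1 : D.1 2 4 + D.1 3 0 + D.1 5 6 = 0 := e 1
    have e2 : D.1 3 5 + D.1 4 1 + D.1 6 0 = 0 := e 2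
    have e3 : D.1 4 6 + D.1 5 2 + D.1 0 1 = 0 := e 3
    have e4 : D.1 5 0 + D.1 6 3 + D.1 1 2 = 0 := e 4
    have e5 : D.1 6 1 + D.1 0 4 + D.1 2 3 = 0 := e 5
    have e6 : D.1 0 2 + D.1 1 5 + D.1 3 4 = 0 := e 6
    simp only [hs, Fin.reduceLT] at e1 e2 e3 e4 e5
    rw [cross7_eq, cross7_eq, cross7_eq]
    funext i
    fin_cases i <;>
      simp only [Matrix.mulVec, dotProduct, Fin.sum_univ_seven, Pi.add_apply, Fin.zero_eta,
        Fin.mk_one, Fin.reduceFinMk, Matrix.cons_val] <;>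
      simp only [hs, hd, Fin.reduceLT, Fin.isValue]
    · linear_combination ((x 2 * y 5 - x 5 * y 2) - (x 4 * y 6 - x 6 * y 4)) * e1 +
        (-(x 3 * y 4 - x 4 * y 3) - (x 1 * y 5 - x 5 * y 1)) * e2 +
        ((x 2 * y 4 - x 4 * y 2) + (x 5 * y 6 - x 6 * y 5)) * e3 +
        (-(x 2 * y 3 - x 3 * y 2) + (x 1 * y 6 - x 6 * y 1)) * e4 +
        ((x 1 * y 2 - x 2 * y 1) - (x 3 * y 6 - x 6 * y 3)) * e5 +
        (-(x 1 * y 4 - x 4 * y 1) + (x 3 * y 5 - x 5 * y 3)) * e6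
    · linear_combination (-(x 2 * y 5 - x 5 * y 2) + (x 4 * y 6 - x 6 * y 4)) * e0 +
        ((x 0 * y 5 - x 5 * y 0) + (x 3 * y 6 - x 6 * y 3)) * e2 +
        (-(x 4 * y 5 - x 5 * y 4) - (x 2 * y 6 - x 6 * y 2)) * e3 +
        ((x 3 * y 5 - x 5 * y 3) - (x 0 * y 6 - x 6 * y 0)) * e4 +
        (-(x 0 * y 2 - x 2 * y 0) - (x 3 * y 4 - x 4 * y 3)) * e5 +
        ((x 2 * y 3 - x 3 * y 2) + (x 0 * y 4 - x 4 * y 0)) * e6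
    · linear_combination ((x 3 * y 4 - x 4 * y 3) + (x 1 * y 5 - x 5 * y 1)) * e0 +
        (-(x 0 * y 5 - x 5 * y 0) - (x 3 * y 6 - x 6 * y 3)) * e1 +
        (-(x 0 * y 4 - x 4 * y 0) + (x 1 * y 6 - x 6 * y 1)) * e3 +
        ((x 0 * y 3 - x 3 * y 0) - (x 5 * y 6 - x 6 * y 5)) * e4 +
        ((x 0 * y 1 - x 1 * y 0) + (x 4 * y 6 - x 6 * y 4)) * e5 +
        (-(x 1 * y 3 - x 3 * y 1) - (x 4 * y 5 - x 5 * y 4)) * e6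
    · linear_combination (-(x 2 * y 4 - x 4 * y 2) - (x 5 * y 6 - x 6 * y 5)) * e0 +
        ((x 4 * y 5 - x 5 * y 4) + (x 2 * y 6 - x 6 * y 2)) * e1 +
        ((x 0 * y 4 - x 4 * y 0) - (x 1 * y 6 - x 6 * y 1)) * e2 +
        (-(x 0 * y 2 - x 2 * y 0) - (x 1 * y 5 - x 5 * y 1)) * e4 +
        ((x 1 * y 4 - x 4 * y 1) + (x 0 * y 6 - x 6 * y 0)) * e5 +
        ((x 1 * y 2 - x 2 * y 1) - (x 0 * y 5 - x 5 * y 0)) * e6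
    · linear_combination ((x 2 * y 3 - x 3 * y 2) - (x 1 * y 6 - x 6 * y 1)) * e0 +
        (-(x 3 * y 5 - x 5 * y 3) + (x 0 * y 6 - x 6 * y 0)) * e1 +
        (-(x 0 * y 3 - x 3 * y 0) + (x 5 * y 6 - x 6 * y 5)) * e2 +
        ((x 0 * y 2 - x 2 * y 0) + (x 1 * y 5 - x 5 * y 1)) * e3 +
        (-(x 1 * y 3 - x 3 * y 1) - (x 2 * y 6 - x 6 * y 2)) * e5 +
        (-(x 0 * y 1 - x 1 * y 0) + (x 2 * y 5 - x 5 * y 2)) * e6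
    · linear_combination (-(x 1 * y 2 - x 2 * y 1) + (x 3 * y 6 - x 6 * y 3)) * e0 +
        ((x 0 * y 2 - x 2 * y 0) + (x 3 * y 4 - x 4 * y 3)) * e1 +
        (-(x 0 * y 1 - x 1 * y 0) - (x 4 * y 6 - x 6 * y 4)) * e2 +
        (-(x 1 * y 4 - x 4 * y 1) - (x 0 * y 6 - x 6 * y 0)) * e3 +
        ((x 1 * y 3 - x 3 * y 1) + (x 2 * y 6 - x 6 * y 2)) * e4 +
        ((x 0 * y 3 - x 3 * y 0) - (x 2 * y 4 - x 4 * y 2)) * e6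
    · linear_combination ((x 1 * y 4 - x 4 * y 1) - (x 3 * y 5 - x 5 * y 3)) * e0 +
        (-(x 2 * y 3 - x 3 * y 2) - (x 0 * y 4 - x 4 * y 0)) * e1 +
        ((x 1 * y 3 - x 3 * y 1) + (x 4 * y 5 - x 5 * y 4)) * e2 +
        (-(x 1 * y 2 - x 2 * y 1) + (x 0 * y 5 - x 5 * y 0)) * e3 +
        ((x 0 * y 1 - x 1 * y 0) - (x 2 * y 5 - x 5 * y 2)) * e4 +
        (-(x 0 * y 3 - x 3 * y 0) + (x 2 * y 4 - x 4 * y 2)) * e5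

end CrossProduct

section Isotropy

variable {K : Type u} [Field K]

theorem defect_add (x y : Matrix (Fin 7) (Fin 7) K) : defect (x + y) = defect x + defect y := by
  funext i
  simp only [defect, Matrix.add_apply, Pi.add_apply]
  ring

theorem defect_smul (c : K) (x : Matrix (Fin 7) (Fin 7) K) : defect (c • x) = c • defect x := by
  funext i
  simp only [defect, Matrix.smul_apply, Pi.smul_apply, smul_eq_mul]
  ring

theorem defect_crossMat (c : Fin 7 → K) : defect (crossMat c) = (-3 : K) • c := by
  funext i
  fin_cases i <;> simp [defect, crossMat] <;> ring

theorem defect_wedge (a b : Fin 7 → K) : defect (wedge a b) = -cross7 a b := by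
  funext i
  simp only [defect, wedge_apply, Pi.neg_apply, cross7]
  ring

theorem trace_mul_crossMat [CharZero K] (x : soLie K 7) (c : Fin 7 → K) :
    (x.1 * crossMat c).trace = 2 * (c ⬝ᵥ defect x.1) := by
  have hs : ∀ i j : Fin 7, i < j → x.1 j i = -x.1 i j := fun i j _ => soLie_apply_swap x i j
  have hd := soLie_apply_self x
  simp only [Matrix.trace, Matrix.diag_apply, Matrix.mul_apply, dotProduct, Fin.sum_univ_seven,
    defect, crossMat, Matrix.of_apply, Matrix.cons_val, Fin.isValue, Fin.reduceAdd, zero_add]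
  simp only [hs, hd, Fin.reduceLT, Fin.isValue]
  ring

theorem trace_wedge_mul {N : ℕ} (a b : Fin N → K) (y : soLie K N) :
    (wedge a b * y.1).trace = 2 * (a ⬝ᵥ y.1 *ᵥ b) := by
  rw [wedge, Matrix.sub_mul, Matrix.trace_sub, Matrix.vecMulVec_mul, Matrix.vecMulVec_mul,
    Matrix.trace_vecMulVec, Matrix.trace_vecMulVec]
  have h1 : a ᵥ* y.1 = -(y.1 *ᵥ a) := by
    rw [← Matrix.mulVec_transpose, soLie_transpose, Matrix.neg_mulVec]
  have h2 : b ᵥ* y.1 = -(y.1 *ᵥ b) := by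
    rw [← Matrix.mulVec_transpose, soLie_transpose, Matrix.neg_mulVec]
  have h3 := skew_dotProduct y a b
  rw [h1, h2]
  simp only [dotProduct_neg]
  rw [dotProduct_comm b, h3]
  ring

theorem wedgeSo_sub_mem_g2 [CharZero K] {a b c d : Fin 7 → K} (h : cross7 a b = cross7 c d) :
    wedgeSo a b - wedgeSo c d ∈ g2 K := by
  rw [mem_g2_iff]
  change defect (wedge a b - wedge c d) = 0
  rw [sub_eq_add_neg, ← neg_one_smul K (wedge c d), defect_add, defect_smul, defect_wedge,
    defect_wedge, h]
  simp

theorem cross7_single₁ (i : Fin 7) :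
    cross7 (Pi.single (i + 1) 1) (Pi.single (i + 3) (1 : K)) = Pi.single i 1 := by
  rw [cross7_eq]
  fin_cases i <;> (funext j; fin_cases j <;> simp)

theorem cross7_single₂ (i : Fin 7) :
    cross7 (Pi.single (i + 2) 1) (Pi.single (i + 6) (1 : K)) = Pi.single i 1 := by
  rw [cross7_eq]
  fin_cases i <;> (funext j; fin_cases j <;> simp)

theorem cross7_single₄ (i : Fin 7) :
    cross7 (Pi.single (i + 4) 1) (Pi.single (i + 5) (1 : K)) = Pi.single i 1 := by
  rw [cross7_eq]
  fin_cases i <;> (funext j; fin_cases j <;> simp)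

/-- The Killing form of `so_7` is nondegenerate on `𝔤₂`. -/
theorem eq_zero_of_mem_g2_of_mem_isotropy [CharZero K] {y : soLie K 7} (hy : y ∈ g2 K)
    (hm : y ∈ isotropy (g2 K)) : y = 0 := by
  rw [mem_isotropy_iff (by norm_num)] at hm
  rw [mem_g2_iff] at hy
  have key : ∀ i j k l : Fin 7, cross7 (Pi.single i 1) (Pi.single j (1 : K)) =
      cross7 (Pi.single k 1) (Pi.single l 1) → y.1 i j = y.1 k l := by
    intro i j k l h
    have h1 := hm _ (wedgeSo_sub_mem_g2 h)
    change ((wedge _ _ - wedge _ _) * y.1).trace = 0 at h1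
    rw [Matrix.sub_mul, Matrix.trace_sub, trace_wedge_mul, trace_wedge_mul] at h1
    simp only [Matrix.mulVec_single_one, single_one_dotProduct, Matrix.col_apply] at h1
    linear_combination h1 / 2
  have h1 : ∀ i : Fin 7, y.1 (i + 1) (i + 3) = y.1 (i + 2) (i + 6) := fun i =>
    key _ _ _ _ ((cross7_single₁ i).trans (cross7_single₂ i).symm)
  have h2 : ∀ i : Fin 7, y.1 (i + 1) (i + 3) = y.1 (i + 4) (i + 5) := fun i =>
    key _ _ _ _ ((cross7_single₁ i).trans (cross7_single₄ i).symm)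
  have h3 : ∀ i : Fin 7, y.1 (i + 1) (i + 3) = 0 := by
    intro i
    have h := congrFun hy i
    simp only [defect, ← h1, ← h2, Pi.zero_apply] at h
    linear_combination h / 3
  have h4 : ∀ i : Fin 7, y.1 (i + 2) (i + 6) = 0 := fun i => (h1 i).symm.trans (h3 i)
  have h5 : ∀ i : Fin 7, y.1 (i + 4) (i + 5) = 0 := fun i => (h2 i).symm.trans (h3 i)
  have hs : ∀ i j : Fin 7, y.1 i j = 0 → y.1 j i = 0 := fun i j h => by
    rw [soLie_apply_swap, h, neg_zero]
  have hd := soLie_apply_self y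
  -- the differences `i - j` of indices: `±2`, `±4`, `±1` occur in `h3`, `h4`, `h5`
  have hall : ∀ i d : Fin 7, y.1 i (i + d) = 0 := by
    intro i d
    fin_cases d
    · simpa using hd i
    · simpa [sub_add, show (4 : Fin 7) - 5 = -1 from rfl] using h5 (i - 4)
    · simpa [sub_add, show (1 : Fin 7) - 3 = -2 from rfl] using h3 (i - 1)
    · simpa [sub_add, show (6 : Fin 7) - 2 = -3 from rfl] using hs _ _ (h4 (i - 6))
    · simpa [sub_add, show (2 : Fin 7) - 6 = -4 from rfl] using h4 (i - 2)
    · simpa [sub_add, show (3 : Fin 7) - 1 = -5 from rfl] using hs _ _ (h3 (i - 3))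
    · simpa [sub_add, show (5 : Fin 7) - 4 = -6 from rfl] using hs _ _ (h5 (i - 5))
  refine Subtype.ext ?_
  ext i j
  have := hall i (j - i)
  rwa [add_sub_cancel] at this

theorem crossSo_mem_isotropy [CharZero K] (c : Fin 7 → K) : crossSo c ∈ isotropy (g2 K) := by
  rw [mem_isotropy_iff (by norm_num)]
  intro x hx
  change (x.1 * crossMat c).trace = 0
  rw [trace_mul_crossMat, (mem_g2_iff x).1 hx, dotProduct_zero, mul_zero]

/-- The component of `e` in `𝔤₂`. -/
noncomputable def g2Part (e : soLie K 7) : soLie K 7 := e + (3 : K)⁻¹ • crossSo (defect e.1)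

theorem g2Part_mem [CharZero K] (e : soLie K 7) : g2Part e ∈ g2 K := by
  rw [mem_g2_iff]
  change defect (e.1 + (3 : K)⁻¹ • crossMat (defect e.1)) = 0
  rw [defect_add, defect_smul, defect_crossMat, smul_smul]
  norm_num

theorem isCompl_g2 [CharZero K] : IsCompl (g2 K).toSubmodule (isotropy (g2 K)) := by
  constructor
  · rw [Submodule.disjoint_def]
    exact fun x h1 h2 => eq_zero_of_mem_g2_of_mem_isotropy h1 h2
  · rw [codisjoint_iff, eq_top_iff]
    intro e _
    have h : e = g2Part e + -((3 : K)⁻¹ • crossSo (defect e.1)) := by rw [g2Part]; abel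
    rw [h]
    exact Submodule.add_mem_sup (g2Part_mem e)
      (Submodule.neg_mem _ (Submodule.smul_mem _ _ (crossSo_mem_isotropy _)))

theorem projection_g2 [CharZero K] (e : soLie K 7) :
    Submodule.projection _ _ (isCompl_g2 (K := K)) e = g2Part e := by
  have h : e = g2Part e + -((3 : K)⁻¹ • crossSo (defect e.1)) := by rw [g2Part]; abel
  conv_lhs => rw [h]
  rw [map_add, Submodule.projection_apply_of_mem_left _ (g2Part_mem e),
    (Submodule.projection_apply_eq_zero_iff _).2, add_zero]
  exact Submodule.neg_mem _ (Submodule.smul_mem _ _ (crossSo_mem_isotropy _))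

/-- The complement of `𝔤₂` in `so_7` consists of the cross products with a vector. -/
theorem eq_crossSo_of_mem_isotropy [CharZero K] {y : soLie K 7} (hy : y ∈ isotropy (g2 K)) :
    ∃ c, y = crossSo c := by
  refine ⟨-((3 : K)⁻¹ • defect y.1), ?_⟩
  have h := (projection_g2 y).symm.trans ((Submodule.projection_apply_eq_zero_iff _).2 hy)
  rw [g2Part] at h
  refine (eq_neg_of_add_eq_zero_left h).trans (Subtype.ext ?_)
  change -((3 : K)⁻¹ • crossMat _) = crossMat _
  refine Matrix.toLin'.injective (LinearMap.ext fun w => ?_)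
  simp only [Matrix.toLin'_apply, Matrix.neg_mulVec, Matrix.smul_mulVec, crossMat_mulVec]
  rw [← neg_smul, ← neg_smul, cross7_smul_left]

end Isotropy

/-! ### Split coordinates for the octonions and elements of `G₂` -/

section Split

/-- Coordinates `(s, x, y)` on the imaginary octonions for which `SL₃` acts on `x` by the standard
representation and on `y` by its dual. -/
abbrev Split (K : Type u) : Type u := K × (Fin 3 → K) × (Fin 3 → K)

theorem split_ext {K : Type u} {w w' : Split K} (h : w.1 = w'.1) (h1 : ∀ i, w.2.1 i = w'.2.1 i)
    (h2 : ∀ i, w.2.2 i = w'.2.2 i) : w = w' :=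
  Prod.ext h (Prod.ext (funext h1) (funext h2))

variable {K : Type u} [Field K]

/-- The quadratic form in split coordinates. -/
def splitForm (w w' : Split K) : K :=
  -(w.1 * w'.1) + 2 * (w.2.1 ⬝ᵥ w'.2.2 + w.2.2 ⬝ᵥ w'.2.1)

/-- The seven-dimensional cross product in split coordinates. -/
def splitCross (w w' : Split K) : Split K :=
  (2 * (w.2.1 ⬝ᵥ w'.2.2 - w.2.2 ⬝ᵥ w'.2.1),
    w'.1 • w.2.1 - w.1 • w'.2.1 + (2 : K) • crossProduct w.2.2 w'.2.2,
    w.1 • w'.2.2 - w'.1 • w.2.2 + (2 : K) • crossProduct w.2.1 w'.2.1)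

/-- The isomorphism from split coordinates to the standard ones given by a square root `I` of `-1`:
the line `{1, 2, 4}` and its images `{3, 6, 5}` under `e₀ ×` are combined to the isotropic vectors
`e₁ ∓ I e₃`, `e₂ ∓ I e₆`, `e₄ ∓ I e₅`. -/
def ofSplit [CharZero K] {I : K} (hI : I * I = -1) : Split K ≃ₗ[K] (Fin 7 → K) where
  toFun w := ![I * w.1, w.2.1 0 + w.2.2 0, w.2.1 1 + w.2.2 1, I * (w.2.2 0 - w.2.1 0),
    w.2.1 2 + w.2.2 2, I * (w.2.2 2 - w.2.1 2), I * (w.2.2 1 - w.2.1 1)]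
  invFun v := (-I * v 0, ![(v 1 + I * v 3) / 2, (v 2 + I * v 6) / 2, (v 4 + I * v 5) / 2],
    ![(v 1 - I * v 3) / 2, (v 2 - I * v 6) / 2, (v 4 - I * v 5) / 2])
  map_add' w w' := by
    funext i
    fin_cases i <;> simp <;> ring
  map_smul' c w := by
    funext i
    fin_cases i <;> simp <;> ring
  left_inv w := by
    refine split_ext ?_ (fun i => ?_) (fun i => ?_)
    · simp
      linear_combination -w.1 * hI
    · fin_cases i <;> simp
      · linear_combination (w.2.2 0 - w.2.1 0) / 2 * hI
      · linear_combination (w.2.2 1 - w.2.1 1) / 2 * hI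
      · linear_combination (w.2.2 2 - w.2.1 2) / 2 * hI
    · fin_cases i <;> simp
      · linear_combination -(w.2.2 0 - w.2.1 0) / 2 * hI
      · linear_combination -(w.2.2 1 - w.2.1 1) / 2 * hI
      · linear_combination -(w.2.2 2 - w.2.1 2) / 2 * hI
  right_inv v := by
    funext i
    fin_cases i <;> simp
    · linear_combination -v 0 * hI
    · ring
    · ring
    · linear_combination -v 3 * hI
    · ring
    · linear_combination -v 5 * hI
    · linear_combination -v 6 * hI

variable {I : K} (hI : I * I = -1)

theorem dotProduct_ofSplit [CharZero K] (w w' : Split K) :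
    ofSplit hI w ⬝ᵥ ofSplit hI w' = splitForm w w' := by
  simp only [ofSplit, LinearEquiv.coe_mk, LinearMap.coe_mk, AddHom.coe_mk, dotProduct,
    Fin.sum_univ_seven, splitForm, Fin.sum_univ_three, Matrix.cons_val]
  linear_combination (w.1 * w'.1 + (w.2.2 0 - w.2.1 0) * (w'.2.2 0 - w'.2.1 0) +
    (w.2.2 1 - w.2.1 1) * (w'.2.2 1 - w'.2.1 1) + (w.2.2 2 - w.2.1 2) * (w'.2.2 2 - w'.2.1 2)) * hI

theorem cross7_ofSplit [CharZero K] (w w' : Split K) :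
    cross7 (ofSplit hI w) (ofSplit hI w') = ofSplit hI (splitCross w w') := by
  have hI2 : I ^ 2 = -1 := by rw [pow_two, hI]
  rw [cross7_eq]
  funext i
  fin_cases i <;>
    simp only [ofSplit, LinearEquiv.coe_mk, LinearMap.coe_mk, AddHom.coe_mk, dotProduct,
      splitCross, Fin.sum_univ_three, Matrix.cons_val, cross_apply, Pi.add_apply, Pi.sub_apply,
      Pi.smul_apply, smul_eq_mul, Fin.zero_eta, Fin.mk_one, Fin.reduceFinMk, Fin.isValue] <;>
    ring_nf <;> simp only [hI2] <;> ring

/-- The matrix in the standard coordinates of an endomorphism in split coordinates. -/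
noncomputable def splitMatrix [CharZero K] (T : Split K →ₗ[K] Split K) : Matrix (Fin 7) (Fin 7) K :=
  LinearMap.toMatrix' ((ofSplit hI).toLinearMap ∘ₗ T ∘ₗ (ofSplit hI).symm.toLinearMap)

theorem splitMatrix_mulVec [CharZero K] (T : Split K →ₗ[K] Split K) (w : Split K) :
    splitMatrix hI T *ᵥ ofSplit hI w = ofSplit hI (T w) := by
  rw [splitMatrix, LinearMap.toMatrix'_mulVec]
  simp

theorem splitMatrix_det [CharZero K] (T : Split K →ₗ[K] Split K) :
    (splitMatrix hI T).det = LinearMap.det T := by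
  rw [splitMatrix, LinearMap.det_toMatrix']
  exact LinearMap.det_conj T (ofSplit hI)

theorem splitMatrix_orthogonal [CharZero K] {T : Split K →ₗ[K] Split K}
    (hf : ∀ w w', splitForm (T w) (T w') = splitForm w w') :
    (splitMatrix hI T)ᵀ * splitMatrix hI T = 1 := by
  refine Matrix.ext_of_mulVec_single fun i => ?_
  rw [Matrix.one_mulVec]
  refine dotProduct_eq _ _ fun v => ?_
  obtain ⟨w, hw⟩ := (ofSplit hI).surjective (Pi.single i 1)
  obtain ⟨w', rfl⟩ := (ofSplit hI).surjective v
  rw [← Matrix.mulVec_mulVec, Matrix.mulVec_transpose, ← Matrix.dotProduct_mulVec, ← hw,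
    splitMatrix_mulVec, splitMatrix_mulVec, dotProduct_ofSplit, dotProduct_ofSplit, hf]

/-- A linear automorphism of the split octonions of determinant one gives an element of `G₂`. -/
theorem exists_mem_G2 [CharZero K] {T : Split K →ₗ[K] Split K}
    (hf : ∀ w w', splitForm (T w) (T w') = splitForm w w')
    (hc : ∀ w w', T (splitCross w w') = splitCross (T w) (T w'))
    (hd : LinearMap.det T = 1) :
    ∃ g ∈ G2 K, ∀ w, g.1 *ᵥ ofSplit hI w = ofSplit hI (T w) := by
  refine ⟨mkSO _ (splitMatrix_orthogonal hI hf) ((splitMatrix_det hI T).trans hd), ?_,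
    splitMatrix_mulVec hI T⟩
  intro v v'
  obtain ⟨w, rfl⟩ := (ofSplit hI).surjective v
  obtain ⟨w', rfl⟩ := (ofSplit hI).surjective v'
  change splitMatrix hI T *ᵥ _ = cross7 (splitMatrix hI T *ᵥ _) (splitMatrix hI T *ᵥ _)
  rw [cross7_ofSplit, splitMatrix_mulVec, splitMatrix_mulVec, splitMatrix_mulVec, cross7_ofSplit,
      hc]

/-- The unipotent automorphism attached to `u` in the standard representation of `SL₃`. -/
def unipX (u : Fin 3 → K) : Split K →ₗ[K] Split K where
  toFun w := (w.1 + 2 * (u ⬝ᵥ w.2.2), w.2.1 + (w.1 + u ⬝ᵥ w.2.2) • u,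
    w.2.2 - crossProduct u w.2.1)
  map_add' w w' := by
    refine split_ext ?_ (fun i => ?_) (fun i => ?_)
    · simp; ring
    · simp; ring
    · simp; ring
  map_smul' c w := by
    refine split_ext ?_ (fun i => ?_) (fun i => ?_)
    · simp; ring
    · simp; ring
    · simp; ring

/-- The unipotent automorphism attached to `v` in the dual of the standard representation of
`SL₃`. -/
def unipY (v : Fin 3 → K) : Split K →ₗ[K] Split K where
  toFun w := (w.1 - 2 * (v ⬝ᵥ w.2.1), w.2.1 - crossProduct v w.2.2,
    w.2.2 + (v ⬝ᵥ w.2.1 - w.1) • v)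
  map_add' w w' := by
    refine split_ext ?_ (fun i => ?_) (fun i => ?_)
    · simp; ring
    · simp; ring
    · simp; ring
  map_smul' c w := by
    refine split_ext ?_ (fun i => ?_) (fun i => ?_)
    · simp; ring
    · simp; ring
    · simp; ring

theorem splitForm_unipX (u : Fin 3 → K) (w w' : Split K) :
    splitForm (unipX u w) (unipX u w') = splitForm w w' := by
  simp only [splitForm, unipX, LinearMap.coe_mk, AddHom.coe_mk, cross_apply, vec3_dotProduct,
      Pi.add_apply, Pi.sub_apply, Pi.smul_apply, smul_eq_mul, Matrix.cons_val, Fin.isValue]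
  ring

theorem splitCross_unipX (u : Fin 3 → K) (w w' : Split K) :
    unipX u (splitCross w w') = splitCross (unipX u w) (unipX u w') := by
  refine split_ext ?_ (fun i => ?_) (fun i => ?_)
  · simp only [splitCross, unipX, LinearMap.coe_mk, AddHom.coe_mk, cross_apply, vec3_dotProduct,
      Pi.add_apply, Pi.sub_apply, Pi.smul_apply, smul_eq_mul, Matrix.cons_val, Fin.isValue]
    ring
  · fin_cases i <;> simp only [splitCross, unipX, LinearMap.coe_mk, AddHom.coe_mk, cross_apply,
      vec3_dotProduct, Pi.add_apply, Pi.sub_apply, Pi.smul_apply, smul_eq_mul, Matrix.cons_val,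
      Fin.zero_eta, Fin.mk_one, Fin.reduceFinMk, Fin.isValue] <;> ring
  · fin_cases i <;> simp only [splitCross, unipX, LinearMap.coe_mk, AddHom.coe_mk, cross_apply,
      vec3_dotProduct, Pi.add_apply, Pi.sub_apply, Pi.smul_apply, smul_eq_mul, Matrix.cons_val,
      Fin.zero_eta, Fin.mk_one, Fin.reduceFinMk, Fin.isValue] <;> ring

theorem splitForm_unipY (u : Fin 3 → K) (w w' : Split K) :
    splitForm (unipY u w) (unipY u w') = splitForm w w' := by
  simp only [splitForm, unipY, LinearMap.coe_mk, AddHom.coe_mk, cross_apply, vec3_dotProduct,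
      Pi.add_apply, Pi.sub_apply, Pi.smul_apply, smul_eq_mul, Matrix.cons_val, Fin.isValue]
  ring

theorem splitCross_unipY (u : Fin 3 → K) (w w' : Split K) :
    unipY u (splitCross w w') = splitCross (unipY u w) (unipY u w') := by
  refine split_ext ?_ (fun i => ?_) (fun i => ?_)
  · simp only [splitCross, unipY, LinearMap.coe_mk, AddHom.coe_mk, cross_apply, vec3_dotProduct,
      Pi.add_apply, Pi.sub_apply, Pi.smul_apply, smul_eq_mul, Matrix.cons_val, Fin.isValue]
    ring
  · fin_cases i <;> simp only [splitCross, unipY, LinearMap.coe_mk, AddHom.coe_mk, cross_apply,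
      vec3_dotProduct, Pi.add_apply, Pi.sub_apply, Pi.smul_apply, smul_eq_mul, Matrix.cons_val,
      Fin.zero_eta, Fin.mk_one, Fin.reduceFinMk, Fin.isValue] <;> ring
  · fin_cases i <;> simp only [splitCross, unipY, LinearMap.coe_mk, AddHom.coe_mk, cross_apply,
      vec3_dotProduct, Pi.add_apply, Pi.sub_apply, Pi.smul_apply, smul_eq_mul, Matrix.cons_val,
      Fin.zero_eta, Fin.mk_one, Fin.reduceFinMk, Fin.isValue] <;> ring

end Split

section Elements

variable {K : Type u} [Field K] {I : K} (hI : I * I = -1)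

/-- A square of an isometry has determinant one. -/
theorem det_eq_one_of_eq_comp_self [CharZero K] (hI : I * I = -1) {T S : Split K →ₗ[K] Split K}
    (hf : ∀ w w', splitForm (S w) (S w') = splitForm w w') (h : T = S ∘ₗ S) :
    LinearMap.det T = 1 := by
  rw [h, LinearMap.det_comp, ← splitMatrix_det hI]
  rcases det_eq_of_orthogonal (splitMatrix_orthogonal hI hf) with h | h <;> rw [h] <;> norm_num

theorem unipX_eq_comp_self [CharZero K] (u : Fin 3 → K) :
    unipX u = unipX ((2 : K)⁻¹ • u) ∘ₗ unipX ((2 : K)⁻¹ • u) := by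
  refine LinearMap.ext fun w => split_ext ?_ (fun i => ?_) (fun i => ?_)
  · simp only [LinearMap.comp_apply, unipX, LinearMap.coe_mk, AddHom.coe_mk, cross_apply,
      vec3_dotProduct, Pi.add_apply, Pi.sub_apply, Pi.smul_apply, smul_eq_mul, Matrix.cons_val]
    ring
  · fin_cases i <;>
    simp only [LinearMap.comp_apply, unipX, LinearMap.coe_mk, AddHom.coe_mk, cross_apply,
      vec3_dotProduct, Pi.add_apply, Pi.sub_apply, Pi.smul_apply, smul_eq_mul, Matrix.cons_val,
      Fin.zero_eta, Fin.mk_one, Fin.reduceFinMk, Fin.isValue] <;> ring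
  · fin_cases i <;>
    simp only [LinearMap.comp_apply, unipX, LinearMap.coe_mk, AddHom.coe_mk, cross_apply,
      vec3_dotProduct, Pi.add_apply, Pi.sub_apply, Pi.smul_apply, smul_eq_mul, Matrix.cons_val,
      Fin.zero_eta, Fin.mk_one, Fin.reduceFinMk, Fin.isValue] <;> ring

theorem unipY_eq_comp_self [CharZero K] (v : Fin 3 → K) :
    unipY v = unipY ((2 : K)⁻¹ • v) ∘ₗ unipY ((2 : K)⁻¹ • v) := by
  refine LinearMap.ext fun w => split_ext ?_ (fun i => ?_) (fun i => ?_)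
  · simp only [LinearMap.comp_apply, unipY, LinearMap.coe_mk, AddHom.coe_mk, cross_apply,
      vec3_dotProduct, Pi.add_apply, Pi.sub_apply, Pi.smul_apply, smul_eq_mul, Matrix.cons_val]
    ring
  · fin_cases i <;>
    simp only [LinearMap.comp_apply, unipY, LinearMap.coe_mk, AddHom.coe_mk, cross_apply,
      vec3_dotProduct, Pi.add_apply, Pi.sub_apply, Pi.smul_apply, smul_eq_mul, Matrix.cons_val,
      Fin.zero_eta, Fin.mk_one, Fin.reduceFinMk, Fin.isValue] <;> ring
  · fin_cases i <;>
    simp only [LinearMap.comp_apply, unipY, LinearMap.coe_mk, AddHom.coe_mk, cross_apply,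
      vec3_dotProduct, Pi.add_apply, Pi.sub_apply, Pi.smul_apply, smul_eq_mul, Matrix.cons_val,
      Fin.zero_eta, Fin.mk_one, Fin.reduceFinMk, Fin.isValue] <;> ring

theorem exists_unipX [CharZero K] (u : Fin 3 → K) :
    ∃ g ∈ G2 K, ∀ w, g.1 *ᵥ ofSplit hI w = ofSplit hI (unipX u w) :=
  exists_mem_G2 hI (splitForm_unipX u) (splitCross_unipX u)
    (det_eq_one_of_eq_comp_self hI (splitForm_unipX _) (unipX_eq_comp_self u))

theorem exists_unipY [CharZero K] (v : Fin 3 → K) :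
    ∃ g ∈ G2 K, ∀ w, g.1 *ᵥ ofSplit hI w = ofSplit hI (unipY v w) :=
  exists_mem_G2 hI (splitForm_unipY v) (splitCross_unipY v)
    (det_eq_one_of_eq_comp_self hI (splitForm_unipY _) (unipY_eq_comp_self v))

/-- The action of `A ∈ SL₃` in split coordinates: by `A` on `x` and by the contragredient matrix
on `y`. -/
def slMap (A : Matrix (Fin 3) (Fin 3) K) : Split K →ₗ[K] Split K :=
  LinearMap.prodMap LinearMap.id (LinearMap.prodMap A.mulVecLin A.adjugateᵀ.mulVecLin)

theorem slMap_apply (A : Matrix (Fin 3) (Fin 3) K) (w : Split K) :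
    slMap A w = (w.1, A *ᵥ w.2.1, A.adjugateᵀ *ᵥ w.2.2) := rfl

theorem det_slMap {A : Matrix (Fin 3) (Fin 3) K} (hA : A.det = 1) :
    LinearMap.det (slMap A) = 1 := by
  rw [slMap, LinearMap.det_prodMap, LinearMap.det_prodMap, LinearMap.det_id, ← Matrix.toLin'_apply',
    ← Matrix.toLin'_apply', LinearMap.det_toLin', LinearMap.det_toLin', Matrix.det_transpose,
    Matrix.det_adjugate, hA]
  simp

theorem mulVec_dotProduct_adjugate_transpose {A : Matrix (Fin 3) (Fin 3) K} (hA : A.det = 1)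
    (x y : Fin 3 → K) : A *ᵥ x ⬝ᵥ A.adjugateᵀ *ᵥ y = x ⬝ᵥ y := by
  rw [Matrix.mulVec_transpose, dotProduct_comm, ← Matrix.dotProduct_mulVec, Matrix.mulVec_mulVec,
    Matrix.adjugate_mul, hA, one_smul, Matrix.one_mulVec, dotProduct_comm]

theorem adjugate_transpose_mulVec_cross (A : Matrix (Fin 3) (Fin 3) K) (x x' : Fin 3 → K) :
    A.adjugateᵀ *ᵥ crossProduct x x' = crossProduct (A *ᵥ x) (A *ᵥ x') := by
  funext i
  rw [Matrix.adjugate_fin_three]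
  fin_cases i <;> simp [Matrix.mulVec, vec3_dotProduct, cross_apply,
      Matrix.transpose_apply] <;> ring

theorem mulVec_cross [CharZero K] {A : Matrix (Fin 3) (Fin 3) K} (hA : A.det = 1)
    (y y' : Fin 3 → K) :
    A *ᵥ crossProduct y y' = crossProduct (A.adjugateᵀ *ᵥ y) (A.adjugateᵀ *ᵥ y') := by
  rw [← adjugate_transpose_mulVec_cross, Matrix.adjugate_transpose, Matrix.transpose_transpose,
    Matrix.adjugate_adjugate _ (by simp), hA]
  simp

/-- The subgroup `SL₃` of `G₂`. -/
theorem exists_slMap [CharZero K] {A : Matrix (Fin 3) (Fin 3) K} (hA : A.det = 1) :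
    ∃ g ∈ G2 K, ∀ w, g.1 *ᵥ ofSplit hI w = ofSplit hI (slMap A w) := by
  refine exists_mem_G2 hI (fun w w' => ?_) (fun w w' => ?_) (det_slMap hA)
  · simp only [splitForm, slMap_apply, mulVec_dotProduct_adjugate_transpose hA]
    rw [dotProduct_comm (A.adjugateᵀ *ᵥ w.2.2), mulVec_dotProduct_adjugate_transpose hA,
      dotProduct_comm w'.2.1]
  · simp only [splitCross, slMap_apply, mulVec_dotProduct_adjugate_transpose hA]
    rw [dotProduct_comm (A.adjugateᵀ *ᵥ w.2.2), mulVec_dotProduct_adjugate_transpose hA,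
      dotProduct_comm w'.2.1]
    simp only [Matrix.mulVec_add, Matrix.mulVec_sub, Matrix.mulVec_smul, mulVec_cross hA,
      adjugate_transpose_mulVec_cross]

/-- Two linearly independent vectors are moved to the first two basis vectors by `SL₃`. -/
theorem exists_sl_of_cross_ne_zero {p q : Fin 3 → K} (h : crossProduct p q ≠ 0) :
    ∃ A : Matrix (Fin 3) (Fin 3) K, A.det = 1 ∧ A *ᵥ p = ![1, 0, 0] ∧ A *ᵥ q = ![0, 1, 0] := by
  obtain ⟨i, hi⟩ := Function.ne_iff.1 h
  set r : Fin 3 → K := Pi.single i (crossProduct p q i)⁻¹ with hr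
  have hr1 : crossProduct p q ⬝ᵥ r = 1 := by
    rw [hr, dotProduct_single]
    exact mul_inv_cancel₀ hi
  let P : Matrix (Fin 3) (Fin 3) K := !![p 0, q 0, r 0; p 1, q 1, r 1; p 2, q 2, r 2]
  have hP : P.det = 1 := by
    rw [← hr1, Matrix.det_fin_three, cross_apply, vec3_dotProduct]
    simp [P]
    ring
  have hp : P *ᵥ ![1, 0, 0] = p := by
    funext j
    fin_cases j <;> simp [P, Matrix.mulVec]
  have hq : P *ᵥ ![0, 1, 0] = q := by
    funext j
    fin_cases j <;> simp [P, Matrix.mulVec]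
  refine ⟨P.adjugate, ?_, ?_, ?_⟩
  · rw [Matrix.det_adjugate, hP, one_pow]
  · conv_lhs => rw [← hp]
    rw [Matrix.mulVec_mulVec, Matrix.adjugate_mul, hP, one_smul, Matrix.one_mulVec]
  · conv_lhs => rw [← hq]
    rw [Matrix.mulVec_mulVec, Matrix.adjugate_mul, hP, one_smul, Matrix.one_mulVec]

theorem exists_cross_ne_zero {p : Fin 3 → K} (hp : p ≠ 0) : ∃ q, crossProduct p q ≠ 0 := by
  by_contra! h
  refine hp (funext fun i => ?_)
  have h0 := h ![1, 0, 0]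
  have h1 := h ![0, 1, 0]
  rw [cross_apply] at h0 h1
  have a1 := congrFun h0 1
  have a2 := congrFun h0 2
  have a3 := congrFun h1 2
  simp at a1 a2 a3
  fin_cases i
  · exact a3
  · exact a2
  · exact a1

end Elements

/-! ### Transitivity of `G₂` on isotropic vectors -/

section Transitivity

variable {K : Type u} [Field K] {I : K} (hI : I * I = -1)

theorem unipX_apply (u : Fin 3 → K) (w : Split K) : unipX u w =
    (w.1 + 2 * (u 0 * w.2.2 0 + u 1 * w.2.2 1 + u 2 * w.2.2 2),
      ![w.2.1 0 + (w.1 + (u 0 * w.2.2 0 + u 1 * w.2.2 1 + u 2 * w.2.2 2)) * u 0,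
        w.2.1 1 + (w.1 + (u 0 * w.2.2 0 + u 1 * w.2.2 1 + u 2 * w.2.2 2)) * u 1,
        w.2.1 2 + (w.1 + (u 0 * w.2.2 0 + u 1 * w.2.2 1 + u 2 * w.2.2 2)) * u 2],
      ![w.2.2 0 - (u 1 * w.2.1 2 - u 2 * w.2.1 1), w.2.2 1 - (u 2 * w.2.1 0 - u 0 * w.2.1 2),
        w.2.2 2 - (u 0 * w.2.1 1 - u 1 * w.2.1 0)]) := by
  rw [← vec3_dotProduct]
  refine split_ext rfl (fun i => ?_) (fun i => ?_) <;> fin_cases i <;> rfl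

theorem unipY_apply (v : Fin 3 → K) (w : Split K) : unipY v w =
    (w.1 - 2 * (v 0 * w.2.1 0 + v 1 * w.2.1 1 + v 2 * w.2.1 2),
      ![w.2.1 0 - (v 1 * w.2.2 2 - v 2 * w.2.2 1), w.2.1 1 - (v 2 * w.2.2 0 - v 0 * w.2.2 2),
        w.2.1 2 - (v 0 * w.2.2 1 - v 1 * w.2.2 0)],
      ![w.2.2 0 + (v 0 * w.2.1 0 + v 1 * w.2.1 1 + v 2 * w.2.1 2 - w.1) * v 0,
        w.2.2 1 + (v 0 * w.2.1 0 + v 1 * w.2.1 1 + v 2 * w.2.1 2 - w.1) * v 1,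
        w.2.2 2 + (v 0 * w.2.1 0 + v 1 * w.2.1 1 + v 2 * w.2.1 2 - w.1) * v 2]) := by
  rw [← vec3_dotProduct]
  refine split_ext rfl (fun i => ?_) (fun i => ?_) <;> fin_cases i <;> rfl

/-- Two vectors in split coordinates lie in one orbit of `G₂`. -/
def SplitConj [CharZero K] (w w' : Split K) : Prop :=
  ∃ g ∈ G2 K, g.1 *ᵥ ofSplit hI w = ofSplit hI w'

theorem SplitConj.trans [CharZero K] {w w' w'' : Split K} (h : SplitConj hI w w')
    (h' : SplitConj hI w' w'') :
    SplitConj hI w w'' := by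
  obtain ⟨g, hg, h⟩ := h
  obtain ⟨g', hg', h'⟩ := h'
  refine ⟨g' * g, (G2 K).mul_mem hg' hg, ?_⟩
  change (g'.1 * g.1) *ᵥ _ = _
  rw [← Matrix.mulVec_mulVec, h, h']

theorem SplitConj.form_eq [CharZero K] {w w' : Split K} (h : SplitConj hI w w') :
    splitForm w w = splitForm w' w' := by
  obtain ⟨g, -, h⟩ := h
  rw [← dotProduct_ofSplit hI, ← dotProduct_ofSplit hI, ← h, Matrix.dotProduct_mulVec,
    ← Matrix.mulVec_transpose, Matrix.mulVec_mulVec, SO_transpose_mul, Matrix.one_mulVec]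

theorem splitConj_of_ne_zero [CharZero K] (s : K) {x : Fin 3 → K} (hx : x ≠ 0) (y : Fin 3 → K) :
    ∃ y', SplitConj hI (s, x, y) (s, ![1, 0, 0], y') := by
  obtain ⟨q, hq⟩ := exists_cross_ne_zero hx
  obtain ⟨A, hA, hp, -⟩ := exists_sl_of_cross_ne_zero hq
  obtain ⟨g, hg, h⟩ := exists_slMap hI hA
  exact ⟨A.adjugateᵀ *ᵥ y, g, hg, by rw [h, slMap_apply, hp]⟩

theorem splitConj_cross [CharZero K] (s : K) (y : Fin 3 → K) :
    ∃ x' y', x' ≠ 0 ∧ SplitConj hI (s, ![1, 0, 0], y) (0, x', y') := by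
  obtain ⟨g, hg, h⟩ := exists_unipY hI ![s / 2, 0, 0]
  refine ⟨(unipY ![s / 2, 0, 0] (s, ![1, 0, 0], y)).2.1,
      (unipY ![s / 2, 0, 0] (s, ![1, 0, 0], y)).2.2,
    fun h0 => ?_, g, hg, ?_⟩
  · have := congrFun h0 0
    simp [unipY_apply] at this
  · rw [h]
    congr 1
    refine Prod.ext ?_ rfl
    simp [unipY_apply]
    ring

/-- `G₂` acts transitively on the nonzero isotropic vectors. -/
theorem splitConj_isotropic [CharZero K] {w : Split K} (h0 : w ≠ 0) (hw : splitForm w w = 0) :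
    SplitConj hI w (0, ![1, 0, 0], 0) := by
  have key : ∀ s (x y : Fin 3 → K), x ≠ 0 → splitForm (s, x, y) (s, x, y) = 0 →
      SplitConj hI (s, x, y) (0, ![1, 0, 0], 0) := by
    intro s x y hx hf
    obtain ⟨y₁, h1⟩ := splitConj_of_ne_zero hI s hx y
    obtain ⟨x₂, y₂, hx₂, h2⟩ := splitConj_cross hI s y₁
    obtain ⟨y₃, h3⟩ := splitConj_of_ne_zero hI 0 hx₂ y₂
    have h := (h1.trans hI h2).trans hI h3
    have hf' := h.form_eq hI
    rw [hf] at hf'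
    have hy : y₃ 0 = 0 := by
      simp only [splitForm, vec3_dotProduct, Matrix.cons_val] at hf'
      linear_combination -hf' / 4
    refine h.trans hI ?_
    obtain ⟨g, hg, hg'⟩ := exists_unipX hI ![0, -y₃ 2, y₃ 1]
    refine ⟨g, hg, ?_⟩
    rw [hg']
    congr 1
    refine split_ext ?_ (fun i => ?_) (fun i => ?_)
    · simp [unipX_apply]
      ring
    · have h0 : -(y₃ 2 * y₃ 1) + y₃ 1 * y₃ 2 = 0 := by ring
      fin_cases i <;> simp [unipX_apply, h0]
    · fin_cases i <;> simp [unipX_apply, hy]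
  obtain ⟨s, x, y⟩ := w
  by_cases hx : x = 0
  · subst hx
    have hs : s = 0 := by
      simpa [splitForm] using hw
    subst hs
    have hy : y ≠ 0 := by
      rintro rfl
      exact h0 rfl
    obtain ⟨i, hi⟩ := Function.ne_iff.1 hy
    have hi' : y i ≠ 0 := hi
    obtain ⟨g, hg, hg'⟩ := exists_unipX hI (Pi.single i 1)
    have h1 : SplitConj hI (0, 0, y) (unipX (Pi.single i 1) (0, 0, y)) := ⟨g, hg, hg' _⟩
    refine h1.trans hI ?_
    have h2 := h1.form_eq hI
    rw [hw] at h2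
    refine key _ _ _ (fun h3 => ?_) h2.symm
    have := congrFun h3 i
    simp at this
    exact hi' this
  · exact key s x y hx hw

/-- The stabiliser of an isotropic vector in `G₂` acts transitively on the generic orthogonal
vectors of norm one, up to multiples of the isotropic vector. -/
theorem exists_conj_of_generic [CharZero K] {s : K} {x y : Fin 3 → K} (hy : y 0 = 0)
    (hb : splitForm (s, x, y) (s, x, y) = 1) (hx : x 1 ≠ 0 ∨ x 2 ≠ 0) :
    ∃ g ∈ G2 K, ∃ c : K, g.1 *ᵥ ofSplit hI (0, ![1, 0, 0], 0) = ofSplit hI (0, ![1, 0, 0], 0) ∧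
      g.1 *ᵥ ofSplit hI (s, x, y) = ofSplit hI (0, ![c, 1, 0], ![0, 4⁻¹, 0]) := by
  have hc : crossProduct ![1, 0, 0] x ≠ 0 := by
    intro h
    rw [cross_apply] at h
    have h1 := congrFun h 1
    have h2 := congrFun h 2
    simp at h1 h2
    tauto
  obtain ⟨A, hA, h1, h2⟩ := exists_sl_of_cross_ne_zero hc
  obtain ⟨g₁, hg₁, ha₁⟩ := exists_slMap hI hA
  set y₁ := A.adjugateᵀ *ᵥ y with hy₁
  have hy10 : y₁ 0 = 0 := by
    have := mulVec_dotProduct_adjugate_transpose hA ![1, 0, 0] y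
    rw [h1, vec3_dotProduct, vec3_dotProduct] at this
    simpa [hy] using this
  obtain ⟨g₂, hg₂, ha₂⟩ := exists_unipY hI ![0, s / 2, 0]
  set y₂ := (unipY ![0, s / 2, 0] (s, ![0, 1, 0], y₁)).2.2 with hy₂
  obtain ⟨g₃, hg₃, ha₃⟩ := exists_unipX hI ![y₂ 2, 0, 0]
  have b1 : slMap A (s, x, y) = (s, ![0, 1, 0], y₁) := by rw [slMap_apply, h2]
  have b2 : unipY ![0, s / 2, 0] (s, ![0, 1, 0], y₁) = (0, ![-(s / 2 * y₁ 2), 1, 0], y₂) := by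
    refine split_ext ?_ (fun i => ?_) (fun i => ?_)
    · simp [unipY_apply]
      ring
    · fin_cases i <;> simp [unipY_apply, hy10]
    · rfl
  have hy20 : y₂ 0 = 0 := by simp [hy₂, unipY_apply, hy10]
  have b3 : unipX ![y₂ 2, 0, 0] (0, ![-(s / 2 * y₁ 2), 1, 0], y₂) =
      (0, ![-(s / 2 * y₁ 2), 1, 0], ![0, y₂ 1, 0]) := by
    refine split_ext ?_ (fun i => ?_) (fun i => ?_)
    · simp [unipX_apply, hy20]
    · fin_cases i <;> simp [unipX_apply, hy20]
    · fin_cases i <;> simp [unipX_apply, hy20]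
  have hb' : (g₃ * (g₂ * g₁)).1 *ᵥ ofSplit hI (s, x, y) =
      ofSplit hI (0, ![-(s / 2 * y₁ 2), 1, 0], ![0, y₂ 1, 0]) := by
    change (g₃.1 * (g₂.1 * g₁.1)) *ᵥ _ = _
    rw [← Matrix.mulVec_mulVec, ← Matrix.mulVec_mulVec, ha₁, b1, ha₂, b2, ha₃, b3]
  have hmem := (G2 K).mul_mem hg₃ ((G2 K).mul_mem hg₂ hg₁)
  have hn : y₂ 1 = 4⁻¹ := by
    have := SplitConj.form_eq hI ⟨_, hmem, hb'⟩
    rw [hb] at this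
    simp only [splitForm, vec3_dotProduct, Matrix.cons_val] at this
    linear_combination -this / 4
  refine ⟨_, hmem, -(s / 2 * y₁ 2), ?_, by rw [hb', hn]⟩
  change (g₃.1 * (g₂.1 * g₁.1)) *ᵥ _ = _
  rw [← Matrix.mulVec_mulVec, ← Matrix.mulVec_mulVec, ha₁, slMap_apply, h1, ha₂, ha₃]
  congr 1
  refine split_ext ?_ (fun i => ?_) (fun i => ?_)
  · simp [unipX_apply, unipY_apply]
  · fin_cases i <;> simp [unipX_apply, unipY_apply]
  · fin_cases i <;> simp [unipX_apply, unipY_apply]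

end Transitivity

/-! ### The orbit of type `(3, 1, 1, 1, 1)` -/

section ThreeOne

variable {K : Type u} [Field K]

theorem wedge_sq {N : ℕ} {a b : Fin N → K} (ha : a ⬝ᵥ a = 0) (hab : a ⬝ᵥ b = 0)
    (hb : b ⬝ᵥ b = 1) : wedge a b ^ 2 = -vecMulVec a a := by
  have hba : b ⬝ᵥ a = 0 := by rw [dotProduct_comm, hab]
  rw [pow_two]
  refine Matrix.toLin'.injective (LinearMap.ext fun w => ?_)
  simp only [Matrix.toLin'_mul, LinearMap.comp_apply, Matrix.toLin'_apply, wedge_mulVec,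
    dotProduct_sub, dotProduct_smul, ha, hab, hba, hb, Matrix.neg_mulVec, vecMulVec_mulVec]
  simp

theorem rank_vecMulVec_self {N : ℕ} {a : Fin N → K} (ha : a ≠ 0) : (vecMulVec a a).rank = 1 := by
  refine le_antisymm (Matrix.rank_vecMulVec_le _ _) (Nat.one_le_iff_ne_zero.2 fun h => ?_)
  obtain ⟨i, hi⟩ := Function.ne_iff.1 ha
  have := congrFun (congrFun (eq_zero_of_rank_eq_zero h) i) i
  simp [vecMulVec_apply] at this
  exact hi this

theorem rank_wedge {N : ℕ} {a b : Fin N → K} (h0 : a ≠ 0) (ha : a ⬝ᵥ a = 0) (hab : a ⬝ᵥ b = 0)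
    (hb : b ⬝ᵥ b = 1) : (wedge a b).rank = 2 := by
  have hba : b ⬝ᵥ a = 0 := by rw [dotProduct_comm, hab]
  refine le_antisymm ?_ ?_
  · classical
    have hle : LinearMap.range (wedge a b).mulVecLin ≤
        Submodule.span K (({b, a} : Finset (Fin N → K)) : Set (Fin N → K)) := by
      rintro _ ⟨w, rfl⟩
      rw [Matrix.mulVecLin_apply, wedge_mulVec]
      exact Submodule.sub_mem _ (Submodule.smul_mem _ _ (Submodule.subset_span (by simp)))
        (Submodule.smul_mem _ _ (Submodule.subset_span (by simp)))
    exact (Submodule.finrank_mono hle).trans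
      ((finrank_span_finset_le_card _).trans Finset.card_le_two)
  · have h := rank_sq_add_finrank_range_inf_ker (wedge a b)
    rw [wedge_sq ha hab hb, ← Matrix.neg_vecMulVec] at h
    have h1 : (vecMulVec (-a) a).rank = 1 := by
      have : vecMulVec (-a) a = (-1 : K) • vecMulVec a a := by rw [Matrix.neg_vecMulVec]; simp
      rw [this, Matrix.rank_smul_of_mem_nonZeroDivisors _
          (mem_nonZeroDivisors_of_ne_zero (by simp)),
        rank_vecMulVec_self h0]
    have h2 : 0 < Module.finrank K (LinearMap.range (wedge a b).mulVecLin ⊓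
        LinearMap.ker (wedge a b).mulVecLin : Submodule K (Fin N → K)) := by
      rw [Module.finrank_pos_iff_exists_ne_zero]
      refine ⟨⟨a, ⟨-b, ?_⟩, ?_⟩, fun h => h0 (congrArg Subtype.val h)⟩
      · simp [wedge_mulVec, hab, hb]
      · simp [wedge_mulVec, ha, hba]
    omega

theorem wedgeSo_mem_nilOrbit {a b : Fin 7 → K} (h0 : a ≠ 0) (ha : a ⬝ᵥ a = 0) (hab : a ⬝ᵥ b = 0)
    (hb : b ⬝ᵥ b = 1) : wedgeSo a b ∈ nilOrbit K 7 [3, 1, 1, 1, 1] := by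
  refine hasJordanType_three_two_one (a := 0) (s := 4) (wedge_cube ha hab) ?_
    (rank_wedge h0 ha hab hb) rfl
  rw [wedgeSo_coe, wedge_sq ha hab hb]
  have : -vecMulVec a a = (-1 : K) • vecMulVec a a := by simp
  rw [this, Matrix.rank_smul_of_mem_nonZeroDivisors _ (mem_nonZeroDivisors_of_ne_zero (by simp)),
    rank_vecMulVec_self h0]

theorem Ad_wedgeSo {N : ℕ} (g : SO K N) (a b : Fin N → K) :
    Ad g (wedgeSo a b) = wedgeSo (g.1 *ᵥ a) (g.1 *ᵥ b) :=
  Subtype.ext (mul_wedge_mul _ _ _)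

theorem SO_dotProduct {N : ℕ} (g : SO K N) (a b : Fin N → K) :
    (g.1 *ᵥ a) ⬝ᵥ (g.1 *ᵥ b) = a ⬝ᵥ b := by
  rw [Matrix.dotProduct_mulVec, ← Matrix.mulVec_transpose, Matrix.mulVec_mulVec, SO_transpose_mul,
    Matrix.one_mulVec]

theorem SO_mulVec_ne_zero {N : ℕ} (g : SO K N) {a : Fin N → K} (ha : a ≠ 0) : g.1 *ᵥ a ≠ 0 := by
  intro h
  refine ha ?_
  have := congrArg (g.1ᵀ *ᵥ ·) h
  simpa [Matrix.mulVec_mulVec, SO_transpose_mul] using this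

/-- A reference pair consisting of an isotropic vector and an orthogonal vector of norm one, in
general position with respect to the cross product. -/
theorem ofSplit_base [CharZero K] {I : K} (hI : I * I = -1) :
    ofSplit hI (0, ![1, 0, 0], 0) ≠ 0 ∧
    ofSplit hI (0, ![1, 0, 0], 0) ⬝ᵥ ofSplit hI (0, ![1, 0, 0], 0) = 0 ∧
    ofSplit hI (0, ![1, 0, 0], 0) ⬝ᵥ ofSplit hI (0, ![0, 1, 0], ![0, 4⁻¹, 0]) = 0 ∧
    ofSplit hI (0, ![0, 1, 0], ![0, 4⁻¹, 0]) ⬝ᵥ ofSplit hI (0, ![0, 1, 0], ![0, 4⁻¹, 0]) = 1 := by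
  refine ⟨fun h => ?_, ?_, ?_, ?_⟩
  · rw [LinearEquiv.map_eq_zero_iff] at h
    have := congrFun (congrArg (fun w => w.2.1) h) 0
    simp at this
  · rw [dotProduct_ofSplit]
    simp [splitForm]
  · rw [dotProduct_ofSplit]
    simp [splitForm]
  · rw [dotProduct_ofSplit]
    simp only [splitForm, vec3_dotProduct, Matrix.cons_val]
    norm_num

theorem neg_one_orthogonal : (-1 : Matrix (Fin 7) (Fin 7) K)ᵀ * (-1) = 1 := by simp

theorem det_neg_one : (-1 : Matrix (Fin 7) (Fin 7) K).det = -1 := by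
  rw [Matrix.det_neg]
  simp
  norm_num

/-- In `so_7` the centre `-1` of the orthogonal group has determinant `-1`, so each nilpotent class
of the orthogonal group is one orbit of `SO_7`. -/
theorem nilOrbit_seven_eq [CharZero K] [IsAlgClosed K] {μ : List ℕ} {x : soLie K 7}
    (hx : x ∈ nilOrbit K 7 μ) :
    nilOrbit K 7 μ = adOrbit ⊤ x :=
  nilOrbit_eq_adOrbit hx neg_one_orthogonal det_neg_one (by simp)

/-- The elements of type `(3, 1⁴)` are the bivectors `a ∧ b` with `a` isotropic and `b` a unit
vector orthogonal to `a`. -/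
theorem mem_nilOrbit_three_one_iff [CharZero K] [IsAlgClosed K] (e : soLie K 7) :
    e ∈ nilOrbit K 7 [3, 1, 1, 1, 1] ↔
      ∃ a b : Fin 7 → K, a ≠ 0 ∧ a ⬝ᵥ a = 0 ∧ a ⬝ᵥ b = 0 ∧ b ⬝ᵥ b = 1 ∧ e = wedgeSo a b := by
  constructor
  · intro he
    obtain ⟨I, hI⟩ := IsAlgClosed.exists_eq_mul_self (-1 : K)
    obtain ⟨h0, ha, hab, hb⟩ := ofSplit_base hI.symm
    rw [nilOrbit_seven_eq (wedgeSo_mem_nilOrbit h0 ha hab hb)] at he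
    obtain ⟨g, -, rfl⟩ := he
    rw [Ad_wedgeSo]
    exact ⟨_, _, SO_mulVec_ne_zero g h0, by rw [SO_dotProduct, ha], by rw [SO_dotProduct, hab],
      by rw [SO_dotProduct, hb], rfl⟩
  · rintro ⟨a, b, h0, ha, hab, hb, rfl⟩
    exact wedgeSo_mem_nilOrbit h0 ha hab hb

theorem isOrbit_nilOrbit_three_one [CharZero K] [IsAlgClosed K] :
    IsOrbit ⊤ (nilOrbit K 7 [3, 1, 1, 1, 1]) := by
  obtain ⟨I, hI⟩ := IsAlgClosed.exists_eq_mul_self (-1 : K)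
  obtain ⟨h0, ha, hab, hb⟩ := ofSplit_base hI.symm
  exact ⟨_, nilOrbit_seven_eq (wedgeSo_mem_nilOrbit h0 ha hab hb)⟩

/-- For `e = a ∧ b` one has `e² = -a aᵀ` and `e³ = 0`, and the two mixed terms of `(ad e)³ z`
cancel, both being multiples of `a aᵀ` by the same scalar. The square `(ad e)²` does not vanish on
bivectors `eᵢ ∧ w` with `w` in the kernel of `e` and not a multiple of `a`. -/
theorem height_two_wedgeSo [CharZero K] {N : ℕ} (hN : 4 ≤ N) {a b : Fin N → K} (h0 : a ≠ 0)
    (ha : a ⬝ᵥ a = 0)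
    (hab : a ⬝ᵥ b = 0) (hb : b ⬝ᵥ b = 1) :
    IsGreatest {d : ℕ | (LieAlgebra.ad K (soLie K N) (wedgeSo a b)) ^ d ≠ 0} 2 := by
  have hba : b ⬝ᵥ a = 0 := by rw [dotProduct_comm, hab]
  have h3 : (wedgeSo a b).1 ^ 3 = 0 := wedge_cube ha hab
  have h2 : (wedgeSo a b).1 ^ 2 = -vecMulVec a a := wedge_sq ha hab hb
  refine isGreatest_ad_pow ?_ ?_
  · ext1 z
    refine Subtype.ext ?_
    have hz := skew_dotProduct_self z a
    have hz' : b ⬝ᵥ (z.1 *ᵥ a) = -(a ⬝ᵥ (z.1 *ᵥ b)) := by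
      rw [dotProduct_comm, skew_dotProduct]
    -- both mixed terms are equal to `-(a, z b) a aᵀ`
    have h4 : vecMulVec a a * z.1 * wedge a b = (a ⬝ᵥ (z.1 *ᵥ b)) • vecMulVec a a := by
      rw [Matrix.mul_assoc, wedge, Matrix.mul_sub, Matrix.mul_sub]
      simp only [mul_vecMulVec, vecMulVec_mulVec, hz]
      simp [smul_vecMulVec]
    have h5 : wedge a b * z.1 * vecMulVec a a = (a ⬝ᵥ (z.1 *ᵥ b)) • vecMulVec a a := by
      rw [Matrix.mul_assoc, wedge, Matrix.sub_mul]
      simp only [mul_vecMulVec, vecMulVec_mulVec, hz, hz']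
      simp [smul_vecMulVec]
    rw [ad_pow_three_coe, h3, h2, wedgeSo_coe]
    simp only [Matrix.neg_mul, Matrix.mul_neg, h4, h5]
    simp
  · obtain ⟨i, hi⟩ := Function.ne_iff.1 h0
    have hi' : a i ≠ 0 := hi
    have hw : ∃ w, (wedge a b) *ᵥ w = 0 ∧ ∀ c : K, w ≠ c • a := by
      by_contra! h
      have hle : LinearMap.ker (wedge a b).mulVecLin ≤ Submodule.span K {a} := fun w hw => by
        obtain ⟨c, rfl⟩ := h w hw
        exact Submodule.smul_mem _ _ (Submodule.mem_span_singleton_self a)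
      have h4 := Submodule.finrank_mono hle
      rw [finrank_span_singleton h0] at h4
      have h5 := rank_add_finrank_ker (wedge a b)
      rw [rank_wedge h0 ha hab hb] at h5
      omega
    obtain ⟨w, hw, hwa⟩ := hw
    refine ⟨wedgeSo (Pi.single i 1) w, fun h => ?_⟩
    have h1 := congrArg Subtype.val h
    rw [ad_pow_two_coe, h2] at h1
    have h4 : (wedgeSo a b).1 * (wedgeSo (Pi.single i 1) w).1 * (wedgeSo a b).1 = 0 := by
      have : (wedgeSo a b).1 * (wedgeSo (Pi.single i 1) w).1 * (wedgeSo a b).1 =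
          -wedge ((wedgeSo a b).1 *ᵥ Pi.single i 1) ((wedgeSo a b).1 *ᵥ w) := by
        rw [← mul_wedge_mul, soLie_transpose, Matrix.mul_neg, neg_neg]; rfl
      rw [this, wedgeSo_coe a b, hw]
      simp [wedge]
    have h6 : a ⬝ᵥ w = 0 := by
      have h7 := congrArg (b ⬝ᵥ ·) hw
      simpa [wedge_mulVec, hb, hba] using h7
    rw [h4] at h1
    refine wedge_ne_zero h0 hwa ?_
    have h8 : a i • wedge a w = 0 := by
      rw [← neg_eq_zero]
      refine Eq.trans ?_ h1
      rw [wedgeSo_coe, wedge, wedge]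
      simp only [Matrix.mul_sub, Matrix.sub_mul, Matrix.neg_mul, Matrix.mul_neg,
        vecMulVec_mul_vecMulVec, h6, dotProduct_comm w a, dotProduct_single, single_dotProduct]
      simp [vecMulVec_smul, sub_eq_add_neg]
    exact (smul_eq_zero.1 h8).resolve_left hi'

theorem hasHeight_nilOrbit_three_one [CharZero K] [IsAlgClosed K] :
    HasHeight (nilOrbit K 7 [3, 1, 1, 1, 1]) 2 := by
  refine ⟨?_, fun e he => ?_⟩
  · obtain ⟨x, hx⟩ := isOrbit_nilOrbit_three_one (K := K)
    exact ⟨x, hx ▸ mem_adOrbit_self ⊤ x⟩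
  · obtain ⟨a, b, h0, ha, hab, hb, rfl⟩ := (mem_nilOrbit_three_one_iff e).1 he
    exact height_two_wedgeSo (by norm_num) h0 ha hab hb

/-- The Plücker relations hold on the closure of a set of decomposable bivectors. -/
theorem plucker_of_mem_zariskiClosure {N : ℕ} {S : Set (soLie K N)}
    (hS : ∀ e ∈ S, ∃ a b, e = wedgeSo a b) {y : soLie K N} (hy : y ∈ zariskiClosure K S)
    (i j k l : Fin N) : y.1 i j * y.1 k l - y.1 i k * y.1 j l + y.1 i l * y.1 j k = 0 := by
  refine hy (entryFun K i j * entryFun K k l - entryFun K i k * entryFun K j l +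
    entryFun K i l * entryFun K j k) ?_ fun e he => ?_
  · exact Subalgebra.add_mem _ (Subalgebra.sub_mem _
      (Subalgebra.mul_mem _ (entryFun_mem _ _) (entryFun_mem _ _))
      (Subalgebra.mul_mem _ (entryFun_mem _ _) (entryFun_mem _ _)))
      (Subalgebra.mul_mem _ (entryFun_mem _ _) (entryFun_mem _ _))
  · obtain ⟨a, b, rfl⟩ := hS e he
    simp only [Pi.add_apply, Pi.sub_apply, Pi.mul_apply, entryFun, wedgeSo_coe, wedge_apply]
    ring

/-- The elements of the complement are the cross products with a vector `c`. Those in the closure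
satisfy the Plücker relations, which force `c = 0`. -/
theorem isGood_g2 [CharZero K] [IsAlgClosed K] : IsGood (g2 K) (nilOrbit K 7 [3, 1, 1, 1, 1]) := by
  refine Set.Subset.antisymm ?_ ?_
  · rintro y ⟨hy, hm⟩
    obtain ⟨c, rfl⟩ := eq_crossSo_of_mem_isotropy hm
    have hp := plucker_of_mem_zariskiClosure (fun e he => by
      obtain ⟨a, b, -, -, -, -, h⟩ := (mem_nilOrbit_three_one_iff e).1 he
      exact ⟨a, b, h⟩) hy
    -- the relation for the complement of a line says that the squares of the coordinates of `c` on
    -- this line sum to zero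
    have h0 := hp 2 4 5 6
    have h1 := hp 3 5 6 0
    have h2 := hp 4 6 0 1
    have h3 := hp 5 0 1 2
    have h4 := hp 6 1 2 3
    have h5 := hp 0 2 3 4
    have h6 := hp 1 3 4 5
    simp only [crossSo, crossMat, Matrix.of_apply, Matrix.cons_val] at h0 h1 h2 h3 h4 h5 h6
    have hc : c = 0 := by
      funext i
      refine pow_eq_zero_iff (two_ne_zero) |>.1 ?_
      fin_cases i <;>
        simp only [Fin.zero_eta, Fin.mk_one, Fin.reduceFinMk, Fin.isValue]
      · linear_combination (1 / 2) * (h0 + h6 + h4) - (1 / 6) * (h0 + h1 + h2 + h3 + h4 + h5 + h6)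
      · linear_combination (1 / 2) * (h1 + h0 + h5) - (1 / 6) * (h0 + h1 + h2 + h3 + h4 + h5 + h6)
      · linear_combination (1 / 2) * (h2 + h1 + h6) - (1 / 6) * (h0 + h1 + h2 + h3 + h4 + h5 + h6)
      · linear_combination (1 / 2) * (h3 + h2 + h0) - (1 / 6) * (h0 + h1 + h2 + h3 + h4 + h5 + h6)
      · linear_combination (1 / 2) * (h4 + h3 + h1) - (1 / 6) * (h0 + h1 + h2 + h3 + h4 + h5 + h6)
      · linear_combination (1 / 2) * (h5 + h4 + h2) - (1 / 6) * (h0 + h1 + h2 + h3 + h4 + h5 + h6)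
      · linear_combination (1 / 2) * (h6 + h5 + h3) - (1 / 6) * (h0 + h1 + h2 + h3 + h4 + h5 + h6)
    subst hc
    refine Subtype.ext ?_
    change crossMat 0 = 0
    ext i j
    fin_cases i <;> fin_cases j <;> simp [crossMat]
  · rintro _ rfl
    refine ⟨?_, Submodule.zero_mem _⟩
    obtain ⟨x, hx⟩ := isOrbit_nilOrbit_three_one (K := K)
    have hx' : x ∈ nilOrbit K 7 [3, 1, 1, 1, 1] := hx ▸ mem_adOrbit_self ⊤ x
    obtain ⟨a, b, h0, ha, hab, hb, rfl⟩ := (mem_nilOrbit_three_one_iff x).1 hx'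
    refine zero_mem_zariskiClosure (e := wedgeSo a b) fun t ht => ?_
    rw [mem_nilOrbit_three_one_iff]
    refine ⟨t • a, b, smul_ne_zero ht h0, by simp [ha], by simp [hab], hb, Subtype.ext ?_⟩
    change t • wedge a b = wedge (t • a) b
    simp [wedge, smul_sub, vecMulVec_smul, smul_vecMulVec]

end ThreeOne

section OpenOrbit

variable {K : Type u} [Field K]

/-- The reference point of the open `G₂`-orbit in `𝒪(3, 1, 1, 1, 1)`. -/
noncomputable def basePoint [CharZero K] {I : K} (hI : I * I = -1) : soLie K 7 :=
  wedgeSo (ofSplit hI (0, ![1, 0, 0], 0)) (ofSplit hI (0, ![0, 1, 0], ![0, 4⁻¹, 0]))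

theorem wedgeSo_add_smul {N : ℕ} (a b : Fin N → K) (c : K) :
    wedgeSo a (b + c • a) = wedgeSo a b := by
  refine Subtype.ext ?_
  ext i j
  simp only [wedgeSo_coe, wedge_apply, Pi.add_apply, Pi.smul_apply, smul_eq_mul]
  ring

theorem wedgeSo_ofSplit_mem [CharZero K] {I : K} (hI : I * I = -1) {s : K} {x y : Fin 3 → K}
    (hy : y 0 = 0)
    (hb : splitForm (s, x, y) (s, x, y) = 1) (hx : x 1 ≠ 0 ∨ x 2 ≠ 0) :
    wedgeSo (ofSplit hI (0, ![1, 0, 0], 0)) (ofSplit hI (s, x, y)) ∈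
      adOrbit (G2 K) (basePoint hI) := by
  obtain ⟨g, hg, c, h1, h2⟩ := exists_conj_of_generic hI hy hb hx
  have h3 : ofSplit hI (0, ![c, 1, 0], ![0, 4⁻¹, 0]) =
      ofSplit hI (0, ![0, 1, 0], ![0, 4⁻¹, 0]) + c • ofSplit hI (0, ![1, 0, 0], 0) := by
    rw [← map_smul, ← map_add]
    congr 1
    refine split_ext (by simp) (fun i => ?_) (fun i => ?_) <;> fin_cases i <;> simp
  refine ⟨g⁻¹, (G2 K).inv_mem hg, ?_⟩
  have h4 : basePoint hI = Ad g (wedgeSo (ofSplit hI (0, ![1, 0, 0], 0))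
      (ofSplit hI (s, x, y))) := by
    rw [Ad_wedgeSo, h1, h2, h3, wedgeSo_add_smul, basePoint]
  rw [h4, Ad_inv_Ad]

/-- Up to `G₂`, an element `a ∧ b` of `𝒪(3, 1, 1, 1, 1)` has the standard isotropic vector as its
first factor. -/
theorem exists_conj_first [CharZero K] {I : K} (hI : I * I = -1) {a b : Fin 7 → K} (h0 : a ≠ 0)
    (ha : a ⬝ᵥ a = 0) (hab : a ⬝ᵥ b = 0) :
    ∃ g ∈ G2 K, ∃ (s : K) (x y : Fin 3 → K), g.1 *ᵥ a = ofSplit hI (0, ![1, 0, 0], 0) ∧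
      g.1 *ᵥ b = ofSplit hI (s, x, y) ∧ y 0 = 0 ∧ splitForm (s, x, y) (s, x, y) = b ⬝ᵥ b := by
  obtain ⟨w, rfl⟩ := (ofSplit hI).surjective a
  rw [dotProduct_ofSplit] at ha
  obtain ⟨g, hg, h⟩ := splitConj_isotropic hI (w := w) (by rintro rfl; simp at h0) ha
  obtain ⟨⟨s, x, y⟩, hw⟩ := (ofSplit hI).surjective (g.1 *ᵥ b)
  refine ⟨g, hg, s, x, y, h, hw.symm, ?_, ?_⟩
  · rw [← SO_dotProduct g, h, ← hw, dotProduct_ofSplit] at hab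
    simpa [splitForm, Matrix.vecHead] using hab
  · rw [← dotProduct_ofSplit hI, hw, SO_dotProduct]

/-- The vectors `a`, `b` are in special position: `a × b` is a multiple of `a`. -/
def IsSpecialPair (a b : Fin 7 → K) : Prop := ∃ c : K, cross7 a b = c • a

theorem IsSpecialPair.of_G2 {g : SO K 7} (hg : g ∈ G2 K) {a b : Fin 7 → K}
    (h : IsSpecialPair (g.1 *ᵥ a) (g.1 *ᵥ b)) : IsSpecialPair a b := by
  obtain ⟨c, hc⟩ := h
  refine ⟨c, ?_⟩
  rw [← hg a b, ← Matrix.mulVec_smul] at hc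
  have := congrArg (g.1ᵀ *ᵥ ·) hc
  simpa only [Matrix.mulVec_mulVec, SO_transpose_mul, Matrix.one_mulVec] using this

theorem cross7_ofSplit_base [CharZero K] {I : K} (hI : I * I = -1) (s : K) (x y : Fin 3 → K) :
    cross7 (ofSplit hI (0, ![1, 0, 0], 0)) (ofSplit hI (s, x, y)) =
      ofSplit hI (2 * y 0, ![s, 0, 0], ![0, -2 * x 2, 2 * x 1]) := by
  rw [cross7_ofSplit]
  congr 1
  refine split_ext ?_ (fun i => ?_) (fun i => ?_)
  · simp [splitCross, Matrix.vecHead]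
  · fin_cases i <;> simp [splitCross, cross_apply]
  · fin_cases i <;> simp [splitCross, cross_apply]

theorem isSpecialPair_of_eq_zero [CharZero K] {I : K} (hI : I * I = -1) {s : K} {x y : Fin 3 → K}
    (hy : y 0 = 0)
    (h1 : x 1 = 0) (h2 : x 2 = 0) :
    IsSpecialPair (ofSplit hI (0, ![1, 0, 0], 0)) (ofSplit hI (s, x, y)) := by
  refine ⟨s, ?_⟩
  rw [cross7_ofSplit_base, hy, h1, h2, ← map_smul]
  congr 1
  refine split_ext (by simp) (fun i => ?_) (fun i => ?_) <;> fin_cases i <;> simp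

theorem not_isSpecialPair_base [CharZero K] {I : K} (hI : I * I = -1) :
    ¬IsSpecialPair (ofSplit hI (0, ![1, 0, 0], 0)) (ofSplit hI (0, ![0, 1, 0], ![0, 4⁻¹, 0])) := by
  rintro ⟨c, hc⟩
  rw [cross7_ofSplit_base, ← map_smul] at hc
  have := congrFun (congrArg (fun w => w.2.2) ((ofSplit hI).injective hc)) 2
  simp at this

theorem mem_openOrbit_of_not_isSpecialPair [CharZero K] {I : K} (hI : I * I = -1) {a b : Fin 7 → K}
    (h0 : a ≠ 0)
    (ha : a ⬝ᵥ a = 0) (hab : a ⬝ᵥ b = 0) (hb : b ⬝ᵥ b = 1) (h : ¬IsSpecialPair a b) :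
    wedgeSo a b ∈ adOrbit (G2 K) (basePoint hI) := by
  obtain ⟨g, hg, s, x, y, h1, h2, hy, hf⟩ := exists_conj_first hI h0 ha hab
  rw [hb] at hf
  have hx : x 1 ≠ 0 ∨ x 2 ≠ 0 := by
    by_contra! hx
    refine h (IsSpecialPair.of_G2 hg ?_)
    rw [h1, h2]
    exact isSpecialPair_of_eq_zero hI hy hx.1 hx.2
  have := Ad_mem_adOrbit ((G2 K).inv_mem hg) (wedgeSo_ofSplit_mem hI hy hf hx)
  rwa [← h1, ← h2, ← Ad_wedgeSo, Ad_inv_Ad] at this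

/-- The closed condition on `𝒪(3, 1, 1, 1, 1)` which expresses that `a × b` is a multiple of `a`. -/
def IsSpecial (e : soLie K 7) : Prop :=
  ∀ i j k, defect e.1 i * (e.1 ^ 2) j k = defect e.1 j * (e.1 ^ 2) i k

theorem isSpecial_wedgeSo_iff {a b : Fin 7 → K} (h0 : a ≠ 0)
    (ha : a ⬝ᵥ a = 0) (hab : a ⬝ᵥ b = 0) (hb : b ⬝ᵥ b = 1) :
    IsSpecial (wedgeSo a b) ↔ IsSpecialPair a b := by
  have h2 : (wedgeSo a b).1 ^ 2 = -vecMulVec a a := wedge_sq ha hab hb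
  have h1 : defect (wedgeSo a b).1 = -cross7 a b := defect_wedge a b
  rw [IsSpecial, h1, h2]
  simp only [Pi.neg_apply, Matrix.neg_apply, vecMulVec_apply, neg_mul_neg]
  constructor
  · intro h
    obtain ⟨k, hk⟩ := Function.ne_iff.1 h0
    have hk' : a k ≠ 0 := hk
    refine ⟨cross7 a b k / a k, funext fun i => ?_⟩
    have := h i k k
    simp only [Pi.smul_apply, smul_eq_mul]
    field_simp
    exact mul_right_cancel₀ hk' (by linear_combination this)
  · rintro ⟨c, hc⟩ i j k
    rw [hc]
    simp only [Pi.smul_apply, smul_eq_mul]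
    ring

theorem defect_entry_mem (i : Fin 7) :
    (fun e : soLie K 7 => defect e.1 i) ∈ polyFun K (soLie K 7) :=
  Subalgebra.add_mem _ (Subalgebra.add_mem _ (entryFun_mem _ _) (entryFun_mem _ _))
    (entryFun_mem _ _)

theorem zariskiClosure_isSpecial [CharZero K] :
    zariskiClosure K {e : soLie K 7 | IsSpecial e} ⊆ {e | IsSpecial e} := by
  intro y hy i j k
  refine sub_eq_zero.1 (hy ((fun e => defect e.1 i) * (fun e => (e.1 ^ 2) j k) -
    (fun e => defect e.1 j) * (fun e => (e.1 ^ 2) i k)) ?_ fun e he => ?_)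
  · exact Subalgebra.sub_mem _ (Subalgebra.mul_mem _ (defect_entry_mem i) (sq_entry_mem j k))
      (Subalgebra.mul_mem _ (defect_entry_mem j) (sq_entry_mem i k))
  · exact sub_eq_zero.2 (he i j k)

variable [IsAlgClosed K]

/-- The bivectors `a ∧ b` for which `a × b` is not a multiple of `a` form one orbit, and the other
ones lie on a line that leaves the special locus. -/
theorem isDenseOrbit_openOrbit [CharZero K] {I : K} (hI : I * I = -1) :
    IsDenseOrbit (G2 K) (adOrbit (G2 K) (basePoint hI)) (nilOrbit K 7 [3, 1, 1, 1, 1]) := by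
  obtain ⟨h0, ha, hab, hb⟩ := ofSplit_base hI
  refine ⟨⟨_, rfl⟩, ?_, ?_⟩
  · rintro _ ⟨g, -, rfl⟩
    exact Ad_mem_nilOrbit g (wedgeSo_mem_nilOrbit h0 ha hab hb)
  · intro e he
    obtain ⟨a, b, h0, ha, hab, hb, rfl⟩ := (mem_nilOrbit_three_one_iff e).1 he
    obtain ⟨g, hg, s, x, y, h1, h2, hy, hf⟩ := exists_conj_first hI h0 ha hab
    rw [hb] at hf
    refine mem_zariskiClosure_of_Ad g (fun x hx => Ad_mem_adOrbit ((G2 K).inv_mem hg) hx) ?_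
    rw [Ad_wedgeSo, h1, h2]
    by_cases hx : x 1 ≠ 0 ∨ x 2 ≠ 0
    · exact subset_zariskiClosure _ (wedgeSo_ofSplit_mem hI hy hf hx)
    · push Not at hx
      obtain ⟨hx1, hx2⟩ := hx
      have hs : s * s = -1 := by
        simp only [splitForm, vec3_dotProduct, hy, hx1, hx2] at hf
        linear_combination -hf
      have hs0 : s ≠ 0 := by
        rintro rfl
        simp at hs
      -- an isotropic vector orthogonal to `a` and `b` in general position to `a`
      set r : K := -2 * s * y 1 with hr
      have hmem : ∀ t : K, t ≠ 0 → wedgeSo (ofSplit hI (0, ![1, 0, 0], 0))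
          (ofSplit hI (s + t * r, ![x 0, t, 0], ![0, y 1 + t * (r ^ 2 / 4), y 2])) ∈
          adOrbit (G2 K) (basePoint hI) := by
        intro t ht
        refine wedgeSo_ofSplit_mem hI (by simp) ?_ (by simp [ht])
        simp only [splitForm, vec3_dotProduct, Matrix.cons_val, hr]
        linear_combination (-1 + 4 * t * y 1) * hs
      have hγ : ∀ t : K, (wedgeSo (ofSplit hI (0, ![1, 0, 0], 0))
          (ofSplit hI (s + t * r, ![x 0, t, 0], ![0, y 1 + t * (r ^ 2 / 4), y 2]))).1 =
          (wedgeSo (ofSplit hI (0, ![1, 0, 0], 0)) (ofSplit hI (s, x, y))).1 +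
          (Polynomial.X : Polynomial K).eval t • (wedgeSo (ofSplit hI (0, ![1, 0, 0], 0))
            (ofSplit hI (r, ![0, 1, 0], ![0, r ^ 2 / 4, 0]))).1 := by
        intro t
        have : ofSplit hI (s + t * r, ![x 0, t, 0], ![0, y 1 + t * (r ^ 2 / 4), y 2]) =
            ofSplit hI (s, x, y) + t • ofSplit hI (r, ![0, 1, 0], ![0, r ^ 2 / 4, 0]) := by
          rw [← map_smul, ← map_add]
          congr 1
          refine split_ext (by simp) (fun i => ?_) (fun i => ?_) <;> fin_cases i <;>
            simp [hx1, hx2, hy, Matrix.vecHead, Matrix.vecTail]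
        rw [this, Polynomial.eval_X, wedgeSo_coe, wedgeSo_coe, wedgeSo_coe]
        ext i j
        simp only [wedge_apply, Pi.add_apply, Pi.smul_apply, smul_eq_mul, Matrix.add_apply,
          Matrix.smul_apply]
        ring
      have h3 := mem_zariskiClosure_of_curve (S := adOrbit (G2 K) (basePoint hI))
        (γ := fun t : K => wedgeSo (ofSplit hI (0, ![1, 0, 0], 0))
          (ofSplit hI (s + t * r, ![x 0, t, 0], ![0, y 1 + t * (r ^ 2 / 4), y 2])))
        (F := Polynomial.X)
        (by
          simp only [hγ]
          exact (IsPolyCurve.const _).add ((IsPolyCurve.const _).smul _))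
        Polynomial.X_ne_zero (fun t ht => hmem t (by simpa using ht)) 0
      have h4 : ((s + 0 * r, ![x 0, 0, 0], ![0, y 1 + 0 * (r ^ 2 / 4), y 2]) : Split K) =
          (s, x, y) := by
        refine split_ext (by simp) (fun i => ?_) (fun i => ?_) <;> fin_cases i <;>
          simp [hx1, hx2, hy]
      rwa [h4] at h3

theorem eq_openOrbit_of_isDenseOrbit [CharZero K] {I : K} (hI : I * I = -1) {Ω : Set (soLie K 7)}
    (hΩ : IsDenseOrbit (G2 K) Ω (nilOrbit K 7 [3, 1, 1, 1, 1])) :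
    Ω = adOrbit (G2 K) (basePoint hI) := by
  refine IsDenseOrbit.unique (isDenseOrbit_openOrbit hI) (P := IsSpecial) (fun e he => ?_)
    zariskiClosure_isSpecial hΩ
  constructor
  · rintro ⟨g, hg, rfl⟩ h
    obtain ⟨h0, ha, hab, hb⟩ := ofSplit_base hI
    rw [basePoint, Ad_wedgeSo, isSpecial_wedgeSo_iff (SO_mulVec_ne_zero g h0)
      (by rw [SO_dotProduct, ha]) (by rw [SO_dotProduct, hab]) (by rw [SO_dotProduct, hb])] at h
    exact not_isSpecialPair_base hI (IsSpecialPair.of_G2 hg h)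
  · intro h
    obtain ⟨a, b, h0, ha, hab, hb, rfl⟩ := (mem_nilOrbit_three_one_iff e).1 he
    rw [isSpecial_wedgeSo_iff h0 ha hab hb] at h
    exact mem_openOrbit_of_not_isSpecialPair hI h0 ha hab hb h

end OpenOrbit

/-! ### Nilpotent elements of the Lie algebra of `G₂` -/

section Equivariance

variable {K : Type u} [Field K]

theorem Ad_crossSo {g : SO K 7} (hg : g ∈ G2 K) (c : Fin 7 → K) :
    Ad g (crossSo c) = crossSo (g.1 *ᵥ c) := by
  rw [Ad_eq_iff]
  refine Matrix.toLin'.injective (LinearMap.ext fun w => ?_)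
  simp only [Matrix.toLin'_apply, ← Matrix.mulVec_mulVec]
  change crossMat _ *ᵥ _ = g.1 *ᵥ (crossMat _ *ᵥ _)
  rw [crossMat_mulVec, crossMat_mulVec, hg]

theorem g2Part_wedgeSo (a b : Fin 7 → K) :
    g2Part (wedgeSo a b) = wedgeSo a b - (3 : K)⁻¹ • crossSo (cross7 a b) := by
  have h : crossSo (-cross7 a b) = -crossSo (cross7 a b) := by
    refine Subtype.ext (Matrix.toLin'.injective (LinearMap.ext fun w => ?_))
    simp only [Matrix.toLin'_apply]
    change crossMat _ *ᵥ w = (-crossMat _) *ᵥ w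
    rw [Matrix.neg_mulVec, crossMat_mulVec, crossMat_mulVec, ← neg_one_smul K, cross7_smul_left]
    simp
  rw [g2Part, wedgeSo_coe, defect_wedge, h, smul_neg, sub_eq_add_neg]

theorem g2Part_wedgeSo_mulVec [CharZero K] (a b w : Fin 7 → K) : (g2Part (wedgeSo a b)).1 *ᵥ w =
    (a ⬝ᵥ w) • b - (b ⬝ᵥ w) • a - (3 : K)⁻¹ • cross7 (cross7 a b) w := by
  rw [g2Part_wedgeSo]
  change (wedge a b - (3 : K)⁻¹ • crossMat (cross7 a b)) *ᵥ w = _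
  rw [Matrix.sub_mulVec, Matrix.smul_mulVec, wedge_mulVec, crossMat_mulVec]

theorem Ad_sub_smul {N : ℕ} (g : SO K N) (x y : soLie K N) (c : K) :
    Ad g (x - c • y) = Ad g x - c • Ad g y := by
  have := map_sub (AdLin g) x (c • y)
  rwa [map_smul] at this

/-- The projection to `𝔤₂` is `G₂`-equivariant. -/
theorem Ad_g2Part_wedgeSo [CharZero K] {g : SO K 7} (hg : g ∈ G2 K) (a b : Fin 7 → K) :
    Ad g (g2Part (wedgeSo a b)) = g2Part (wedgeSo (g.1 *ᵥ a) (g.1 *ᵥ b)) := by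
  rw [g2Part_wedgeSo, g2Part_wedgeSo, Ad_sub_smul, Ad_wedgeSo, Ad_crossSo hg, hg]

theorem Ad_mem_g2 {g : SO K 7} (hg : g ∈ G2 K) {D : soLie K 7} (hD : D ∈ g2 K) : Ad g D ∈ g2 K := by
  intro x y
  have h : ∀ v, (Ad g D).1 *ᵥ (g.1 *ᵥ v) = g.1 *ᵥ (D.1 *ᵥ v) := fun v => by
    have h1 := (Ad_eq_iff g D _).1 rfl
    rw [Matrix.mulVec_mulVec, h1, Matrix.mulVec_mulVec]
  have hs : ∀ v, g.1 *ᵥ (g.1ᵀ *ᵥ v) = v := fun v => by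
    rw [Matrix.mulVec_mulVec, SO_mul_transpose, Matrix.one_mulVec]
  rw [← hs x, ← hs y, ← hg, h, h, h, hD, Matrix.mulVec_add, hg, hg]

theorem Ad_pow_eq_zero {N : ℕ} (g : SO K N) {x : soLie K N} {k : ℕ} (hk : x.1 ^ k = 0) :
    (Ad g x).1 ^ k = 0 := by
  have h : ∀ j, (Ad g x).1 ^ j = g.1 * x.1 ^ j * g.1ᵀ := by
    intro j
    induction j with
    | zero => simp [SO_mul_transpose]
    | succ j ih =>
      rw [pow_succ, ih, Ad_coe, pow_succ]
      simp only [← Matrix.mul_assoc]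
      rw [Matrix.mul_assoc (g.1 * x.1 ^ j) g.1ᵀ g.1, SO_transpose_mul, Matrix.mul_one]
  rw [h, hk, Matrix.mul_zero, Matrix.zero_mul]

theorem isNilpotent_Ad [CharZero K] {N : ℕ} (g : SO K N) {x : soLie K N} (hx : IsNilpotent x.1) :
    IsNilpotent (Ad g x).1 := by
  obtain ⟨k, hk⟩ := hx
  exact ⟨k, Ad_pow_eq_zero g hk⟩

end Equivariance

section Split

variable {K : Type u} [Field K]

/-- The derivation of the split octonions with components `A ∈ sl₃`, `u ∈ K³` and `v ∈ (K³)^*`. -/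
def splitDer (A : Matrix (Fin 3) (Fin 3) K) (u v : Fin 3 → K) (w : Split K) : Split K :=
  (2 * (u ⬝ᵥ w.2.2) - 2 * (v ⬝ᵥ w.2.1), A *ᵥ w.2.1 + w.1 • u - crossProduct v w.2.2,
    -(Aᵀ *ᵥ w.2.2) - w.1 • v - crossProduct u w.2.1)

variable [CharZero K] {I : K} (hI : I * I = -1)

/-- Every derivation is of the form `splitDer A u v` with `A` of trace zero. -/
theorem exists_splitDer {D : soLie K 7} (hD : D ∈ g2 K) :
    ∃ (A : Matrix (Fin 3) (Fin 3) K) (u v : Fin 3 → K), A 0 0 + A 1 1 + A 2 2 = 0 ∧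
      ∀ w, D.1 *ᵥ ofSplit hI w = ofSplit hI (splitDer A u v w) := by
  let T : Split K →ₗ[K] Split K :=
    (ofSplit hI).symm.toLinearMap ∘ₗ D.1.mulVecLin ∘ₗ (ofSplit hI).toLinearMap
  have hT : ∀ w, D.1 *ᵥ ofSplit hI w = ofSplit hI (T w) := fun w => by simp [T]
  have hf : ∀ w w', splitForm (T w) w' = -splitForm w (T w') := fun w w' => by
    rw [← dotProduct_ofSplit hI, ← dotProduct_ofSplit hI, ← hT, ← hT, skew_dotProduct]
  have hc : ∀ w w', T (splitCross w w') = splitCross (T w) w' + splitCross w (T w') :=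
    fun w w' => by
    apply (ofSplit hI).injective
    rw [map_add, ← cross7_ofSplit, ← cross7_ofSplit, ← hT, ← cross7_ofSplit, hD, hT, hT]
  have hz1 : (T (1, 0, 0)).1 = 0 := by
    have := hf (1, 0, 0) (1, 0, 0)
    simp [splitForm] at this
    linear_combination -(1 / 2) * this
  set u := (T (1, 0, 0)).2.1 with hu
  set v := -(T (1, 0, 0)).2.2 with hv
  have hz : T (1, 0, 0) = (0, u, -v) := Prod.ext hz1 (Prod.ext rfl (by simp [hv]))
  have hx : ∀ x, (T (0, x, 0)).1 = -(2 * (v ⬝ᵥ x)) ∧ (T (0, x, 0)).2.2 = -crossProduct u x := by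
    intro x
    have h1 := hc (1, 0, 0) (0, x, 0)
    have h2 : splitCross (1, 0, 0) ((0, x, 0) : Split K) = -(0, x, 0) := by
      simp [splitCross]
    rw [h2, map_neg, hz] at h1
    constructor
    · have h3 := congrArg Prod.fst h1
      simp [splitCross] at h3
      linear_combination -h3
    · have h3 := congrArg (fun w => w.2.2) h1
      simp only [splitCross, Prod.snd_neg, Prod.snd_add] at h3
      simp at h3
      have h4 : (2 : K) • (T (0, x, 0)).2.2 = (2 : K) • -crossProduct u x := by
        rw [smul_neg, two_smul]
        nth_rewrite 1 [← neg_neg (T (0, x, 0)).2.2]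
        rw [h3]
        abel
      exact smul_right_injective _ two_ne_zero h4
  have hy : ∀ y, (T (0, 0, y)).1 = 2 * (u ⬝ᵥ y) ∧ (T (0, 0, y)).2.1 = -crossProduct v y := by
    intro y
    have h1 := hc (1, 0, 0) (0, 0, y)
    have h2 : splitCross (1, 0, 0) ((0, 0, y) : Split K) = (0, 0, y) := by
      simp [splitCross]
    rw [h2, hz] at h1
    constructor
    · have h3 := congrArg Prod.fst h1
      simp [splitCross] at h3
      exact h3
    · have h3 := congrArg (fun w => w.2.1) h1
      simp only [splitCross, Prod.snd_add, Prod.fst_add] at h3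
      simp [-cross_anticomm] at h3
      have h4 : (2 : K) • (T (0, 0, y)).2.1 = (2 : K) • -crossProduct v y := by
        rw [smul_neg, two_smul]
        nth_rewrite 1 [h3]
        abel
      exact smul_right_injective _ two_ne_zero h4
  let A : Matrix (Fin 3) (Fin 3) K := LinearMap.toMatrix'
    (LinearMap.fst K _ _ ∘ₗ LinearMap.snd K _ _ ∘ₗ T ∘ₗ LinearMap.inr K K _ ∘ₗ LinearMap.inl K _ _)
  have hA : ∀ x, A *ᵥ x = (T (0, x, 0)).2.1 := fun x => by
    rw [LinearMap.toMatrix'_mulVec]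
    rfl
  have hAt : ∀ y, (T (0, 0, y)).2.2 = -(Aᵀ *ᵥ y) := fun y => by
    refine dotProduct_eq _ _ fun x => ?_
    have h1 := hf (0, x, 0) (0, 0, y)
    simp only [splitForm] at h1
    simp only [dotProduct_zero, zero_dotProduct, mul_zero, zero_mul, neg_zero, zero_add,
      add_zero] at h1
    rw [neg_dotProduct, Matrix.mulVec_transpose, ← Matrix.dotProduct_mulVec, hA,
      dotProduct_comm _ x, dotProduct_comm y]
    linear_combination h1 / 2
  refine ⟨A, u, v, ?_, fun w => ?_⟩
  · have h1 := congrFun (congrArg (fun w => w.2.2) (hc (0, ![1, 0, 0], 0) (0, ![0, 1, 0], 0))) 2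
    have h2 : splitCross (0, ![1, 0, 0], 0) ((0, ![0, 1, 0], 0) : Split K) =
        (2 : K) • (0, 0, ![0, 0, 1]) := by
      refine split_ext (by simp [splitCross]) (fun i => ?_) (fun i => ?_) <;> fin_cases i <;>
        simp [splitCross, cross_apply]
    rw [h2, map_smul] at h1
    simp only [Prod.snd_add, Prod.smul_snd, Pi.smul_apply, Pi.add_apply, hAt, splitCross,
      cross_apply, ← hA] at h1
    simp [Matrix.mulVec, Matrix.vecHead, Matrix.vecTail] at h1
    linear_combination -h1 / 2
  · rw [hT]
    congr 1
    obtain ⟨s, x, y⟩ := w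
    have h1 : ((s, x, y) : Split K) = s • (1, 0, 0) + (0, x, 0) + (0, 0, y) := by simp
    have h2 : T (s, x, y) = s • T (1, 0, 0) + T (0, x, 0) + T (0, 0, y) := by
      rw [h1, map_add, map_add, map_smul]
    rw [h2, hz]
    refine split_ext ?_ (fun i => ?_) (fun i => ?_)
    · simp [splitDer, hx, hy]
      ring
    · simp [splitDer, hy, hA, -cross_anticomm]
      ring
    · simp [splitDer, hx, hAt, -cross_anticomm]
      ring

end Split

/-! ### The nilradical of a Borel subalgebra of `𝔤₂` -/

section NormalForm

variable {K : Type u} [Field K]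

/-- The elements of the nilradical of a Borel subalgebra of `𝔤₂` in split coordinates: `β` and `v`
are the coordinates for the long and the short simple root, `p`, `q`, `u`, `r` those for the
other positive roots. -/
def nilLin (β p q u v r : K) : Split K →ₗ[K] Split K where
  toFun w := (2 * u * w.2.2 0 - 2 * v * w.2.1 1 - 2 * r * w.2.1 2,
    ![p * w.2.1 1 + q * w.2.1 2 + w.1 * u - (v * w.2.2 2 - r * w.2.2 1),
      β * w.2.1 2 - r * w.2.2 0, v * w.2.2 0],
    ![0, -p * w.2.2 0 - w.1 * v + u * w.2.1 2,
      -q * w.2.2 0 - β * w.2.2 1 - w.1 * r - u * w.2.1 1])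
  map_add' w w' := by
    refine split_ext ?_ (fun i => ?_) (fun i => ?_)
    · simp; ring
    · fin_cases i <;> simp <;> ring
    · fin_cases i <;> simp <;> ring
  map_smul' c w := by
    refine split_ext ?_ (fun i => ?_) (fun i => ?_)
    · simp; ring
    · fin_cases i <;> simp <;> ring
    · fin_cases i <;> simp <;> ring

theorem nilLin_apply (β p q u v r : K) (w : Split K) : nilLin β p q u v r w =
    (2 * u * w.2.2 0 - 2 * v * w.2.1 1 - 2 * r * w.2.1 2,
    ![p * w.2.1 1 + q * w.2.1 2 + w.1 * u - (v * w.2.2 2 - r * w.2.2 1),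
      β * w.2.1 2 - r * w.2.2 0, v * w.2.2 0],
    ![0, -p * w.2.2 0 - w.1 * v + u * w.2.1 2,
      -q * w.2.2 0 - β * w.2.2 1 - w.1 * r - u * w.2.1 1]) := rfl

theorem splitForm_nilLin (β p q u v r : K) (w w' : Split K) :
    splitForm (nilLin β p q u v r w) w' = -splitForm w (nilLin β p q u v r w') := by
  simp only [splitForm, nilLin_apply, vec3_dotProduct, Matrix.cons_val]
  ring

theorem nilLin_splitCross (β p q u v r : K) (w w' : Split K) :
    nilLin β p q u v r (splitCross w w') =
      splitCross (nilLin β p q u v r w) w' + splitCross w (nilLin β p q u v r w') := by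
  refine split_ext ?_ (fun i => ?_) (fun i => ?_)
  · simp only [splitCross, nilLin_apply, cross_apply, vec3_dotProduct, Prod.fst_add, Pi.add_apply,
      Pi.sub_apply, Pi.smul_apply, smul_eq_mul, Matrix.cons_val]
    ring
  · fin_cases i <;>
    simp only [splitCross, nilLin_apply, cross_apply, vec3_dotProduct, Prod.fst_add, Prod.snd_add,
      Pi.add_apply, Pi.sub_apply, Pi.smul_apply, smul_eq_mul, Matrix.cons_val, Fin.zero_eta,
      Fin.mk_one, Fin.reduceFinMk, Fin.isValue] <;> ring
  · fin_cases i <;>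
    simp only [splitCross, nilLin_apply, cross_apply, vec3_dotProduct, Prod.snd_add,
      Pi.add_apply, Pi.sub_apply, Pi.smul_apply, smul_eq_mul, Matrix.cons_val, Fin.zero_eta,
      Fin.mk_one, Fin.reduceFinMk, Fin.isValue] <;> ring

variable {I : K} (hI : I * I = -1)

/-- The element of `so_7` with matrix `nilLin` in split coordinates. -/
noncomputable def nilSo [CharZero K] (β p q u v r : K) : soLie K 7 :=
  ⟨splitMatrix hI (nilLin β p q u v r), by
    rw [mem_so]
    refine Matrix.ext_of_mulVec_single fun i => ?_
    refine dotProduct_eq _ _ fun x => ?_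
    obtain ⟨w, hw⟩ := (ofSplit hI).surjective (Pi.single i 1)
    obtain ⟨w', rfl⟩ := (ofSplit hI).surjective x
    rw [Matrix.mulVec_transpose, ← Matrix.dotProduct_mulVec, ← hw, Matrix.neg_mulVec,
      neg_dotProduct, splitMatrix_mulVec, splitMatrix_mulVec, dotProduct_ofSplit,
      dotProduct_ofSplit, splitForm_nilLin, neg_neg]⟩

theorem nilSo_mulVec [CharZero K] (β p q u v r : K) (w : Split K) :
    (nilSo hI β p q u v r).1 *ᵥ ofSplit hI w = ofSplit hI (nilLin β p q u v r w) :=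
  splitMatrix_mulVec hI _ w

theorem nilSo_mem_g2 [CharZero K] (β p q u v r : K) : nilSo hI β p q u v r ∈ g2 K := by
  intro x y
  obtain ⟨w, rfl⟩ := (ofSplit hI).surjective x
  obtain ⟨w', rfl⟩ := (ofSplit hI).surjective y
  rw [cross7_ofSplit, nilSo_mulVec, nilSo_mulVec, nilSo_mulVec, nilLin_splitCross, map_add,
    cross7_ofSplit, cross7_ofSplit]

theorem ext_ofSplit [CharZero K] {D E : soLie K 7}
    (h : ∀ w, D.1 *ᵥ ofSplit hI w = E.1 *ᵥ ofSplit hI w) :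
    D = E := by
  refine Subtype.ext (Matrix.ext_of_mulVec_single fun i => ?_)
  obtain ⟨w, hw⟩ := (ofSplit hI).surjective (Pi.single i 1)
  rw [← hw, h]

theorem Ad_eq_of_ofSplit [CharZero K] {g : SO K 7} {S T T' : Split K → Split K} {D E : soLie K 7}
    (hg : ∀ w, g.1 *ᵥ ofSplit hI w = ofSplit hI (S w))
    (hD : ∀ w, D.1 *ᵥ ofSplit hI w = ofSplit hI (T w))
    (hE : ∀ w, E.1 *ᵥ ofSplit hI w = ofSplit hI (T' w)) (h : ∀ w, T' (S w) = S (T w)) :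
    Ad g D = E := by
  rw [Ad_eq_iff]
  refine Matrix.ext_of_mulVec_single fun i => ?_
  obtain ⟨w, hw⟩ := (ofSplit hI).surjective (Pi.single i 1)
  rw [← hw, ← Matrix.mulVec_mulVec, ← Matrix.mulVec_mulVec, hg, hE, hD, hg, h]

theorem mulVec_three (A : Matrix (Fin 3) (Fin 3) K) (x : Fin 3 → K) : A *ᵥ x =
    ![A 0 0 * x 0 + A 0 1 * x 1 + A 0 2 * x 2, A 1 0 * x 0 + A 1 1 * x 1 + A 1 2 * x 2,
      A 2 0 * x 0 + A 2 1 * x 1 + A 2 2 * x 2] := by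
  funext i
  fin_cases i <;> simp only [Matrix.mulVec, vec3_dotProduct] <;> rfl

theorem mem_adOrbit_of_Ad {N : ℕ} {H : Subgroup (SO K N)} {g : SO K N} (hg : g ∈ H)
    {x y : soLie K N} (h : Ad g x ∈ adOrbit H y) : x ∈ adOrbit H y := by
  have := Ad_mem_adOrbit (H.inv_mem hg) h
  rwa [Ad_inv_Ad] at this

/-! The coordinates for the non-simple roots of an element with nonzero simple coordinates are
removed by unipotent elements of `G₂`, one at a time, and the torus normalises the simple ones. -/

theorem nilSo_mem_of_torus [CharZero K] {β v : K} (hβ : β ≠ 0) (hv : v ≠ 0) :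
    nilSo hI β 0 0 0 v 0 ∈ adOrbit (G2 K) (nilSo hI 1 0 0 0 1 0) := by
  have hA : (!![(β * v ^ 2)⁻¹, 0, 0; 0, v, 0; 0, 0, β * v] : Matrix (Fin 3) (Fin 3) K).det = 1 := by
    rw [Matrix.det_fin_three]
    simp
    field_simp
  obtain ⟨g, hg, h⟩ := exists_slMap hI hA
  refine mem_adOrbit_of_Ad hg ?_
  rw [Ad_eq_of_ofSplit hI h (nilSo_mulVec hI _ _ _ _ _ _) (nilSo_mulVec hI 1 0 0 0 1 0) fun w => ?_]
  · exact mem_adOrbit_self _ _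
  · simp only [slMap_apply, Matrix.adjugate_fin_three, mulVec_three]
    refine split_ext ?_ (fun i => ?_) (fun i => ?_)
    · simp [nilLin_apply]
      ring
    · fin_cases i <;> simp [nilLin_apply] <;>
        field_simp
    · fin_cases i <;> simp [nilLin_apply] <;>
        field_simp

theorem nilSo_mem_of_q [CharZero K] {β v : K} (hβ : β ≠ 0) (hv : v ≠ 0) (q : K) :
    nilSo hI β 0 q 0 v 0 ∈ adOrbit (G2 K) (nilSo hI 1 0 0 0 1 0) := by
  have hA : (!![1, -q / β, 0; 0, 1, 0; 0, 0, 1] : Matrix (Fin 3) (Fin 3) K).det = 1 := by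
    rw [Matrix.det_fin_three]
    simp
  obtain ⟨g, hg, h⟩ := exists_slMap hI hA
  refine mem_adOrbit_of_Ad hg ?_
  rw [Ad_eq_of_ofSplit hI h (nilSo_mulVec hI _ _ _ _ _ _) (nilSo_mulVec hI β 0 0 0 v 0) fun w => ?_]
  · exact nilSo_mem_of_torus hI hβ hv
  · simp only [slMap_apply, Matrix.adjugate_fin_three, mulVec_three]
    refine split_ext ?_ (fun i => ?_) (fun i => ?_)
    · simp [nilLin_apply]
    · fin_cases i <;> simp [nilLin_apply] <;>
        field_simp <;> ring
    · fin_cases i <;> simp [nilLin_apply] <;>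
        field_simp <;> ring

theorem nilSo_mem_of_p [CharZero K] {β v : K} (hβ : β ≠ 0) (hv : v ≠ 0) (p q : K) :
    nilSo hI β p q 0 v 0 ∈ adOrbit (G2 K) (nilSo hI 1 0 0 0 1 0) := by
  obtain ⟨g, hg, h⟩ := exists_unipX hI ![p / (3 * v), 0, 0]
  refine mem_adOrbit_of_Ad hg ?_
  rw [Ad_eq_of_ofSplit hI h (nilSo_mulVec hI _ _ _ _ _ _) (nilSo_mulVec hI β 0 q 0 v 0) fun w => ?_]
  · exact nilSo_mem_of_q hI hβ hv q
  · refine split_ext ?_ (fun i => ?_) (fun i => ?_)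
    · simp [nilLin_apply, unipX_apply]
    · fin_cases i <;> simp [nilLin_apply, unipX_apply] <;> field_simp <;> ring
    · fin_cases i <;> simp [nilLin_apply, unipX_apply] <;> field_simp <;> ring

theorem nilSo_mem_of_u [CharZero K] {β v : K} (hβ : β ≠ 0) (hv : v ≠ 0) (p q u : K) :
    nilSo hI β p q u v 0 ∈ adOrbit (G2 K) (nilSo hI 1 0 0 0 1 0) := by
  obtain ⟨g, hg, h⟩ := exists_unipY hI ![0, 0, u / (2 * v)]
  refine mem_adOrbit_of_Ad hg ?_
  rw [Ad_eq_of_ofSplit hI h (nilSo_mulVec hI _ _ _ _ _ _)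
    (nilSo_mulVec hI β p (q + 3 * u ^ 2 / (4 * v)) 0 v 0) fun w => ?_]
  · exact nilSo_mem_of_p hI hβ hv p _
  · refine split_ext ?_ (fun i => ?_) (fun i => ?_)
    · simp [nilLin_apply, unipY_apply]
      field_simp
      ring
    · fin_cases i <;> simp [nilLin_apply, unipY_apply] <;> field_simp <;> ring
    · fin_cases i <;> simp [nilLin_apply, unipY_apply] <;> field_simp <;> ring

/-- The elements with nonzero coordinates for the two simple roots are conjugate under `G₂`. -/
theorem nilSo_mem_regular [CharZero K] {β v : K} (hβ : β ≠ 0) (hv : v ≠ 0) (p q u r : K) :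
    nilSo hI β p q u v r ∈ adOrbit (G2 K) (nilSo hI 1 0 0 0 1 0) := by
  have hA : (!![1, 0, 0; 0, 1, r / v; 0, 0, 1] : Matrix (Fin 3) (Fin 3) K).det = 1 := by
    rw [Matrix.det_fin_three]
    simp
  obtain ⟨g, hg, h⟩ := exists_slMap hI hA
  refine mem_adOrbit_of_Ad hg ?_
  rw [Ad_eq_of_ofSplit hI h (nilSo_mulVec hI _ _ _ _ _ _)
    (nilSo_mulVec hI β p (q - p * (r / v)) u v 0) fun w => ?_]
  · exact nilSo_mem_of_u hI hβ hv _ _ _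
  · simp only [slMap_apply, Matrix.adjugate_fin_three, mulVec_three]
    refine split_ext ?_ (fun i => ?_) (fun i => ?_)
    · simp [nilLin_apply]
      field_simp
      ring
    · fin_cases i <;> simp [nilLin_apply] <;>
        field_simp <;> ring
    · fin_cases i <;> simp [nilLin_apply] <;>
        field_simp <;> ring

end NormalForm

section Reduction

variable {K : Type u} [Field K]

variable [CharZero K] {I : K} (hI : I * I = -1)

/-- A nilpotent element of `so_7` kills a nonzero isotropic vector. -/
theorem exists_isotropic_ker (hI : I * I = -1) {D : soLie K 7} (hD : IsNilpotent D.1) :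
    ∃ a : Fin 7 → K, a ≠ 0 ∧ a ⬝ᵥ a = 0 ∧ D.1 *ᵥ a = 0 := by
  by_cases h0 : D.1 = 0
  · obtain ⟨h1, h2, -⟩ := ofSplit_base hI
    exact ⟨_, h1, h2, by rw [h0, Matrix.zero_mulVec]⟩
  · classical
    have hn := Nat.find_spec hD
    set n := Nat.find hD with hn'
    have h1 : n ≠ 0 := fun h => by
      rw [h, pow_zero] at hn
      exact one_ne_zero hn
    have h2 : n ≠ 1 := fun h => by
      rw [h, pow_one] at hn
      exact h0 hn
    obtain ⟨m, hm⟩ : ∃ m, n = m + 2 := ⟨n - 2, by omega⟩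
    have h3 : D.1 ^ (m + 1) ≠ 0 := Nat.find_min hD (by omega)
    have h4 : ∃ i, D.1 ^ (m + 1) *ᵥ Pi.single i 1 ≠ 0 := by
      by_contra! h
      exact h3 (Matrix.ext_of_mulVec_single fun i => by rw [h i, Matrix.zero_mulVec])
    obtain ⟨i, hi⟩ := h4
    have h5 : D.1 *ᵥ (D.1 ^ (m + 1) *ᵥ Pi.single i 1) = 0 := by
      rw [Matrix.mulVec_mulVec, ← pow_succ', ← hm, hn, Matrix.zero_mulVec]
    refine ⟨_, hi, ?_, h5⟩
    -- the vector lies in the image and in the kernel of `D`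
    have h6 : D.1 ^ (m + 1) *ᵥ Pi.single i 1 = D.1 *ᵥ (D.1 ^ m *ᵥ Pi.single i 1) := by
      rw [Matrix.mulVec_mulVec, ← pow_succ']
    conv_lhs => enter [1]; rw [h6]
    rw [skew_dotProduct, h5, dotProduct_zero, neg_zero]

theorem splitDer_base_eq_zero {A : Matrix (Fin 3) (Fin 3) K} {u v : Fin 3 → K}
    (h : splitDer A u v (0, ![1, 0, 0], 0) = 0) :
    A 0 0 = 0 ∧ A 1 0 = 0 ∧ A 2 0 = 0 ∧ u 1 = 0 ∧ u 2 = 0 ∧ v 0 = 0 := by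
  simp only [splitDer, mulVec_three, cross_apply, vec3_dotProduct] at h
  have h1 := congrArg Prod.fst h
  have h2 := congrArg (fun w => w.2.1) h
  have h3 := congrArg (fun w => w.2.2) h
  have a1 := congrFun h2 0
  have a2 := congrFun h2 1
  have a3 := congrFun h2 2
  have b1 := congrFun h3 1
  have b2 := congrFun h3 2
  simp at h1 a1 a2 a3 b1 b2
  exact ⟨a1, a2, a3, b2, b1, h1⟩

/-- If a nilpotent derivation kills the standard isotropic vector, then its matrix part `A` induces
an endomorphism of the plane `K³ / ⟨e₀⟩` that is not injective: the powers of the derivation act on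
this plane by the powers of `A`. -/
theorem exists_ker_mod {D : soLie K 7} (hN : IsNilpotent D.1) {A : Matrix (Fin 3) (Fin 3) K}
    {u v : Fin 3 → K} (hA : ∀ w, D.1 *ᵥ ofSplit hI w = ofSplit hI (splitDer A u v w))
    (h10 : A 1 0 = 0) (h20 : A 2 0 = 0) (h00 : A 0 0 = 0) (hu1 : u 1 = 0) (hu2 : u 2 = 0)
    (hv0 : v 0 = 0) :
    ∃ x : Fin 3 → K, (x 1 ≠ 0 ∨ x 2 ≠ 0) ∧ (A *ᵥ x) 1 = 0 ∧ (A *ᵥ x) 2 = 0 := by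
  obtain ⟨n, hn⟩ := hN
  have key : ∀ m, ∃ w : Split K, D.1 ^ m *ᵥ ofSplit hI (0, ![0, 1, 0], 0) = ofSplit hI w ∧
      w.2.2 0 = 0 := by
    intro m
    induction m with
    | zero => exact ⟨_, by rw [pow_zero, Matrix.one_mulVec], rfl⟩
    | succ m ih =>
      obtain ⟨w, hw, hw0⟩ := ih
      refine ⟨_, by rw [pow_succ', ← Matrix.mulVec_mulVec, hw, hA], ?_⟩
      simp [splitDer, mulVec_three, cross_apply, hv0, hu1, hu2, h00, h10, h20,
        Matrix.transpose_apply, Matrix.vecHead]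
  choose w hw hw0 using key
  have hstep : ∀ m, (A *ᵥ (w m).2.1) 1 = (w (m + 1)).2.1 1 ∧
      (A *ᵥ (w m).2.1) 2 = (w (m + 1)).2.1 2 := by
    intro m
    have h1 : w (m + 1) = splitDer A u v (w m) := by
      apply (ofSplit hI).injective
      rw [← hw, pow_succ', ← Matrix.mulVec_mulVec, hw, hA]
    rw [h1]
    simp [splitDer, cross_apply, hv0, hu1, hu2, hw0, Matrix.vecHead, Matrix.vecTail]
  by_contra! h
  have hne : ∀ m, (w m).2.1 1 ≠ 0 ∨ (w m).2.1 2 ≠ 0 := by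
    intro m
    induction m with
    | zero =>
      have h1 : w 0 = (0, ![0, 1, 0], 0) := by
        apply (ofSplit hI).injective
        rw [← hw, pow_zero, Matrix.one_mulVec]
      rw [h1]
      simp
    | succ m ih =>
      rw [← (hstep m).1, ← (hstep m).2]
      by_contra! h2
      exact h _ ih h2.1 h2.2
  have h1 : w n = 0 := by
    apply (ofSplit hI).injective
    rw [← hw, hn, Matrix.zero_mulVec, map_zero]
  have := hne n
  rw [h1] at this
  simp at this

/-- Every nilpotent element of `𝔤₂` is conjugate under `G₂` to an element of the nilradical of the
standard Borel subalgebra. -/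
theorem exists_conj_nilSo {D : soLie K 7} (hD : D ∈ g2 K) (hN : IsNilpotent D.1) :
    ∃ g ∈ G2 K, ∃ β p q u v r, Ad g D = nilSo hI β p q u v r := by
  obtain ⟨a, ha0, haa, hDa⟩ := exists_isotropic_ker hI hN
  obtain ⟨w, rfl⟩ := (ofSplit hI).surjective a
  rw [dotProduct_ofSplit] at haa
  obtain ⟨g, hg, h⟩ := splitConj_isotropic hI (w := w) (by rintro rfl; simp at ha0) haa
  have hD1 := Ad_mem_g2 hg hD
  have hN1 := isNilpotent_Ad g hN
  have hDa1 : (Ad g D).1 *ᵥ ofSplit hI (0, ![1, 0, 0], 0) = 0 := by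
    rw [← h, Matrix.mulVec_mulVec, (Ad_eq_iff g D _).1 rfl, ← Matrix.mulVec_mulVec, hDa,
      Matrix.mulVec_zero]
  obtain ⟨A, u, v, -, hA⟩ := exists_splitDer hI hD1
  rw [hA, LinearEquiv.map_eq_zero_iff] at hDa1
  obtain ⟨h00, h10, h20, hu1, hu2, hv0⟩ := splitDer_base_eq_zero hDa1
  obtain ⟨x, hx, hx1, hx2⟩ := exists_ker_mod hI hN1 hA h10 h20 h00 hu1 hu2 hv0
  have hc : crossProduct ![1, 0, 0] x ≠ 0 := by
    intro h
    rw [cross_apply] at h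
    have h1 := congrFun h 1
    have h2 := congrFun h 2
    simp at h1 h2
    tauto
  obtain ⟨B, hB, hB1, hB2⟩ := exists_sl_of_cross_ne_zero hc
  obtain ⟨g', hg', hgB⟩ := exists_slMap hI hB
  have hAd : ∀ w, (Ad g' (Ad g D)).1 *ᵥ (g'.1 *ᵥ w) = g'.1 *ᵥ ((Ad g D).1 *ᵥ w) := fun w => by
    rw [Matrix.mulVec_mulVec, (Ad_eq_iff g' (Ad g D) _).1 rfl, ← Matrix.mulVec_mulVec]
  obtain ⟨A', u', v', htr, hA'⟩ := exists_splitDer hI (Ad_mem_g2 hg' hD1)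
  -- in the new coordinates the first basis vector is killed, and the second goes to the first
  have e1 : splitDer A' u' v' (0, ![1, 0, 0], 0) = 0 := by
    apply (ofSplit hI).injective
    have := hAd (ofSplit hI (0, ![1, 0, 0], 0))
    rw [hA, hDa1, map_zero, Matrix.mulVec_zero, hgB, slMap_apply, hB1, Matrix.mulVec_zero,
      hA'] at this
    rw [this, map_zero]
  have e2 : A' 1 1 = 0 ∧ A' 2 1 = 0 := by
    have h1 := hAd (ofSplit hI (0, x, 0))
    rw [hA, hgB, hgB, slMap_apply, hB2, Matrix.mulVec_zero, hA'] at h1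
    have h2 := congrArg (fun w => w.2.1) ((ofSplit hI).injective h1)
    have h3 : A *ᵥ x = (A *ᵥ x) 0 • ![1, 0, 0] := by
      funext i
      fin_cases i
      · simp
      · simpa using hx1
      · simpa using hx2
    simp only [splitDer, slMap_apply, zero_smul, add_zero, map_zero, sub_zero] at h2
    rw [h3, Matrix.mulVec_smul, hB1, mulVec_three] at h2
    have a1 := congrFun h2 1
    have a2 := congrFun h2 2
    simp at a1 a2
    exact ⟨a1, a2⟩
  obtain ⟨k00, k10, k20, ku1, ku2, kv0⟩ := splitDer_base_eq_zero e1
  obtain ⟨k11, k21⟩ := e2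
  have k22 : A' 2 2 = 0 := by rw [k00, k11] at htr; simpa using htr
  refine ⟨g' * g, (G2 K).mul_mem hg' hg, A' 1 2, A' 0 1, A' 0 2, u' 0, v' 1, v' 2, ?_⟩
  rw [Ad_mul]
  refine ext_ofSplit hI fun w => ?_
  rw [hA', nilSo_mulVec]
  congr 1
  simp only [splitDer, mulVec_three, cross_apply, vec3_dotProduct, Matrix.transpose_apply]
  refine split_ext ?_ (fun i => ?_) (fun i => ?_)
  · simp [nilLin_apply, ku1, ku2, kv0]
    ring
  · fin_cases i <;> simp [nilLin_apply, ku1, ku2, kv0, k00, k10, k20, k11, k21, k22, Matrix.vecHead,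
      Matrix.vecTail]
  · fin_cases i <;> simp [nilLin_apply, ku1, ku2, kv0, k00, k10, k20, k11, k21, k22, Matrix.vecHead,
      Matrix.vecTail] <;> ring

/-- The projection of a bivector whose first factor is the standard isotropic vector. -/
theorem g2Part_eq_nilSo (x1 x2 y1 y2 s x0 : K) :
    g2Part (wedgeSo (ofSplit hI (0, ![1, 0, 0], 0)) (ofSplit hI (s, ![x0, x1, x2], ![0, y1, y2]))) =
      nilSo hI 0 (-2 * y1) (-2 * y2) (2 / 3 * s) (2 / 3 * x2) (-2 / 3 * x1) := by
  refine ext_ofSplit hI fun w => ?_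
  rw [g2Part_wedgeSo_mulVec, nilSo_mulVec, dotProduct_ofSplit, dotProduct_ofSplit, cross7_ofSplit,
    cross7_ofSplit, ← map_smul, ← map_smul, ← map_smul, ← map_sub, ← map_sub]
  congr 1
  simp only [splitCross, splitForm, cross_apply, vec3_dotProduct, nilLin_apply]
  refine split_ext ?_ (fun i => ?_) (fun i => ?_)
  · simp
    ring
  · fin_cases i <;> simp <;> ring
  · fin_cases i <;> simp <;> ring

theorem g2Part_eq_nilSo_of_plane (a c s x0 x1 y1 y2 : K) :
    g2Part (wedgeSo (ofSplit hI (0, ![a, 0, 0], ![0, 0, c]))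
      (ofSplit hI (s, ![x0, x1, 0], ![0, y1, y2]))) =
      nilSo hI (2 * c * x1) (-2 * a * y1) (2 * (c * x0 - a * y2)) (2 / 3 * (a * s + c * y1)) 0
        (-2 / 3 * (c * s + a * x1)) := by
  refine ext_ofSplit hI fun w => ?_
  rw [g2Part_wedgeSo_mulVec, nilSo_mulVec, dotProduct_ofSplit, dotProduct_ofSplit, cross7_ofSplit,
    cross7_ofSplit, ← map_smul, ← map_smul, ← map_smul, ← map_sub, ← map_sub]
  congr 1
  simp only [splitCross, splitForm, cross_apply, vec3_dotProduct, nilLin_apply]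
  refine split_ext ?_ (fun i => ?_) (fun i => ?_)
  · simp
    ring
  · fin_cases i <;> simp <;> ring
  · fin_cases i <;> simp <;> ring

end Reduction

/-! ### The subregular orbit -/

section Subregular

variable {K : Type u} [Field K] [CharZero K] {I : K} (hI : I * I = -1)

theorem g2Part_wedgeSo_add_smul (a b c : Fin 7 → K) (t : K) :
    g2Part (wedgeSo a (b + t • c)) = g2Part (wedgeSo a b) + t • g2Part (wedgeSo a c) := by
  have h : wedgeSo a (b + t • c) = wedgeSo a b + t • wedgeSo a c := by
    refine Subtype.ext ?_
    change wedge a (b + t • c) = wedge a b + t • wedge a c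
    ext i j
    simp only [wedge_apply, Pi.add_apply, Pi.smul_apply, smul_eq_mul, Matrix.add_apply,
      Matrix.smul_apply]
    ring
  rw [h, ← projection_g2, map_add, map_smul, projection_g2, projection_g2]

theorem wedgeSo_smul_inv_smul {N : ℕ} (a b : Fin N → K) (r : K) :
    wedgeSo a (r⁻¹ • b) = wedgeSo (r⁻¹ • a) b := by
  refine Subtype.ext ?_
  ext i j
  simp only [wedgeSo_coe, wedge_apply, Pi.smul_apply, smul_eq_mul]
  ring

/-- The projection of the open orbit is an orbit. -/
theorem image_g2Part_openOrbit :
    g2Part '' adOrbit (G2 K) (basePoint hI) = adOrbit (G2 K) (g2Part (basePoint hI)) := by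
  ext x
  constructor
  · rintro ⟨_, ⟨g, hg, rfl⟩, rfl⟩
    refine ⟨g, hg, ?_⟩
    rw [basePoint, Ad_g2Part_wedgeSo hg, Ad_wedgeSo]
  · rintro ⟨g, hg, rfl⟩
    refine ⟨_, ⟨g, hg, rfl⟩, ?_⟩
    rw [basePoint, Ad_g2Part_wedgeSo hg, Ad_wedgeSo]

theorem nilSo_pow_mulVec (β p q u v r : K) (k : ℕ) (w : Split K) :
    (nilSo hI β p q u v r).1 ^ k *ᵥ ofSplit hI w = ofSplit hI ((nilLin β p q u v r ^ k) w) := by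
  induction k with
  | zero => simp
  | succ k ih =>
    rw [pow_succ', ← Matrix.mulVec_mulVec, ih, nilSo_mulVec, pow_succ']
    rfl

theorem nilSo_pow_eq_zero {β p q u v r : K} {k : ℕ} (h : ∀ w, (nilLin β p q u v r ^ k) w = 0) :
    (nilSo hI β p q u v r).1 ^ k = 0 := by
  refine Matrix.ext_of_mulVec_single fun i => ?_
  obtain ⟨w, hw⟩ := (ofSplit hI).surjective (Pi.single i 1)
  rw [← hw, nilSo_pow_mulVec, h, map_zero, Matrix.zero_mulVec]

theorem regular_pow_seven : (nilSo hI 1 0 0 0 1 0).1 ^ 7 = 0 := by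
  refine nilSo_pow_eq_zero hI fun w => ?_
  simp only [pow_succ, pow_zero, one_mul, Module.End.mul_apply, nilLin_apply]
  refine split_ext (by simp) (fun i => ?_) (fun i => ?_) <;> fin_cases i <;> simp

theorem regular_pow_three_ne_zero : (nilSo hI 1 0 0 0 1 0).1 ^ 3 ≠ 0 := by
  intro h
  have h1 := nilSo_pow_mulVec hI 1 0 0 0 1 0 3 (0, 0, ![1, 0, 0])
  rw [h, Matrix.zero_mulVec, eq_comm, LinearEquiv.map_eq_zero_iff] at h1
  have h2 := congrArg Prod.fst h1
  simp [pow_succ, nilLin_apply] at h2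

theorem g2Part_basePoint : g2Part (basePoint hI) = nilSo hI 0 (-2 * 4⁻¹) 0 0 0 (-2 / 3) := by
  have := g2Part_eq_nilSo hI 1 0 4⁻¹ 0 0 0
  simpa [basePoint] using this

theorem g2Part_basePoint_pow_three : (g2Part (basePoint hI)).1 ^ 3 = 0 := by
  rw [g2Part_basePoint]
  refine nilSo_pow_eq_zero hI fun w => ?_
  simp only [pow_succ, pow_zero, one_mul, Module.End.mul_apply, nilLin_apply]
  refine split_ext (by simp) (fun i => ?_) (fun i => ?_) <;> fin_cases i <;> simp

theorem g2Part_basePoint_mem_nilOrbit : g2Part (basePoint hI) ∈ nilOrbit K 7 [3, 3, 1] := by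
  rw [g2Part_basePoint]
  refine hasJordanType_of_kernel (by simp)
    (![ofSplit hI (0, 0, ![0, 0, 8 / 9]), ofSplit hI (0, ![-2 / 3, 0, 0], 0),
      ofSplit hI (0, ![0, 4, 0], ![0, -3, 0])] : Fin 3 → Fin 7 → K) ?_ (fun i => ?_) (fun i => ?_)
  · rw [Fintype.linearIndependent_iff]
    intro c hc
    change ∑ i : Fin 3, c i • _ = 0 at hc
    rw [Fin.sum_univ_three] at hc
    simp only [Matrix.cons_val] at hc
    rw [← map_smul, ← map_smul, ← map_smul, ← map_add, ← map_add,
      LinearEquiv.map_eq_zero_iff] at hc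
    have h1 := congrFun (congrArg (fun w => w.2.1) hc) 0
    have h2 := congrFun (congrArg (fun w => w.2.1) hc) 1
    have h3 := congrFun (congrArg (fun w => w.2.2) hc) 2
    simp at h1 h2 h3
    change ∀ i : Fin 3, c i = 0
    intro i
    fin_cases i
    · exact h3
    · exact h1
    · exact h2
  · change Fin 3 at i
    have hz : ∀ w : Split K, nilLin 0 (-2 * 4⁻¹) 0 0 0 (-2 / 3) w = 0 →
        (nilSo hI 0 (-2 * 4⁻¹) 0 0 0 (-2 / 3)).1 *ᵥ ofSplit hI w = 0 := fun w hw => by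
      rw [nilSo_mulVec, hw, map_zero]
    fin_cases i
    all_goals
      refine hz _ ?_
      rw [nilLin_apply]
      refine split_ext ?_ (fun i => ?_) (fun i => ?_)
    all_goals first | simp; done | (fin_cases i <;> simp; try norm_num)
  · change Fin 3 at i
    fin_cases i
    · refine ⟨ofSplit hI (0, ![0, 0, 1], 0), ?_⟩
      refine (nilSo_pow_mulVec hI _ _ _ _ _ _ 2 _).trans ?_
      refine congrArg (ofSplit hI) ?_
      simp only [pow_succ, pow_zero, one_mul, Module.End.mul_apply, nilLin_apply]
      refine split_ext (by simp) (fun i => ?_) (fun i => ?_) <;> fin_cases i <;> simp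
      norm_num
    · refine ⟨ofSplit hI (0, 0, ![1, 0, 0]), ?_⟩
      refine (nilSo_pow_mulVec hI _ _ _ _ _ _ 2 _).trans ?_
      refine congrArg (ofSplit hI) ?_
      simp only [pow_succ, pow_zero, one_mul, Module.End.mul_apply, nilLin_apply]
      refine split_ext (by simp) (fun i => ?_) (fun i => ?_) <;> fin_cases i <;> simp
      norm_num
    · exact ⟨_, Matrix.one_mulVec _⟩

theorem height_four_of_mem_nilOrbit {e : soLie K 7} (he : e ∈ nilOrbit K 7 [3, 3, 1]) :
    IsGreatest {d : ℕ | (LieAlgebra.ad K (soLie K 7) e) ^ d ≠ 0} 4 := by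
  have he' : HasJordanType e.1 [3, 3, 1] := he
  have h3 : e.1 ^ 3 = 0 := eq_zero_of_rank_eq_zero (by rw [he'.rank_pow]; simp)
  obtain ⟨t, ht, -⟩ := he'.exists_tops (fun i => by
    change Fin 3 at i
    fin_cases i <;> simp)
  change LinearIndependent K (fun i : Fin 3 => _) at ht
  have hp := ht.comp ![0, 1] (fun i j hij => by
    fin_cases i <;> fin_cases j <;> simp_all)
  have hf : ((fun i : Fin 3 => e.1 ^ ([3, 3, 1].get i - 1) *ᵥ t i) ∘ ![0, 1]) =
      ![e.1 ^ 2 *ᵥ t (0 : Fin 3), e.1 ^ 2 *ᵥ t (1 : Fin 3)] := by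
    funext i
    fin_cases i <;> rfl
  have hp' := hf ▸ hp
  have h0 : e.1 ^ 2 *ᵥ t (0 : Fin 3) ≠ 0 := hp'.ne_zero 0
  exact height_four_of_cube_eq_zero h3 h0 fun c hc =>
    (LinearIndependent.pair_iff' h0).1 hp' c hc.symm

variable [IsAlgClosed K]

/-- Rescaling `a ∧ b = r a ∧ r⁻¹ b` reduces an anisotropic `b` to a unit vector. -/
theorem g2Part_wedgeSo_mem_of_generic {s : K} {x y : Fin 3 → K} (hy : y 0 = 0) (hx : x 1 ≠ 0)
    (hb : splitForm (s, x, y) (s, x, y) ≠ 0) :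
    g2Part (wedgeSo (ofSplit hI (0, ![1, 0, 0], 0)) (ofSplit hI (s, x, y))) ∈
      adOrbit (G2 K) (g2Part (basePoint hI)) := by
  rw [← image_g2Part_openOrbit]
  refine ⟨_, ?_, rfl⟩
  obtain ⟨r, hr⟩ := IsAlgClosed.exists_eq_mul_self (splitForm (s, x, y) (s, x, y))
  have hr0 : r ≠ 0 := by
    rintro rfl
    exact hb (by rw [hr, mul_zero])
  obtain ⟨h0, ha, -, -⟩ := ofSplit_base hI
  have h : wedgeSo (ofSplit hI (0, ![1, 0, 0], 0)) (ofSplit hI (s, x, y)) =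
      wedgeSo (r • ofSplit hI (0, ![1, 0, 0], 0)) (r⁻¹ • ofSplit hI (s, x, y)) := by
    rw [wedgeSo_smul_inv_smul, smul_smul, inv_mul_cancel₀ hr0, one_smul]
  rw [h]
  refine mem_openOrbit_of_not_isSpecialPair hI (smul_ne_zero hr0 h0) ?_ ?_ ?_ ?_
  · rw [dotProduct_smul, smul_dotProduct, ha, smul_zero, smul_zero]
  · rw [dotProduct_smul, smul_dotProduct, dotProduct_ofSplit]
    simp [splitForm, Matrix.vecHead, hy]
  · rw [dotProduct_smul, smul_dotProduct, dotProduct_ofSplit, hr, smul_eq_mul, smul_eq_mul]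
    field_simp
  · rintro ⟨c, hc⟩
    rw [cross7_smul_left, cross7_smul_right, smul_smul, mul_inv_cancel₀ hr0, one_smul,
      cross7_ofSplit_base, ← map_smul, ← map_smul] at hc
    have := congrFun (congrArg (fun w => w.2.2) ((ofSplit hI).injective hc)) 2
    simp [hx] at this

/-- The vector `b` need not be anisotropic: it is deformed to a generic one. -/
theorem g2Part_wedgeSo_mem_zariskiClosure {a b : Fin 7 → K} (h0 : a ≠ 0) (ha : a ⬝ᵥ a = 0)
    (hab : a ⬝ᵥ b = 0) : g2Part (wedgeSo a b) ∈
      zariskiClosure K (adOrbit (G2 K) (g2Part (basePoint hI))) := by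
  obtain ⟨g, hg, s, x, y, h1, h2, hy, -⟩ := exists_conj_first hI h0 ha hab
  refine mem_zariskiClosure_of_Ad g (fun x hx => Ad_mem_adOrbit ((G2 K).inv_mem hg) hx) ?_
  rw [Ad_g2Part_wedgeSo hg, h1, h2]
  have hγ : ∀ t : K, g2Part (wedgeSo (ofSplit hI (0, ![1, 0, 0], 0)) (ofSplit hI (s, x, y))) +
      t • g2Part (basePoint hI) = g2Part (wedgeSo (ofSplit hI (0, ![1, 0, 0], 0))
        (ofSplit hI (s, x + t • ![0, 1, 0], y + t • ![0, 4⁻¹, 0]))) := by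
    intro t
    rw [basePoint, ← g2Part_wedgeSo_add_smul, ← map_smul, ← map_add]
    congr 3
    exact split_ext (by simp) (fun _ => rfl) (fun _ => rfl)
  -- the value of the quadratic form along the deformation, a monic polynomial in `t`
  let N : Polynomial K := Polynomial.X ^ 2 + Polynomial.C (x 1 + 4 * y 1) * Polynomial.X +
    Polynomial.C (splitForm (s, x, y) (s, x, y))
  have hN : N.Monic := by
    have : N = (⟨0, 1, x 1 + 4 * y 1, splitForm (s, x, y) (s, x, y)⟩ : Cubic K).toPoly := by
      simp [N, Cubic.toPoly]
    rw [this]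
    exact Cubic.monic_of_b_eq_one rfl rfl
  have := mem_zariskiClosure_of_curve (S := adOrbit (G2 K) (g2Part (basePoint hI)))
    (γ := fun t : K =>
      g2Part (wedgeSo (ofSplit hI (0, ![1, 0, 0], 0)) (ofSplit hI (s, x, y))) +
        t • g2Part (basePoint hI))
    (F := N * (Polynomial.X + Polynomial.C (x 1)))
    (by
      have := (IsPolyCurve.const (g2Part (wedgeSo (ofSplit hI (0, ![1, 0, 0], 0))
        (ofSplit hI (s, x, y)))).1).add ((IsPolyCurve.const (g2Part (basePoint hI)).1).smul
          Polynomial.X)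
      simpa using this)
    (mul_ne_zero hN.ne_zero (Polynomial.X_add_C_ne_zero _)) (fun t ht => ?_) 0
  · simpa using this
  · rw [Polynomial.eval_mul] at ht
    have hN' := left_ne_zero_of_mul ht
    have hx' := right_ne_zero_of_mul ht
    simp only [hγ]
    refine g2Part_wedgeSo_mem_of_generic hI (by simp [hy]) ?_ ?_
    · simpa [add_comm] using hx'
    · convert hN' using 1
      simp [N, splitForm, vec3_dotProduct, hy, Matrix.vecHead, Matrix.vecTail]
      ring

/-- The elements of the nilradical for which a simple coordinate vanishes are projections of
decomposable bivectors `a ∧ b` with `a` isotropic and orthogonal to `b`. -/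
theorem nilSo_mem_zariskiClosure {β p q u v r : K} (h : β = 0 ∨ v = 0) :
    nilSo hI β p q u v r ∈ zariskiClosure K (adOrbit (G2 K) (g2Part (basePoint hI))) := by
  have key : ∀ a c s x0 x1 y1 y2 : K, a ≠ 0 ∨ c ≠ 0 →
      nilSo hI (2 * c * x1) (-2 * a * y1) (2 * (c * x0 - a * y2)) (2 / 3 * (a * s + c * y1)) 0
        (-2 / 3 * (c * s + a * x1)) ∈
      zariskiClosure K (adOrbit (G2 K) (g2Part (basePoint hI))) := by
    intro a c s x0 x1 y1 y2 hac
    rw [← g2Part_eq_nilSo_of_plane]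
    refine g2Part_wedgeSo_mem_zariskiClosure hI (fun h0 => ?_) ?_ ?_
    · rw [LinearEquiv.map_eq_zero_iff] at h0
      have h1 := congrFun (congrArg (fun w => w.2.1) h0) 0
      have h2 := congrFun (congrArg (fun w => w.2.2) h0) 2
      simp at h1 h2
      tauto
    · rw [dotProduct_ofSplit]
      simp [splitForm]
    · rw [dotProduct_ofSplit]
      simp [splitForm]
  rcases h with rfl | rfl
  · have h1 := g2Part_eq_nilSo hI (-3 / 2 * r) (3 / 2 * v) (-p / 2) (-q / 2) (3 / 2 * u) 0
    obtain ⟨h0, ha, -, -⟩ := ofSplit_base hI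
    have h2 := g2Part_wedgeSo_mem_zariskiClosure hI h0 ha
      (b := ofSplit hI (3 / 2 * u, ![0, -3 / 2 * r, 3 / 2 * v], ![0, -p / 2, -q / 2]))
      (by rw [dotProduct_ofSplit]; simp [splitForm])
    rw [h1] at h2
    convert h2 using 2 <;> field_simp
  · by_cases hp : p = 0
    · subst hp
      convert key 0 1 (-3 / 2 * r) (q / 2) (β / 2) (3 / 2 * u) 0 (Or.inr one_ne_zero) using 2 <;>
        field_simp <;> ring
    · -- the short simple coordinate vanishes: the plane is found by solving the binary cubic form
      -- on which the Levi subgroup of the long root acts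
      obtain ⟨t, ht⟩ := IsAlgClosed.exists_root (⟨p, 3 * u, 3 * r, β⟩ : Cubic K).toPoly
        (by rw [Cubic.degree_of_a_ne_zero hp]; norm_num)
      have ht' : p * t ^ 3 + 3 * u * t ^ 2 + 3 * r * t + β = 0 := by
        simpa [Cubic.toPoly, Polynomial.IsRoot] using ht
      convert key 1 t (3 / 2 * u + t * p / 2) 0 (-3 / 2 * r - t * (3 / 2 * u + t * p / 2)) (-p / 2)
        (-q / 2) (Or.inl one_ne_zero) using 2
      · linear_combination ht'
      all_goals field_simp
      all_goals ring

/-- Adding a multiple of the reference element makes both simple coordinates nonzero. -/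
theorem isDenseOrbit_regular :
    IsDenseOrbit (G2 K) (adOrbit (G2 K) (nilSo hI 1 0 0 0 1 0)) (nilCone (g2 K)) := by
  refine ⟨⟨_, rfl⟩, ?_, ?_⟩
  · rintro _ ⟨g, hg, rfl⟩
    exact ⟨Ad_mem_g2 hg (nilSo_mem_g2 hI _ _ _ _ _ _), isNilpotent_Ad g ⟨7, regular_pow_seven hI⟩⟩
  · rintro D ⟨hD, hN⟩
    obtain ⟨g, hg, β, p, q, u, v, r, h⟩ := exists_conj_nilSo hI hD hN
    refine mem_zariskiClosure_of_Ad g (fun x hx => Ad_mem_adOrbit ((G2 K).inv_mem hg) hx) ?_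
    rw [h]
    have hγ : ∀ t : K, nilSo hI β p q u v r + t • nilSo hI 1 0 0 0 1 0 =
        nilSo hI (β + t) p q u (v + t) r := by
      intro t
      refine ext_ofSplit hI fun w => ?_
      change ((nilSo hI β p q u v r).1 + t • (nilSo hI 1 0 0 0 1 0).1) *ᵥ _ = _
      rw [Matrix.add_mulVec, Matrix.smul_mulVec, nilSo_mulVec, nilSo_mulVec, nilSo_mulVec,
        ← map_smul, ← map_add]
      congr 1
      refine split_ext ?_ (fun i => ?_) (fun i => ?_)
      · simp [nilLin_apply]
        ring
      · fin_cases i <;> simp [nilLin_apply] <;> ring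
      · fin_cases i <;> simp [nilLin_apply] <;> ring
    have := mem_zariskiClosure_of_curve (S := adOrbit (G2 K) (nilSo hI 1 0 0 0 1 0))
      (γ := fun t : K => nilSo hI β p q u v r + t • nilSo hI 1 0 0 0 1 0)
      (F := (Polynomial.X + Polynomial.C β) * (Polynomial.X + Polynomial.C v))
      (by
        have := (IsPolyCurve.const (nilSo hI β p q u v r).1).add
          ((IsPolyCurve.const (nilSo hI 1 0 0 0 1 0).1).smul Polynomial.X)
        simpa using this)
      (mul_ne_zero (Polynomial.X_add_C_ne_zero _) (Polynomial.X_add_C_ne_zero _))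
      (fun t ht => ?_) 0
    · simpa using this
    · rw [Polynomial.eval_mul] at ht
      simp only [hγ]
      exact nilSo_mem_regular hI (by simpa [add_comm] using left_ne_zero_of_mul ht)
        (by simpa [add_comm] using right_ne_zero_of_mul ht) _ _ _ _

/-- A nilpotent element that is not regular is conjugate to one with a vanishing simple coordinate,
and hence lies in the closure of the projected orbit. -/
theorem isSubregularOrbit_g2Part :
    IsSubregularOrbit (G2 K) (g2 K) (adOrbit (G2 K) (g2Part (basePoint hI))) := by
  refine ⟨_, isDenseOrbit_regular hI, ⟨_, rfl⟩, ?_, ?_⟩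
  · rintro _ ⟨g, hg, rfl⟩
    refine ⟨⟨Ad_mem_g2 hg (g2Part_mem _), isNilpotent_Ad g ⟨3, g2Part_basePoint_pow_three hI⟩⟩, ?_⟩
    -- the cube of a regular nilpotent element does not vanish
    rintro ⟨g', -, h⟩
    refine regular_pow_three_ne_zero hI ?_
    rw [← Ad_inv_Ad g' (nilSo hI 1 0 0 0 1 0), ← h]
    exact Ad_pow_eq_zero _ (Ad_pow_eq_zero _ (g2Part_basePoint_pow_three hI))
  · rintro D ⟨⟨hD, hN⟩, hR⟩
    obtain ⟨g, hg, β, p, q, u, v, r, h⟩ := exists_conj_nilSo hI hD hN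
    refine mem_zariskiClosure_of_Ad g (fun x hx => Ad_mem_adOrbit ((G2 K).inv_mem hg) hx) ?_
    rw [h]
    refine nilSo_mem_zariskiClosure hI ?_
    by_contra! hne
    refine hR (mem_adOrbit_of_Ad hg ?_)
    rw [h]
    exact nilSo_mem_regular hI hne.1 hne.2 _ _ _ _

/-- The octonionic case: the orbit of type `(3, 1⁴)` projected to the Lie algebra of `G₂`. -/
theorem octonion_case : ∃ hc : IsCompl (g2 K).toSubmodule (isotropy (g2 K)),
    IsOrbit ⊤ (nilOrbit K 7 [3, 1, 1, 1, 1]) ∧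
    IsGood (g2 K) (nilOrbit K 7 [3, 1, 1, 1, 1]) ∧
    (∃! Ω, IsDenseOrbit (G2 K) Ω (nilOrbit K 7 [3, 1, 1, 1, 1])) ∧
    HasHeight (nilOrbit K 7 [3, 1, 1, 1, 1]) 2 ∧
    ∀ Ω, IsDenseOrbit (G2 K) Ω (nilOrbit K 7 [3, 1, 1, 1, 1]) →
      IsSubregularOrbit (G2 K) (g2 K) (Submodule.projection _ _ hc '' Ω) ∧
      saturation (Submodule.projection _ _ hc '' Ω) = nilOrbit K 7 [3, 3, 1] ∧
      HasHeight (saturation (Submodule.projection _ _ hc '' Ω)) 4 := by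
  obtain ⟨I, hI⟩ := IsAlgClosed.exists_eq_mul_self (-1 : K)
  replace hI := hI.symm
  refine ⟨isCompl_g2, isOrbit_nilOrbit_three_one, isGood_g2,
    ⟨_, isDenseOrbit_openOrbit hI, fun _ => eq_openOrbit_of_isDenseOrbit hI⟩,
    hasHeight_nilOrbit_three_one, fun Ω hΩ => ?_⟩
  obtain rfl := eq_openOrbit_of_isDenseOrbit hI hΩ
  have h1 : Submodule.projection _ _ (isCompl_g2 (K := K)) '' adOrbit (G2 K) (basePoint hI) =
      adOrbit (G2 K) (g2Part (basePoint hI)) := by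
    rw [← image_g2Part_openOrbit]
    exact Set.image_congr fun e _ => projection_g2 e
  have h2 : saturation (adOrbit (G2 K) (g2Part (basePoint hI))) = nilOrbit K 7 [3, 3, 1] := by
    rw [nilOrbit_seven_eq (g2Part_basePoint_mem_nilOrbit hI)]
    ext x
    constructor
    · rintro ⟨g, _, ⟨g', -, rfl⟩, rfl⟩
      exact ⟨g * g', trivial, (Ad_mul _ _ _).symm⟩
    · rintro ⟨g, -, rfl⟩
      exact ⟨g, _, mem_adOrbit_self _ _, rfl⟩
  rw [h1, h2]
  exact ⟨isSubregularOrbit_g2Part hI, rfl, ⟨_, g2Part_basePoint_mem_nilOrbit hI⟩,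
    fun e he => height_four_of_mem_nilOrbit he⟩

end Subregular

end OrbitProj

theorem proposition4p8 (K : Type*) [Field K] [IsAlgClosed K] [CharZero K] :
    -- part (i), with `𝔤 = so_{n+1}`, `𝔥 = so_n`
    (∀ k m n : ℕ, 2 ≤ k → n + 1 = 4 * k + m →
      ∃ hc : IsCompl (OrbitProj.stdso K n).toSubmodule
          (OrbitProj.isotropy (OrbitProj.stdso K n)),
        (0 < m → OrbitProj.IsOrbit ⊤
          (OrbitProj.nilOrbit K (n + 1) (List.replicate (2 * k) 2 ++ List.replicate m 1))) ∧
        (m = 0 → ∃ O₁ O₂ : Set (OrbitProj.soLie K (n + 1)),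
          OrbitProj.IsOrbit ⊤ O₁ ∧ OrbitProj.IsOrbit ⊤ O₂ ∧ O₁ ≠ O₂ ∧
          O₁ ∪ O₂ = OrbitProj.nilOrbit K (n + 1) (List.replicate (2 * k) 2)) ∧
        ∀ O : Set (OrbitProj.soLie K (n + 1)), OrbitProj.IsOrbit ⊤ O →
          O ⊆ OrbitProj.nilOrbit K (n + 1) (List.replicate (2 * k) 2 ++ List.replicate m 1) →
          OrbitProj.IsGood (OrbitProj.stdso K n) O ∧
          (∃! Ω, OrbitProj.IsDenseOrbit (OrbitProj.stdSO K n) Ω O) ∧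
          OrbitProj.HasHeight O 2 ∧
          ∀ Ω, OrbitProj.IsDenseOrbit (OrbitProj.stdSO K n) Ω O →
            Submodule.projection _ _ hc '' Ω =
              OrbitProj.stdLieHom K n ''
                OrbitProj.nilOrbit K n
                  (3 :: (List.replicate (2 * k - 2) 2 ++ List.replicate m 1)) ∧
            OrbitProj.saturation (Submodule.projection _ _ hc '' Ω) =
              OrbitProj.nilOrbit K (n + 1)
                (3 :: (List.replicate (2 * k - 2) 2 ++ List.replicate (m + 1) 1)) ∧
            OrbitProj.HasHeight
              (OrbitProj.saturation (Submodule.projection _ _ hc '' Ω)) 3) ∧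
    -- part (ii), with `𝔤 = so_7` and `𝔥` the Lie algebra of `G₂`
    (∃ hc : IsCompl (OrbitProj.g2 K).toSubmodule (OrbitProj.isotropy (OrbitProj.g2 K)),
        OrbitProj.IsOrbit ⊤ (OrbitProj.nilOrbit K 7 [3, 1, 1, 1, 1]) ∧
        OrbitProj.IsGood (OrbitProj.g2 K) (OrbitProj.nilOrbit K 7 [3, 1, 1, 1, 1]) ∧
        (∃! Ω, OrbitProj.IsDenseOrbit (OrbitProj.G2 K) Ω
          (OrbitProj.nilOrbit K 7 [3, 1, 1, 1, 1])) ∧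
        OrbitProj.HasHeight (OrbitProj.nilOrbit K 7 [3, 1, 1, 1, 1]) 2 ∧
        ∀ Ω, OrbitProj.IsDenseOrbit (OrbitProj.G2 K) Ω
            (OrbitProj.nilOrbit K 7 [3, 1, 1, 1, 1]) →
          OrbitProj.IsSubregularOrbit (OrbitProj.G2 K) (OrbitProj.g2 K)
            (Submodule.projection _ _ hc '' Ω) ∧
          OrbitProj.saturation (Submodule.projection _ _ hc '' Ω) =
            OrbitProj.nilOrbit K 7 [3, 3, 1] ∧
          OrbitProj.HasHeight
            (OrbitProj.saturation (Submodule.projection _ _ hc '' Ω)) 4) := by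
  exact ⟨fun _ _ _ hk hN => OrbitProj.orthogonal_case hk hN, OrbitProj.octonion_case⟩
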